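/- **Proposition (Laplacian coflow for coclosed warped $\mathrm G_2$-structures).** Let $M$ be a smooth 6-manifold, $J\subseteq\mathbb R$ an interval with more than one point, and $\alpha,\beta\in\mathbb R$ with $\alpha^2+\beta^2=1$. Let $(\omega(t),\psi_+(t),\psi_-(t))$, $t\in J$, be a family of $\mathrm{SU}(3)$-structures on $M$, differentiable in $t$, i.e. for each $t$ there are, near every point of $M$, smooth 1-forms $e^1,\dots,e^6$, linearly independent and orthonormal for the metric, with $$\omega=e^{12}+e^{34}+e^{56},\quad \psi_+=e^{135}-e^{146}-e^{236}-e^{245},\quad \psi_-=-e^{246}+e^{235}+e^{145}+e^{136}.$$ Let $\ast_6$ be the Hodge star operator of the metric and of the volume form $\frac16\omega^3$, and let $\sigma_0,\pi_0\in C^\infty(M)$, $\pi_1,\nu_1\in\Omega^1(M)$, $\pi_2,\sigma_2\in\Omega^2_8(M)$, $\nu_3\in\Omega^3_{12}(M)$ (all depending on $t$) be the torsion forms, given by $$\begin{aligned} d\omega&=-\tfrac32\sigma_0\psi_++\tfrac32\pi_0\psi_-+\nu_1\wedge\omega+\nu_3,\\ d\psi_+&=\pi_0\,\omega^2+\pi_1\wedge\psi_+-\pi_2\wedge\omega,\\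 d\psi_-&=\sigma_0\,\omega^2+\pi_1\wedge\psi_--\sigma_2\wedge\omega,\end{aligned}$$ where $\Omega^2_8=\{\sigma:\sigma\wedge\psi_+=0,\ \ast_6\sigma=-\sigma\wedge\omega\}$ and $\Omega^3_{12}=\{\gamma:\gamma\wedge\omega=0,\ \gamma\wedge\psi_\pm=0\}$. Let $f:J\to\mathbb R\setminus\{0\}$ be differentiable (a warping function that is constant on $M$ for each $t$), let $s$ be the coordinate on $S^1$, and consider on $M\times S^1$ the warped $\mathrm G_2$-structures $$\varphi(t)=f(t)\,\omega(t)\wedge ds+\alpha\psi_+(t)-\beta\psi_-(t).$$ Let $\ast_t$ and $\Delta_t=dd^*+d^*d$ be the Hodge star operator and the Hodge Laplacian of the metric and the volume form induced by $\varphi(t)$ through $g_\varphi(X,Y)\,vol_\varphi=\frac16(\iota_X\varphi)\wedge(\iota_Y\varphi)\wedge\varphi$. Suppose that $\varphi(t)$ is coclosed, $d(\ast_t\varphi(t))=0$, for all $t\in J$. Then $\alpha\sigma_i(t)+\beta\pi_i(t)=0$ for $i=0,2$ and all $t\in J$, and $\varphi(t)$ is a solution of the Laplacian coflow $$\frac{\partial}{\partial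 t}(\ast_t\varphi(t))=-\Delta_t(\ast_t\varphi(t)),\qquad d(\ast_t\varphi(t))=0,\qquad t\in J,$$ if and only if, for all $t\in J$, $$\begin{aligned}\frac{\partial\omega^2}{\partial t}={}&-3(\alpha\pi_0-\beta\sigma_0)^2\omega^2+3(\alpha\pi_0-\beta\sigma_0)(\alpha\pi_2-\beta\sigma_2)\wedge\omega+2\,d(\ast_6\nu_3)\\&-3\,d(\alpha\pi_0-\beta\sigma_0)\wedge(\alpha\psi_+-\beta\psi_-),\\ \frac{f'}{f}(\beta\psi_++\alpha\psi_-)+\beta\frac{\partial\psi_+}{\partial t}+\alpha\frac{\partial\psi_-}{\partial t}={}&-(\alpha\pi_0-\beta\sigma_0)\left[-3\sigma_0\psi_++3\pi_0\psi_-+2\nu_3\right]\\&-d(\alpha\pi_2-\beta\sigma_2)-2\,d(\alpha\pi_0-\beta\sigma_0)\wedge\omega.\end{aligned}$$ -/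

import Mathlib

open scoped Manifold ContDiff

noncomputable section

namespace WarpedCoflow

/-! ### Exterior algebra on a real vector space -/

section LinearAlgebra

variable {V : Type*} [NormedAddCommGroup V] [NormedSpace ℝ V]

/-- The underlying algebraic alternating map of the exterior product, i.e. the signed sum over
`(p, q)`-shuffles (so that `(a ∧ b)(v, w) = a v * b w - a w * b v` for covectors). -/
def wedgeAux {p q : ℕ} (a : V [⋀^Fin p]→L[ℝ] ℝ) (b : V [⋀^Fin q]→L[ℝ] ℝ) :
    V [⋀^Fin (p + q)]→ₗ[ℝ] ℝ :=
  ((LinearMap.mul' ℝ ℝ).compAlternatingMap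
    (a.toAlternatingMap.domCoprod b.toAlternatingMap)).domDomCongr finSumFinEquiv

theorem continuous_wedgeAux {p q : ℕ} (a : V [⋀^Fin p]→L[ℝ] ℝ) (b : V [⋀^Fin q]→L[ℝ] ℝ) :
    Continuous (fun v => wedgeAux a b v) := by
  have h : (fun v => wedgeAux a b v) = fun v : Fin (p + q) → V =>
      ∑ σ : Equiv.Perm.ModSumCongr (Fin p) (Fin q), LinearMap.mul' ℝ ℝ
        (AlternatingMap.domCoprod.summand a.toAlternatingMap b.toAlternatingMap σ
          (fun i => v (finSumFinEquiv i))) := by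
    funext v
    simp [wedgeAux, AlternatingMap.domCoprod_apply, map_sum,
      Function.comp_def]
  rw [h]
  refine continuous_finsetSum _ fun σ _ => ?_
  induction σ using Quotient.inductionOn' with
  | _ σ =>
    have h2 : ∀ v : Fin (p + q) → V, LinearMap.mul' ℝ ℝ
        (AlternatingMap.domCoprod.summand a.toAlternatingMap b.toAlternatingMap
          (Quotient.mk'' σ) (fun i => v (finSumFinEquiv i))) =
        Equiv.Perm.sign σ • (a (fun i => v (finSumFinEquiv (σ (Sum.inl i)))) *
          b (fun i => v (finSumFinEquiv (σ (Sum.inr i))))) := by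
      intro v
      rw [AlternatingMap.domCoprod.summand_mk'']
      rcases Int.units_eq_one_or (Equiv.Perm.sign σ) with hs | hs <;> simp [hs]
    simp only [h2]
    have ha : Continuous fun v : Fin (p + q) → V =>
        a (fun i => v (finSumFinEquiv (σ (Sum.inl i)))) :=
      a.cont.comp (by fun_prop)
    have hb : Continuous fun v : Fin (p + q) → V =>
        b (fun i => v (finSumFinEquiv (σ (Sum.inr i)))) :=
      b.cont.comp (by fun_prop)
    exact (ha.mul hb).const_smul _

/-- The exterior product `a ∧ b`. -/
def wedge {p q : ℕ} (a : V [⋀^Fin p]→L[ℝ] ℝ) (b : V [⋀^Fin q]→L[ℝ] ℝ) :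
    V [⋀^Fin (p + q)]→L[ℝ] ℝ :=
  { wedgeAux a b with cont := continuous_wedgeAux a b }

/-- Transport of a form along an equality of degrees. -/
def castDeg {m n : ℕ} (h : m = n) (a : V [⋀^Fin m]→L[ℝ] ℝ) : V [⋀^Fin n]→L[ℝ] ℝ := h ▸ a

/-- `contract p w a = a (w₀, …, w_{p-1}, ⬝, …, ⬝)`. -/
def contract : (p : ℕ) → {q : ℕ} → (Fin p → V) → V [⋀^Fin (q + p)]→L[ℝ] ℝ →
    V [⋀^Fin q]→L[ℝ] ℝ
  | 0, _, _, a => a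
  | p + 1, q, w, a =>
    contract p (Fin.tail w) ((show V [⋀^Fin ((q + p) + 1)]→L[ℝ] ℝ from a).curryLeft (w 0))

/-- `e` is an orthonormal basis for the bilinear form `g`. -/
def IsOrthonormalBasis {n : ℕ} (g : LinearMap.BilinForm ℝ V) (e : Module.Basis (Fin n) ℝ V) :
    Prop :=
  ∀ i j, g (e i) (e j) = if i = j then 1 else 0

open Classical in
/-- The Hodge star of the inner product `g` and the volume form `vol`, from `p`-forms to `q`-forms
in dimension `q + p`:
`(⋆β)(v) = (1/p!) ∑_{i₁,…,i_p} β(e_{i₁},…,e_{i_p}) vol(e_{i₁},…,e_{i_p}, v)`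
for a `g`-orthonormal basis `e` (the result does not depend on `e`). With this convention
`α ∧ ⋆β = ⟨α, β⟩ vol`. -/
def hodgeStar {p q : ℕ} (g : LinearMap.BilinForm ℝ V) (vol : V [⋀^Fin (q + p)]→L[ℝ] ℝ)
    (β : V [⋀^Fin p]→L[ℝ] ℝ) : V [⋀^Fin q]→L[ℝ] ℝ :=
  if h : ∃ e : Module.Basis (Fin (q + p)) ℝ V, IsOrthonormalBasis g e then
    ((p.factorial : ℝ)⁻¹) • ∑ i : Fin p → Fin (q + p),
      β (fun k => h.choose (i k)) • contract p (fun k => h.choose (i k)) vol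
  else 0

/-- The monomial `e^i ∧ e^j` in the covectors `e`. -/
def mono2 {n : ℕ} (e : Fin n → V [⋀^Fin 1]→L[ℝ] ℝ) (i j : Fin n) : V [⋀^Fin 2]→L[ℝ] ℝ :=
  wedge (e i) (e j)

/-- The monomial `e^i ∧ e^j ∧ e^k` in the covectors `e`. -/
def mono3 {n : ℕ} (e : Fin n → V [⋀^Fin 1]→L[ℝ] ℝ) (i j k : Fin n) : V [⋀^Fin 3]→L[ℝ] ℝ :=
  wedge (mono2 e i j) (e k)

/-- `e` is an adapted coframe of the linear `SU(3)`-structure `(g, w, ψ₊, ψ₋)` on the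
6-dimensional space `V` (indices are shifted: `e 0, …, e 5` are `e¹, …, e⁶`). -/
structure IsAdaptedCoframe (e : Fin 6 → V [⋀^Fin 1]→L[ℝ] ℝ) (g : LinearMap.BilinForm ℝ V)
    (w : V [⋀^Fin 2]→L[ℝ] ℝ) (ψp ψm : V [⋀^Fin 3]→L[ℝ] ℝ) : Prop where
  linearIndependent : LinearIndependent ℝ e
  metric_eq : ∀ X Y : V, g X Y = ∑ i, e i (fun _ => X) * e i (fun _ => Y)
  omega_eq : w = mono2 e 0 1 + mono2 e 2 3 + mono2 e 4 5
  psiPlus_eq : ψp = mono3 e 0 2 4 - mono3 e 0 3 5 - mono3 e 1 2 5 - mono3 e 1 3 4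
  psiMinus_eq : ψm = -mono3 e 1 3 5 + mono3 e 1 2 4 + mono3 e 0 3 4 + mono3 e 0 2 5

/-- `w² = w ∧ w`. -/
def sq (w : V [⋀^Fin 2]→L[ℝ] ℝ) : V [⋀^Fin 4]→L[ℝ] ℝ := wedge w w

/-- The volume form `w³ / 3!` of a linear `SU(3)`-structure. -/
def vol6 (w : V [⋀^Fin 2]→L[ℝ] ℝ) : V [⋀^Fin 6]→L[ℝ] ℝ := (1 / 6 : ℝ) • wedge (sq w) w

/-- The 7-form `(ι_X φ) ∧ (ι_Y φ) ∧ φ`. -/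
def bryantForm (φ : V [⋀^Fin 3]→L[ℝ] ℝ) (X Y : V) : V [⋀^Fin 7]→L[ℝ] ℝ :=
  wedge (wedge (φ.curryLeft X) (φ.curryLeft Y)) φ

/-- The 3-form `φ` on the 7-dimensional space `V` determines the inner product `g` and the volume
form `vol`: `g(X, Y) vol = (1/6) (ι_X φ) ∧ (ι_Y φ) ∧ φ`, where `g` is positive definite and `vol`
is a volume form of `g`. (There is at most one such pair.) -/
def Induces (φ : V [⋀^Fin 3]→L[ℝ] ℝ) (g : LinearMap.BilinForm ℝ V)
    (vol : V [⋀^Fin 7]→L[ℝ] ℝ) : Prop :=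
  (∀ X Y : V, g X Y • vol = (1 / 6 : ℝ) • bryantForm φ X Y) ∧
    ∃ e : Module.Basis (Fin 7) ℝ V, IsOrthonormalBasis g e ∧ vol (fun i => e i) = 1

/-- `φ` is a linear `G₂`-structure: it determines an inner product and a volume form. -/
def IsG2 (φ : V [⋀^Fin 3]→L[ℝ] ℝ) : Prop :=
  ∃ P : LinearMap.BilinForm ℝ V × V [⋀^Fin 7]→L[ℝ] ℝ, Induces φ P.1 P.2

open Classical in
/-- The inner product `g_φ` induced by a linear `G₂`-structure `φ`. -/
def g2Metric (φ : V [⋀^Fin 3]→L[ℝ] ℝ) : LinearMap.BilinForm ℝ V :=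
  if h : IsG2 φ then h.choose.1 else 0

open Classical in
/-- The volume form `vol_φ` induced by a linear `G₂`-structure `φ`. -/
def g2Vol (φ : V [⋀^Fin 3]→L[ℝ] ℝ) : V [⋀^Fin 7]→L[ℝ] ℝ :=
  if h : IsG2 φ then h.choose.2 else 0

end LinearAlgebra

/-! ### Differential forms on manifolds -/

section Forms

variable {E : Type*} [NormedAddCommGroup E] [NormedSpace ℝ E] {H : Type*} [TopologicalSpace H]
  {E' : Type*} [NormedAddCommGroup E'] [NormedSpace ℝ E'] {H' : Type*} [TopologicalSpace H']

/-- Differential `k`-forms (not necessarily smooth) on a manifold `M` with model `I`. The tangent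
space `TangentSpace I x` is by definition the model vector space `E`. -/
abbrev Form (_I : ModelWithCorners ℝ E H) (M : Type*) (k : ℕ) : Type _ :=
  M → E [⋀^Fin k]→L[ℝ] ℝ

/-- The pull-back `F^* η` of a differential form. -/
def pullback (I : ModelWithCorners ℝ E H) (I' : ModelWithCorners ℝ E' H')
    {M : Type*} [TopologicalSpace M] [ChartedSpace H M]
    {N : Type*} [TopologicalSpace N] [ChartedSpace H' N] {k : ℕ} (F : M → N)
    (η : Form I' N k) : Form I M k :=
  fun x => (η (F x)).compContinuousLinearMap (mfderiv I I' F x : E →L[ℝ] E')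

variable (I : ModelWithCorners ℝ E H) {M : Type*} [TopologicalSpace M] [ChartedSpace H M]

/-- The expression of a differential form in the preferred chart at `x`: its pull-back under the
inverse of the chart. -/
def coordForm {k : ℕ} (η : Form I M k) (x : M) : E → E [⋀^Fin k]→L[ℝ] ℝ :=
  fun y => (η ((extChartAt I x).symm y)).compContinuousLinearMap
    (mfderivWithin 𝓘(ℝ, E) I (extChartAt I x).symm (Set.range I) y : E →L[ℝ] E)

/-- The exterior derivative of a differential form on a manifold: at `x`, the exterior derivative
of its expression in the chart at `x`, pulled back under this chart. -/
def extD {k : ℕ} (η : Form I M k) : Form I M (k + 1) :=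
  fun x => (extDerivWithin (coordForm I η x) (Set.range I)
      (extChartAt I x x)).compContinuousLinearMap
    (mfderiv I 𝓘(ℝ, E) (extChartAt I x) x : E →L[ℝ] E)

/-- The differential of a function, as a 1-form. -/
def funD (c : M → ℝ) : Form I M 1 :=
  fun x => ContinuousAlternatingMap.ofSubsingleton ℝ E ℝ (0 : Fin 1)
    (mfderiv I 𝓘(ℝ, ℝ) c x : E →L[ℝ] ℝ)

/-- Smoothness of a differential form on a set `U`, in charts. -/
def IsSmoothOn {k : ℕ} (U : Set M) (η : Form I M k) : Prop :=
  ∀ x : M, ContDiffOn ℝ ∞ (coordForm I η x)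
    ((extChartAt I x).target ∩ (extChartAt I x).symm ⁻¹' U)

/-- Smoothness of a differential form. -/
def IsSmooth {k : ℕ} (η : Form I M k) : Prop := IsSmoothOn I Set.univ η

/-! ### `G₂`-structures and the Laplacian coflow on a 7-manifold -/

/-- A `G₂`-structure on a 7-manifold. -/
def IsG2Structure (φ : Form I M 3) : Prop :=
  IsSmooth I φ ∧ ∀ x, IsG2 (φ x)

/-- The Hodge star operator `⋆_φ` from `p`-forms to `q`-forms, `q + p = 7`, of the metric and the
volume form induced by `φ`. -/
def star7 {p q : ℕ} (h : q + p = 7) (φ : Form I M 3) (η : Form I M p) : Form I M q :=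
  fun x => hodgeStar (g2Metric (φ x))
    (castDeg h.symm (g2Vol (φ x))) (η x)

/-- The codifferential `d^* = (-1)^{k+1} ⋆ d ⋆` on `(k+1)`-forms on a 7-manifold with
`G₂`-structure `φ`. Here `q = 7 - (k + 1)`. -/
def codiff {k q : ℕ} (h : q + (k + 1) = 7) (φ : Form I M 3) (η : Form I M (k + 1)) :
    Form I M k :=
  (-1 : ℝ) ^ (k + 1) • star7 I (p := q + 1) (q := k) (by omega) φ (extD I (star7 I h φ η))

/-- The Hodge Laplacian `Δ_φ = d d^* + d^* d` on 4-forms on a 7-manifold with `G₂`-structure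
`φ`. -/
def laplacian4 (φ : Form I M 3) (χ : Form I M 4) : Form I M 4 :=
  extD I (codiff I (k := 3) (q := 3) rfl φ χ) + codiff I (k := 4) (q := 2) rfl φ (extD I χ)

/-- The 4-form `⋆_φ φ`. -/
def starPhi (φ : Form I M 3) : Form I M 4 := star7 I (p := 3) (q := 4) rfl φ φ

/-- `φ` is coclosed: `d (⋆_φ φ) = 0`. -/
def IsCoclosed (φ : Form I M 3) : Prop := extD I (starPhi I φ) = 0

/-- The one-parameter family `φ(t)`, `t ∈ J`, of `G₂`-structures solves the Laplacian coflow: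
`∂/∂t (⋆_t φ(t)) = - Δ_t (⋆_t φ(t))` and `d (⋆_t φ(t)) = 0`. -/
def IsLaplacianCoflow (J : Set ℝ) (φ : ℝ → Form I M 3) : Prop :=
  ∀ t ∈ J, IsG2Structure I (φ t) ∧ IsCoclosed I (φ t) ∧
    ∀ x, HasDerivWithinAt (fun τ => starPhi I (φ τ) x)
      (-laplacian4 I (φ t) (starPhi I (φ t)) x) J t

end Forms

/-! ### `SU(3)`-structures on a 6-manifold and their torsion forms -/

/-- The model space of 6-manifolds. -/
abbrev E6 : Type := EuclideanSpace ℝ (Fin 6)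

section SU3

variable (M : Type*) [TopologicalSpace M] [ChartedSpace E6 M]

/-- An `SU(3)`-structure `(g, ω, ψ₊, ψ₋)` on a 6-manifold, described through local adapted
coframes. -/
structure SU3Structure where
  metric : M → LinearMap.BilinForm ℝ E6
  omega : Form (𝓡 6) M 2
  psiPlus : Form (𝓡 6) M 3
  psiMinus : Form (𝓡 6) M 3
  smooth_omega : IsSmooth (𝓡 6) omega
  smooth_psiPlus : IsSmooth (𝓡 6) psiPlus
  smooth_psiMinus : IsSmooth (𝓡 6) psiMinus
  exists_coframe : ∀ x : M, ∃ U : Set M, IsOpen U ∧ x ∈ U ∧ ∃ e : Fin 6 → Form (𝓡 6) M 1,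
    (∀ i, IsSmoothOn (𝓡 6) U (e i)) ∧
    ∀ y ∈ U, IsAdaptedCoframe (fun i => e i y) (metric y) (omega y) (psiPlus y) (psiMinus y)

variable {M}

/-- The 4-form `ω²`. -/
def SU3Structure.omegaSq (s : SU3Structure M) : Form (𝓡 6) M 4 := fun x => sq (s.omega x)

/-- The Hodge star operator of an `SU(3)`-structure from `p`-forms to `q`-forms, `q + p = 6`. -/
def star6 {p q : ℕ} (h : q + p = 6) (s : SU3Structure M) (η : Form (𝓡 6) M p) :
    Form (𝓡 6) M q :=
  fun x => hodgeStar (s.metric x) (castDeg h.symm (vol6 (s.omega x))) (η x)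

/-- `σ ∈ Ω²₈`: primitive forms of type `(1,1)`, i.e. `σ ∧ ψ₊ = 0` and `⋆σ = - σ ∧ ω`. -/
def IsOmega28 (s : SU3Structure M) (σ : Form (𝓡 6) M 2) : Prop :=
  ∀ x, wedge (σ x) (s.psiPlus x) = 0 ∧
    star6 (p := 2) (q := 4) rfl s σ x = -wedge (σ x) (s.omega x)

/-- `γ ∈ Ω³₁₂`: `γ ∧ ω = 0` and `γ ∧ ψ₊ = γ ∧ ψ₋ = 0`. -/
def IsOmega312 (s : SU3Structure M) (γ : Form (𝓡 6) M 3) : Prop :=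
  ∀ x, wedge (γ x) (s.omega x) = 0 ∧ wedge (γ x) (s.psiPlus x) = 0 ∧
    wedge (γ x) (s.psiMinus x) = 0

/-- The torsion forms of an `SU(3)`-structure, determined by
`dω = -(3/2) σ₀ ψ₊ + (3/2) π₀ ψ₋ + ν₁ ∧ ω + ν₃`,
`dψ₊ = π₀ ω² + π₁ ∧ ψ₊ - π₂ ∧ ω`, `dψ₋ = σ₀ ω² + π₁ ∧ ψ₋ - σ₂ ∧ ω`. -/
structure SU3Torsion (s : SU3Structure M) where
  sigma0 : M → ℝ
  pi0 : M → ℝ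
  pi1 : Form (𝓡 6) M 1
  nu1 : Form (𝓡 6) M 1
  pi2 : Form (𝓡 6) M 2
  sigma2 : Form (𝓡 6) M 2
  nu3 : Form (𝓡 6) M 3
  smooth_sigma0 : ContMDiff (𝓡 6) 𝓘(ℝ, ℝ) ∞ sigma0
  smooth_pi0 : ContMDiff (𝓡 6) 𝓘(ℝ, ℝ) ∞ pi0
  smooth_pi1 : IsSmooth (𝓡 6) pi1
  smooth_nu1 : IsSmooth (𝓡 6) nu1
  smooth_pi2 : IsSmooth (𝓡 6) pi2
  smooth_sigma2 : IsSmooth (𝓡 6) sigma2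
  smooth_nu3 : IsSmooth (𝓡 6) nu3
  pi2_mem : IsOmega28 s pi2
  sigma2_mem : IsOmega28 s sigma2
  nu3_mem : IsOmega312 s nu3
  extD_omega : ∀ x, extD (𝓡 6) s.omega x =
    (-(3 / 2) * sigma0 x) • s.psiPlus x + (3 / 2 * pi0 x) • s.psiMinus x
      + wedge (nu1 x) (s.omega x) + nu3 x
  extD_psiPlus : ∀ x, extD (𝓡 6) s.psiPlus x =
    pi0 x • s.omegaSq x + wedge (pi1 x) (s.psiPlus x) - wedge (pi2 x) (s.omega x)
  extD_psiMinus : ∀ x, extD (𝓡 6) s.psiMinus x =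
    sigma0 x • s.omegaSq x + wedge (pi1 x) (s.psiMinus x) - wedge (sigma2 x) (s.omega x)

/-! ### Warped `G₂`-structures on `M × S¹` -/

/-- The model of `M × S¹`. -/
abbrev I7 : ModelWithCorners ℝ (E6 × EuclideanSpace ℝ (Fin 1))
    (ModelProd E6 (EuclideanSpace ℝ (Fin 1))) :=
  (𝓡 6).prod (𝓡 1)

/-- The 1-form `ds` on the unit circle, where `s` is the angular coordinate: for `z = exp (i s)`,
`ds = Im (z̄ dz)`. -/
def ds : Form (𝓡 1) Circle 1 :=
  fun z => ContinuousAlternatingMap.ofSubsingleton ℝ (EuclideanSpace ℝ (Fin 1)) ℝ (0 : Fin 1)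
    (Complex.imCLM ∘L (ContinuousLinearMap.mul ℝ ℂ ((starRingEnd ℂ) (z : ℂ))) ∘L
      (mfderiv (𝓡 1) 𝓘(ℝ, ℂ) (fun w : Circle => (w : ℂ)) z : EuclideanSpace ℝ (Fin 1) →L[ℝ] ℂ))

/-- The warped `G₂`-structure `φ = f ω ∧ ds + (α ψ₊ - β ψ₋)` on `M × S¹`, for a warping function
`f` that is constant on `M`. -/
def warpedG2 (α β f : ℝ) (s : SU3Structure M) : Form I7 (M × Circle) 3 :=
  fun x =>
    f • wedge (pullback I7 (𝓡 6) Prod.fst s.omega x) (pullback I7 (𝓡 1) Prod.snd ds x)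
      + (α • pullback I7 (𝓡 6) Prod.fst s.psiPlus x
        - β • pullback I7 (𝓡 6) Prod.fst s.psiMinus x)

/-- A family of differential forms is differentiable in `t ∈ J` (at every point). -/
def TimeDifferentiable {k : ℕ} (J : Set ℝ) (η : ℝ → Form (𝓡 6) M k) : Prop :=
  ∀ x, DifferentiableOn ℝ (fun t => η t x) J

/-- The time derivative `∂η/∂t` of a family of differential forms `η(t)`, `t ∈ J`. -/
def timeDeriv {k : ℕ} (J : Set ℝ) (η : ℝ → Form (𝓡 6) M k) (t : ℝ) : Form (𝓡 6) M k :=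
  fun x => derivWithin (fun τ => η τ x) J t

end SU3

end WarpedCoflow

end

open scoped Manifold ContDiff

noncomputable section

namespace WarpedCoflow

/-! ### The shuffle product of functions on lists -/

section Shuffle

variable {ι κ R : Type*} [CommRing R]

/-! Put ψ = αψ₊ − βψ₋ and ψ̂ = βψ₊ + αψ₋, the real and imaginary parts of (α + iβ)(ψ₊ + iψ₋). As α²
+ β² = 1, (ω, ψ, ψ̂) is again an SU(3)-structure with the same metric (`IsAdaptedCoframe.rotate`),
and with θ = f ds as seventh covector φ = ω ∧ θ + ψ is the standard G₂-form. So θ is a unit covector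
orthogonal to M, ⋆₇(A + B ∧ θ) is expressed by ⋆₆A and ⋆₆B (`star_lift_three`, `star_lift_four`),
and ⋆φ = ω²/2 + ψ̂ ∧ θ. As f is constant on M and ds is closed, d acts on A and B separately
(`extD_liftM`).

Coclosedness thus means d(ω²) = 0 and dψ̂ = 0. The first forces ν₁ = 0; the second, by the splitting
of 4-forms into multiples of ω², Λ¹ ∧ ψ̂ and Λ²₈ ∧ ω, forces π₁ = 0 and ασᵢ + βπᵢ = 0
(`SU3Torsion.coclosed`). With p₀ = απ₀ − βσ₀ and p₂ = απ₂ − βσ₂ what remains is dω = (3/2)p₀ψ̂ + ν₃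
and dψ = p₀ω² − p₂ ∧ ω. Since ⋆φ is closed and ⋆⋆φ = φ, Δ⋆φ = d⋆dφ, where ⋆dφ = (3/2)p₀ψ − ⋆₆ν₃ +
(2p₀ω + p₂) ∧ θ (`codiff_starPhi`). Its differential (`laplacian_starPhi`) has two components;
comparing them with the time derivatives of ω²/2 and fψ̂ gives the two evolution equations
(`isLaplacianCoflow_iff`).

Most of the file makes exterior algebra computable. The exterior product, a sum over a quotient of a
permutation group, becomes a recursion on lists of vectors (`ev_wedge`), which yields graded
commutativity, the Leibniz rule and explicit components. A form is determined by its values on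
increasing lists of basis vectors (`ev_ext_basis`), so identities between the standard forms are
finite checks over the integers. Objects defined through a choice are pinned down separately: the
metric and volume of φ by `Induces.unique`, the Hodge star by `hodgeStar_eq`, and the
differentiability of ⋆₆ν₃ by `formDifferentiableAt_star6`. -/

/-- The exterior product on the level of functions on lists: `s = (-1)^p` for `a` of degree `p`. -/
def shuffle : R → (List ι → R) → (List ι → R) → List ι → R
  | _, a, b, [] => a [] * b []
  | s, a, b, x :: l => shuffle (-s) (fun m => a (x :: m)) b l + s * shuffle s a (fun m => b (x :: m)) l

/-- The alternating sum `∑ (-1)^i L (l i) (l without l i)`. -/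
def altSum : (ι → List ι → R) → List ι → R
  | _, [] => 0
  | L, x :: l => L x l - altSum (fun y m => L y (x :: m)) l

theorem shuffle_nil (s : R) (a b : List ι → R) : shuffle s a b [] = a [] * b [] := rfl

theorem shuffle_cons (s : R) (a b : List ι → R) (x : ι) (l : List ι) :
    shuffle s a b (x :: l) = shuffle (-s) (fun m => a (x :: m)) b l +
      s * shuffle s a (fun m => b (x :: m)) l := rfl

theorem shuffle_add_left (s : R) (a a' b : List ι → R) (l : List ι) :
    shuffle s (fun m => a m + a' m) b l = shuffle s a b l + shuffle s a' b l := by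
  induction l generalizing s a a' b with
  | nil => simp only [shuffle]; ring
  | cons x l ih => simp only [shuffle, ih]; ring

theorem shuffle_add_right (s : R) (a b b' : List ι → R) (l : List ι) :
    shuffle s a (fun m => b m + b' m) l = shuffle s a b l + shuffle s a b' l := by
  induction l generalizing s a b b' with
  | nil => simp only [shuffle]; ring
  | cons x l ih => simp only [shuffle, ih]; ring

theorem shuffle_smul_left (s c : R) (a b : List ι → R) (l : List ι) :
    shuffle s (fun m => c * a m) b l = c * shuffle s a b l := by
  induction l generalizing s a b with
  | nil => simp only [shuffle]; ring
  | cons x l ih => simp only [shuffle, ih]; ring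

theorem shuffle_smul_right (s c : R) (a b : List ι → R) (l : List ι) :
    shuffle s a (fun m => c * b m) l = c * shuffle s a b l := by
  induction l generalizing s a b with
  | nil => simp only [shuffle]; ring
  | cons x l ih => simp only [shuffle, ih]; ring

theorem shuffle_zero_left (s : R) (b : List ι → R) (l : List ι) :
    shuffle s (fun _ => 0) b l = 0 := by
  simpa using shuffle_smul_left s 0 (fun _ => 0) b l

theorem shuffle_zero_right (s : R) (a : List ι → R) (l : List ι) :
    shuffle s a (fun _ => 0) l = 0 := by
  simpa using shuffle_smul_right s 0 a (fun _ => 0) l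

/-- Induction on the list: if the head goes to `a`, then p drops by one and (-1)^(p*q) changes by
(-1)^q, which is the price of moving the head past `b` on the other side. Vanishing off the degrees
ties the signs to p and q and removes the branches where a factor of degree 0 would receive a
vector. -/
theorem shuffle_comm (p q : ℕ) (a b : List ι → R) (l : List ι)
    (ha : ∀ m : List ι, m.length ≠ p → a m = 0) (hb : ∀ m : List ι, m.length ≠ q → b m = 0) :
    shuffle ((-1) ^ p) a b l = (-1) ^ (p * q) * shuffle ((-1) ^ q) b a l := by
  induction l generalizing p q a b with
  | nil =>
    simp only [shuffle]
    rcases Nat.eq_zero_or_pos p with rfl | hp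
    · simp [mul_comm]
    · simp [ha [] (by simpa using hp.ne)]
  | cons x l ih =>
    have h1 : shuffle (-(-1) ^ p) (fun m => a (x :: m)) b l =
        (-1) ^ (p * q) * ((-1) ^ q * shuffle ((-1) ^ q) b (fun m => a (x :: m)) l) := by
      rcases p with _ | p
      · rw [show (fun m => a (x :: m)) = fun _ => 0 from funext fun m => ha _ (by simp),
          shuffle_zero_left, shuffle_zero_right]
        ring
      · rw [show (-(-1 : R) ^ (p + 1)) = (-1) ^ p by ring,
          ih p q _ b (fun m hm => ha _ (by simpa using hm)) hb, ← mul_assoc, ← pow_add]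
        congr 1
        rw [show (p + 1) * q + q = p * q + 2 * q by ring, pow_add, pow_mul (-1 : R) 2 q]
        simp
    have h2 : (-1) ^ p * shuffle ((-1) ^ p) a (fun m => b (x :: m)) l =
        (-1) ^ (p * q) * shuffle (-(-1) ^ q) (fun m => b (x :: m)) a l := by
      rcases q with _ | q
      · rw [show (fun m => b (x :: m)) = fun _ => 0 from funext fun m => hb _ (by simp),
          shuffle_zero_left, shuffle_zero_right]
        ring
      · rw [show (-(-1 : R) ^ (q + 1)) = (-1) ^ q by ring,
          ih p q a _ ha (fun m hm => hb _ (by simpa using hm)), ← mul_assoc, ← pow_add]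
        congr 2
        ring
    rw [shuffle_cons, shuffle_cons, h1, h2]
    ring

theorem shuffle_map (f : κ → ι) (s : R) (a b : List ι → R) (l : List κ) :
    shuffle s a b (l.map f) = shuffle s (fun m => a (m.map f)) (fun m => b (m.map f)) l := by
  induction l generalizing s a b with
  | nil => rfl
  | cons x l ih => simp only [List.map_cons, shuffle_cons, ih]

theorem altSum_add (L L' : ι → List ι → R) (l : List ι) :
    altSum (fun y m => L y m + L' y m) l = altSum L l + altSum L' l := by
  induction l generalizing L L' with
  | nil => simp [altSum]
  | cons x l ih => simp only [altSum, ih]; ring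

theorem altSum_smul (c : R) (L : ι → List ι → R) (l : List ι) :
    altSum (fun y m => c * L y m) l = c * altSum L l := by
  induction l generalizing L with
  | nil => simp [altSum]
  | cons x l ih => simp only [altSum, ih]; ring

/-- First half of the Leibniz rule for d, with `L y` in the role of the derivative of the left
factor along `y`. Alternating raises the degree of that factor by one, so its sign becomes -s. -/
theorem altSum_shuffle_left (s : R) (L : ι → List ι → R) (b : List ι → R) (l : List ι) :
    altSum (fun y => shuffle s (L y) b) l = shuffle (-s) (altSum L) b l := by
  induction l generalizing s L b with
  | nil => simp [altSum, shuffle]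
  | cons x l ih =>
    have h := shuffle_add_left (- -s) (L x) (fun m => -1 * altSum (fun y m => L y (x :: m)) m) b l
    rw [shuffle_smul_left] at h
    simp only [shuffle_cons, altSum, altSum_add, altSum_smul, ih]
    rw [show (fun m => L x m - altSum (fun y m => L y (x :: m)) m) =
      fun m => L x m + -1 * altSum (fun y m => L y (x :: m)) m by funext m; ring, h]
    simp only [neg_neg]; ring

/-- Second half of the Leibniz rule: the direction of differentiation must pass `a`, which costs s.
The relation s² = 1 settles the term whose direction of differentiation is the head of the list. -/
theorem altSum_shuffle_right (s : R) (hs : s * s = 1) (a : List ι → R) (L : ι → List ι → R)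
    (l : List ι) :
    altSum (fun y => shuffle s a (L y)) l = s * shuffle s a (altSum L) l := by
  induction l generalizing s L a with
  | nil => simp [altSum, shuffle]
  | cons x l ih =>
    have h := shuffle_add_right s a (L x) (fun m => -1 * altSum (fun y m => L y (x :: m)) m) l
    rw [shuffle_smul_right] at h
    simp only [shuffle_cons, altSum, altSum_add, altSum_smul, ih s hs, ih (-s) (by simpa using hs)]
    rw [show (fun m => L x m - altSum (fun y m => L y (x :: m)) m) =
      fun m => L x m + -1 * altSum (fun y m => L y (x :: m)) m by funext m; ring, h]
    linear_combination (-shuffle s a (L x) l) * hs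

end Shuffle

/-! ### Alternating forms as functions on lists of vectors -/

section Eval

variable {V V' : Type*} [NormedAddCommGroup V] [NormedSpace ℝ V]
  [NormedAddCommGroup V'] [NormedSpace ℝ V']

/-- The value of a form on a list of vectors, zero if the length of the list is not the degree. -/
def ev {k : ℕ} (a : V [⋀^Fin k]→L[ℝ] ℝ) (l : List V) : ℝ :=
  if h : l.length = k then a (fun i => l.get (i.cast h.symm)) else 0

theorem ev_of_length_ne {k : ℕ} (a : V [⋀^Fin k]→L[ℝ] ℝ) {l : List V} (h : l.length ≠ k) :
    ev a l = 0 := dif_neg h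

theorem ev_ofFn {k : ℕ} (a : V [⋀^Fin k]→L[ℝ] ℝ) (v : Fin k → V) : ev a (List.ofFn v) = a v := by
  rw [ev, dif_pos (List.length_ofFn)]
  congr 1
  funext i
  simp

theorem ev_ext {k : ℕ} {a b : V [⋀^Fin k]→L[ℝ] ℝ} (h : ∀ l, ev a l = ev b l) : a = b := by
  ext v
  rw [← ev_ofFn, h, ev_ofFn]

theorem ev_castDeg {m n : ℕ} (h : m = n) (a : V [⋀^Fin m]→L[ℝ] ℝ) (l : List V) :
    ev (castDeg h a) l = ev a l := by
  subst h; rfl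

theorem ev_add {k : ℕ} (a b : V [⋀^Fin k]→L[ℝ] ℝ) (l : List V) :
    ev (a + b) l = ev a l + ev b l := by
  unfold ev; split_ifs <;> simp

theorem ev_sub {k : ℕ} (a b : V [⋀^Fin k]→L[ℝ] ℝ) (l : List V) :
    ev (a - b) l = ev a l - ev b l := by
  unfold ev; split_ifs <;> simp

theorem ev_neg {k : ℕ} (a : V [⋀^Fin k]→L[ℝ] ℝ) (l : List V) : ev (-a) l = -ev a l := by
  unfold ev; split_ifs <;> simp

theorem ev_smul {k : ℕ} (c : ℝ) (a : V [⋀^Fin k]→L[ℝ] ℝ) (l : List V) :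
    ev (c • a) l = c * ev a l := by
  unfold ev; split_ifs <;> simp

theorem ev_zero {k : ℕ} (l : List V) : ev (0 : V [⋀^Fin k]→L[ℝ] ℝ) l = 0 := by
  unfold ev; split_ifs <;> simp

theorem ev_sum {k : ℕ} {ι : Type*} (s : Finset ι) (a : ι → V [⋀^Fin k]→L[ℝ] ℝ) (l : List V) :
    ev (∑ i ∈ s, a i) l = ∑ i ∈ s, ev (a i) l := by
  unfold ev; split_ifs <;> simp

theorem ev_singleton (a : V [⋀^Fin 1]→L[ℝ] ℝ) (x : V) : ev a [x] = a (fun _ => x) := by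
  rw [← ev_ofFn]; rfl

theorem ev_cons {k : ℕ} (a : V [⋀^Fin (k + 1)]→L[ℝ] ℝ) (x : V) (l : List V) :
    ev a (x :: l) = ev (a.curryLeft x) l := by
  by_cases h : l.length = k
  · rw [ev, ev, dif_pos (by simpa using h), dif_pos h]
    simp only [ContinuousAlternatingMap.curryLeft_apply_apply]
    congr 1
    funext i
    refine Fin.cases ?_ (fun i => ?_) i <;> simp
  · rw [ev_of_length_ne _ h, ev_of_length_ne _ (by simpa using h)]

theorem ev_cons_zero (a : V [⋀^Fin 0]→L[ℝ] ℝ) (x : V) (l : List V) : ev a (x :: l) = 0 :=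
  ev_of_length_ne _ (by simp)

theorem ev_comp {k : ℕ} (a : V' [⋀^Fin k]→L[ℝ] ℝ) (L : V →L[ℝ] V') (l : List V) :
    ev (a.compContinuousLinearMap L) l = ev a (l.map L) := by
  by_cases h : l.length = k
  · rw [ev, ev, dif_pos h, dif_pos (by simpa using h)]
    simp only [ContinuousAlternatingMap.compContinuousLinearMap_apply]
    congr 1
    funext i
    simp
  · rw [ev_of_length_ne _ h, ev_of_length_ne _ (by simpa using h)]

theorem ev_contract (p : ℕ) {q : ℕ} (w : Fin p → V) (a : V [⋀^Fin (q + p)]→L[ℝ] ℝ) (l : List V) :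
    ev (contract p w a) l = ev a (List.ofFn w ++ l) := by
  induction p with
  | zero => simp [contract]
  | succ p ih =>
    rw [contract, ih, List.ofFn_succ, List.cons_append]
    exact (ev_cons (k := q + p) a _ _).symm

theorem ev_ofSubsingleton (L : V →L[ℝ] ℝ) (x : V) :
    ev (ContinuousAlternatingMap.ofSubsingleton ℝ V ℝ (0 : Fin 1) L) [x] = L x := by
  rw [ev_singleton]; rfl

theorem _root_.List.ofFn_insertNth {α : Type*} {n : ℕ} (j : Fin (n + 1)) (x : α) (v : Fin n → α) :
    List.ofFn (Fin.insertNth (α := fun _ => α) j x v) = (List.ofFn v).insertIdx j x := by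
  refine List.ext_getElem ?_ fun i h1 h2 => ?_
  · rw [List.length_insertIdx_of_le_length (by simpa using Nat.lt_succ_iff.1 j.2)]
    simp
  · rw [List.getElem_ofFn, List.getElem_insertIdx]
    have hi : i < n + 1 := by simpa using h1
    rcases Fin.eq_self_or_eq_succAbove j ⟨i, hi⟩ with h | ⟨k, h⟩
    · subst h
      simp
    · rw [h, Fin.insertNth_apply_succAbove]
      rcases lt_or_ge k.castSucc j with hk | hk
      · rw [Fin.succAbove_of_castSucc_lt _ _ hk] at h
        have hik : i = k := by simpa using congrArg Fin.val h
        have : i < j := by rw [hik]; exact hk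
        rw [dif_pos this]
        simp [hik]
      · rw [Fin.succAbove_of_le_castSucc _ _ hk] at h
        have hik : i = k + 1 := by simpa using congrArg Fin.val h
        have : (j : ℕ) ≤ k := hk
        have h3 : ¬ i < j := by omega
        have h4 : ¬ i = j := by omega
        rw [dif_neg h3, dif_neg h4]
        simp [hik]

/-- Bringing `x` to the front takes j transpositions. All later sign rules for lists of vectors go
back to this one. -/
theorem ev_insertIdx {k : ℕ} (a : V [⋀^Fin k]→L[ℝ] ℝ) (x : V) (l : List V) (j : ℕ)
    (hj : j ≤ l.length) : ev a (l.insertIdx j x) = (-1) ^ j * ev a (x :: l) := by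
  by_cases h : l.length + 1 = k
  · obtain ⟨n, v, rfl⟩ : ∃ n, ∃ v : Fin n → V, List.ofFn v = l := ⟨_, l.get, List.ofFn_get l⟩
    rw [List.length_ofFn] at h hj
    subst h
    have h2 : x :: List.ofFn v = List.ofFn (Matrix.vecCons x v) := by simp [List.ofFn_succ]
    have h1 := List.ofFn_insertNth (⟨j, Nat.lt_succ_of_le hj⟩ : Fin (n + 1)) x v
    rw [h2, ← h1, ev_ofFn, ev_ofFn]
    simpa using AlternatingMap.map_insertNth a.toAlternatingMap ⟨j, Nat.lt_succ_of_le hj⟩ x v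
  · rw [ev_of_length_ne, ev_of_length_ne, mul_zero]
    · simpa using h
    · rw [List.length_insertIdx_of_le_length hj]; exact h

theorem altSum_ofFn {ι : Type*} {n : ℕ} (L : ι → List ι → ℝ) (v : Fin (n + 1) → ι) :
    altSum L (List.ofFn v) = ∑ i : Fin (n + 1), (-1) ^ (i : ℕ) * L (v i) (List.ofFn (i.removeNth v)) := by
  induction n generalizing L with
  | zero => simp [altSum]
  | succ n ih =>
    rw [List.ofFn_succ, altSum, ih, Fin.sum_univ_succ (n := n + 1)]
    rw [sub_eq_add_neg, ← Finset.sum_neg_distrib]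
    congr 1
    · simp [Fin.tail]
    refine Finset.sum_congr rfl fun i _ => ?_
    have : List.ofFn (i.succ.removeNth v) = v 0 :: List.ofFn (i.removeNth fun j => v j.succ) := by
      rw [List.ofFn_succ]
      congr 1
      simp only [Fin.removeNth, Fin.succ_succAbove_succ]
      rfl
    rw [this, Fin.val_succ, pow_succ]
    ring

theorem altSum_of_length_ne {ι : Type*} (k : ℕ) (L : ι → List ι → ℝ)
    (hL : ∀ x l, l.length ≠ k → L x l = 0) (l : List ι) (hl : l.length ≠ k + 1) :
    altSum L l = 0 := by
  induction l generalizing k L with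
  | nil => rfl
  | cons x l ih =>
    rw [altSum, hL x l (by simpa using hl)]
    rcases k with _ | k
    · rw [show (fun y m => L y (x :: m)) = fun y m => 0 * L y m from
        funext fun y => funext fun m => by rw [hL _ _ (by simp), zero_mul], altSum_smul]
      simp
    · rw [ih k _ (fun y m hm => hL _ _ (by simpa using hm)) (by simpa using hl), sub_zero]

/-- This brings `extDeriv`, which alternates the Fréchet derivative, into the list calculus. -/
theorem ev_alternatizeUncurryFin {k : ℕ} (L : V →L[ℝ] V [⋀^Fin k]→L[ℝ] ℝ) (l : List V) :
    ev (ContinuousAlternatingMap.alternatizeUncurryFin L) l = altSum (fun x => ev (L x)) l := by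
  by_cases h : l.length = k + 1
  · obtain ⟨v, rfl⟩ : ∃ v : Fin (k + 1) → V, List.ofFn v = l := by
      exact ⟨fun i => l.get (i.cast h.symm), by rw [← List.ofFn_congr h, List.ofFn_get]⟩
    rw [ev_ofFn, altSum_ofFn, ContinuousAlternatingMap.alternatizeUncurryFin_apply]
    simp [ev_ofFn]
  · rw [ev_of_length_ne _ h, altSum_of_length_ne k _ (fun x l hl => ev_of_length_ne _ hl) l h]

theorem shuffle_of_length_ne {ι R : Type*} [CommRing R] (p q : ℕ) (s : R) (a b : List ι → R)
    (ha : ∀ m : List ι, m.length ≠ p → a m = 0) (hb : ∀ m : List ι, m.length ≠ q → b m = 0)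
    (l : List ι) (hl : l.length ≠ p + q) : shuffle s a b l = 0 := by
  induction l generalizing p q s a b with
  | nil =>
    rw [shuffle_nil]
    rcases Nat.eq_zero_or_pos p with rfl | hp
    · rw [hb [] (by simpa using hl), mul_zero]
    · rw [ha [] (by simpa using hp.ne), zero_mul]
  | cons x l ih =>
    have h1 : shuffle (-s) (fun m => a (x :: m)) b l = 0 := by
      rcases p with _ | p
      · rw [show (fun m => a (x :: m)) = fun _ => 0 from funext fun m => ha _ (by simp),
          shuffle_zero_left]
      · exact ih p q _ _ _ (fun m hm => ha _ (by simpa using hm)) hb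
          (by simp only [List.length_cons] at hl; omega)
    have h2 : shuffle s a (fun m => b (x :: m)) l = 0 := by
      rcases q with _ | q
      · rw [show (fun m => b (x :: m)) = fun _ => 0 from funext fun m => hb _ (by simp),
          shuffle_zero_right]
      · exact ih p q _ _ _ ha (fun m hm => hb _ (by simpa using hm))
          (by simp only [List.length_cons] at hl; omega)
    rw [shuffle_cons, h1, h2, mul_zero, add_zero]

/-- This and the next three lemmas cut a list after its first entries once `x` has been inserted at
j: the position of j relative to the cut decides which of the two factors of an exterior product
receives `x`. -/
theorem _root_.List.take_succ_insertIdx {α : Type*} (m : List α) (x : α) {j p : ℕ} (h : j ≤ p) :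
    (m.insertIdx j x).take (p + 1) = (m.take p).insertIdx j x := by
  induction m generalizing j p with
  | nil => rcases j with _ | j <;> simp
  | cons y m ih =>
    rcases j with _ | j
    · simp
    · obtain ⟨p, rfl⟩ : ∃ p', p = p' + 1 := ⟨p - 1, by omega⟩
      simp [ih (Nat.succ_le_succ_iff.1 h)]

theorem _root_.List.drop_succ_insertIdx {α : Type*} (m : List α) (x : α) {j p : ℕ} (h : j ≤ p) :
    (m.insertIdx j x).drop (p + 1) = m.drop p := by
  induction m generalizing j p with
  | nil => rcases j with _ | j <;> simp
  | cons y m ih =>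
    rcases j with _ | j
    · simp
    · obtain ⟨p, rfl⟩ : ∃ p', p = p' + 1 := ⟨p - 1, by omega⟩
      simp [ih (Nat.succ_le_succ_iff.1 h)]

theorem _root_.List.take_insertIdx {α : Type*} (m : List α) (x : α) {j p : ℕ} (h : p ≤ j) :
    (m.insertIdx j x).take p = m.take p := by
  induction m generalizing j p with
  | nil => rcases j with _ | j <;> rcases p with _ | p <;> simp_all
  | cons y m ih =>
    rcases p with _ | p
    · simp
    · obtain ⟨j, rfl⟩ : ∃ j', j = j' + 1 := ⟨j - 1, by omega⟩
      simp [ih (Nat.succ_le_succ_iff.1 h)]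

theorem _root_.List.drop_insertIdx {α : Type*} (m : List α) (x : α) {j p : ℕ} (h : p ≤ j)
    (hp : p ≤ m.length) : (m.insertIdx j x).drop p = (m.drop p).insertIdx (j - p) x := by
  induction m generalizing j p with
  | nil => obtain rfl : p = 0 := by simpa using hp
           simp
  | cons y m ih =>
    rcases p with _ | p
    · simp
    · obtain ⟨j, rfl⟩ : ∃ j', j = j' + 1 := ⟨j - 1, by omega⟩
      simp [ih (Nat.succ_le_succ_iff.1 h) (by simpa using hp)]

theorem neg_one_pow_mul_self (j : ℕ) : (-1 : ℝ) ^ j * (-1) ^ j = 1 := by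
  rw [← mul_pow]; simp

/-- A permutation of n + 1 entries is the position j of the first entry together with a permutation
of the others; this is the expansion of a determinant along one row. -/
theorem sum_perm_succ {ι : Type*} {n : ℕ} (F : (Fin (n + 1) → ι) → ℝ) (x : ι) (v : Fin n → ι) :
    ∑ σ : Equiv.Perm (Fin (n + 1)), ((σ.sign : ℤ) : ℝ) * F (Fin.cons (α := fun _ => ι) x v ∘ σ) =
      ∑ j : Fin (n + 1), (-1) ^ (j : ℕ) * ∑ e : Equiv.Perm (Fin n),
        ((e.sign : ℤ) : ℝ) * F (Fin.insertNth (α := fun _ => ι) j x (v ∘ e)) := by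
  -- The left factor fixes 0 and permutes the other indices by `w.2`; `Fin.cycleRange j` carries j
  -- to 0 and has sign (-1)^j.
  let Φ : Fin (n + 1) × Equiv.Perm (Fin n) → Equiv.Perm (Fin (n + 1)) := fun w =>
    Equiv.Perm.decomposeFin.symm (0, w.2) * Fin.cycleRange w.1
  have hΦ : Function.Bijective Φ := by
    rw [Fintype.bijective_iff_injective_and_card]
    constructor
    · rintro ⟨j, e⟩ ⟨j', e'⟩ h
      have hj : ∀ (j : Fin (n + 1)) (e : Equiv.Perm (Fin n)), Φ (j, e) j = 0 := by
        intro j e; simp [Φ]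
      have hjj : j = j' := by
        have := hj j e
        rw [h] at this
        exact (Φ (j', e')).injective (this.trans (hj j' e').symm)
      subst hjj
      have := mul_right_cancel (h : _ * _ = _ * _)
      simpa using this
    · simp [Fintype.card_perm, Nat.factorial_succ]
  rw [← (Equiv.ofBijective Φ hΦ).sum_comp, Fintype.sum_prod_type]
  refine Finset.sum_congr rfl fun j _ => ?_
  rw [Finset.mul_sum]
  refine Finset.sum_congr rfl fun e _ => ?_
  have h1 : (Fin.cons (α := fun _ => ι) x v ∘ Φ (j, e)) =
      Fin.insertNth (α := fun _ => ι) j x (v ∘ e) := by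
    rw [← Fin.cons_comp_cycleRange]
    funext i
    simp only [Φ, Function.comp, Equiv.Perm.mul_apply]
    generalize j.cycleRange i = k
    refine Fin.cases ?_ (fun k => ?_) k <;> simp
  have h2 : (((Φ (j, e)).sign : ℤ) : ℝ) = (-1) ^ (j : ℕ) * ((e.sign : ℤ) : ℝ) := by
    simp [Φ, Fin.sign_cycleRange, mul_comm]
  simp only [Equiv.ofBijective_apply, h1, h2]
  ring

/-- The signed sum over all permutations underlying the exterior product. -/
def permSum (A B : List V → ℝ) (p : ℕ) {n : ℕ} (v : Fin n → V) : ℝ :=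
  ∑ σ : Equiv.Perm (Fin n), ((σ.sign : ℤ) : ℝ) *
    (A ((List.ofFn (v ∘ σ)).take p) * B ((List.ofFn (v ∘ σ)).drop p))

/-- Sort the permutations by the position j of the first vector. The p positions j < p hand it to
`a` and contribute equally; the other q positions hand it to `b`, with the additional sign (-1)^p.
These are the two branches of `shuffle`, and the multiplicities p and q build up p! q! by induction.
-/
theorem permSum_eq_shuffle {p q : ℕ} (a : V [⋀^Fin p]→L[ℝ] ℝ) (b : V [⋀^Fin q]→L[ℝ] ℝ) {n : ℕ}
    (hn : p + q = n) (v : Fin n → V) :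
    permSum (ev a) (ev b) p v =
      p.factorial * q.factorial * shuffle ((-1) ^ p) (ev a) (ev b) (List.ofFn v) := by
  induction n generalizing p q with
  | zero =>
    obtain ⟨rfl, rfl⟩ : p = 0 ∧ q = 0 := by omega
    simp [permSum, shuffle_nil]
  | succ n ih =>
    obtain ⟨x, w, rfl⟩ : ∃ x w, v = Fin.cons (α := fun _ => V) x w :=
      ⟨v 0, Fin.tail v, (Fin.cons_self_tail v).symm⟩
    rw [permSum, sum_perm_succ (fun u => ev a ((List.ofFn u).take p) * ev b ((List.ofFn u).drop p))]
    have h1 : ∀ j : Fin (n + 1), (-1 : ℝ) ^ (j : ℕ) * ∑ e : Equiv.Perm (Fin n), ((e.sign : ℤ) : ℝ) *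
        (ev a ((List.ofFn (Fin.insertNth (α := fun _ => V) j x (w ∘ e))).take p) *
          ev b ((List.ofFn (Fin.insertNth (α := fun _ => V) j x (w ∘ e))).drop p)) =
        if (j : ℕ) < p then permSum (fun m => ev a (x :: m)) (ev b) (p - 1) w
        else (-1) ^ p * permSum (ev a) (fun m => ev b (x :: m)) p w := by
      intro j
      rw [permSum, permSum, Finset.mul_sum, Finset.mul_sum]
      split_ifs with hj
      · refine Finset.sum_congr rfl fun e _ => ?_
        obtain ⟨p', rfl⟩ : ∃ p', p = p' + 1 := ⟨p - 1, by omega⟩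
        rw [List.ofFn_insertNth, List.take_succ_insertIdx _ x (Nat.lt_succ_iff.1 hj),
          List.drop_succ_insertIdx _ x (Nat.lt_succ_iff.1 hj), ev_insertIdx _ _ _ _ (by simp; omega),
          Nat.add_sub_cancel]
        have := neg_one_pow_mul_self j
        linear_combination (((e.sign : ℤ) : ℝ) * (ev a (x :: List.take p' (List.ofFn (w ∘ e))) *
          ev b (List.drop p' (List.ofFn (w ∘ e))))) * this
      · refine Finset.sum_congr rfl fun e _ => ?_
        rw [not_lt] at hj
        rw [List.ofFn_insertNth, List.take_insertIdx _ x hj,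
          List.drop_insertIdx _ x hj (by simp; omega), ev_insertIdx _ _ _ _ (by simp; omega)]
        have := neg_one_pow_mul_self (j - p)
        rw [show (-1 : ℝ) ^ (j : ℕ) = (-1) ^ p * (-1) ^ (j - p : ℕ) by rw [← pow_add]; congr 1; omega]
        linear_combination ((-1) ^ p * ((e.sign : ℤ) : ℝ) *
          (ev a (List.take p (List.ofFn (w ∘ e))) *
          ev b (x :: List.drop p (List.ofFn (w ∘ e))))) * this
    simp only [h1]
    rw [Fin.sum_univ_eq_sum_range (fun j => if j < p then permSum (fun m => ev a (x :: m)) (ev b) (p - 1) w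
        else (-1) ^ p * permSum (ev a) (fun m => ev b (x :: m)) p w)]
    rw [show Finset.range (n + 1) = Finset.range (p + q) by rw [hn], Finset.sum_range_add,
      Finset.sum_congr rfl (g := fun _ => permSum (fun m => ev a (x :: m)) (ev b) (p - 1) w)
        (fun j hj => if_pos (Finset.mem_range.1 hj)),
      Finset.sum_congr rfl (g := fun _ => (-1) ^ p * permSum (ev a) (fun m => ev b (x :: m)) p w)
        (fun j hj => if_neg (by omega)), List.ofFn_cons, shuffle_cons]
    simp only [Finset.sum_const, Finset.card_range, nsmul_eq_mul]
    have hA : (p : ℝ) * permSum (fun m => ev a (x :: m)) (ev b) (p - 1) w =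
        p.factorial * q.factorial *
          shuffle (-(-1) ^ p) (fun m => ev a (x :: m)) (ev b) (List.ofFn w) := by
      rcases p with _ | p
      · simp only [ev_cons_zero, shuffle_zero_left]
        simp
      · simp only [ev_cons, Nat.add_sub_cancel]
        rw [ih _ _ (by omega), Nat.factorial_succ, pow_succ]
        push_cast
        rw [mul_neg_one, neg_neg]
        ring
    have hB : (q : ℝ) * permSum (ev a) (fun m => ev b (x :: m)) p w =
        p.factorial * q.factorial *
          shuffle ((-1) ^ p) (ev a) (fun m => ev b (x :: m)) (List.ofFn w) := by
      rcases q with _ | q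
      · simp only [ev_cons_zero, shuffle_zero_right]
        simp
      · simp only [ev_cons]
        rw [ih _ _ (by omega), Nat.factorial_succ]
        push_cast
        ring
    rw [hA]
    linear_combination (-1) ^ p * hB

/-- Both sides times p! q! equal the signed sum over all permutations, and the factor cancels. From
here on the quotient in the definition of `wedge` is not used. -/
theorem ev_wedge {p q : ℕ} (a : V [⋀^Fin p]→L[ℝ] ℝ) (b : V [⋀^Fin q]→L[ℝ] ℝ) (l : List V) :
    ev (wedge a b) l = shuffle ((-1) ^ p) (ev a) (ev b) l := by
  by_cases h : l.length = p + q
  · obtain ⟨v, rfl⟩ : ∃ v : Fin (p + q) → V, List.ofFn v = l :=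
      ⟨fun i => l.get (i.cast h.symm), by rw [← List.ofFn_congr h, List.ofFn_get]⟩
    have h1 := permSum_eq_shuffle a b rfl v
    have h2 : permSum (ev a) (ev b) p v = p.factorial * q.factorial * wedge a b v := by
      -- Alternating the tensor product of two alternating maps gives p! q! times their sum over
      -- shuffles.
      have h3 := congrArg (fun F => LinearMap.mul' ℝ ℝ (F (v ∘ finSumFinEquiv)))
        (MultilinearMap.domCoprod_alternization_eq a.toAlternatingMap b.toAlternatingMap)
      have h4 : wedge a b v = LinearMap.mul' ℝ ℝ
        ((a.toAlternatingMap.domCoprod b.toAlternatingMap) (v ∘ finSumFinEquiv)) := rfl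
      simp only [MultilinearMap.alternatization_apply, AlternatingMap.smul_apply, map_nsmul,
        ← h4, map_sum, Fintype.card_fin] at h3
      rw [nsmul_eq_mul, Nat.cast_mul] at h3
      rw [← h3, permSum, ← (finSumFinEquiv.permCongr).sum_comp]
      refine Finset.sum_congr rfl fun σ _ => ?_
      rw [List.ofFn_add, List.take_left' (by simp), List.drop_left' (by simp), ev_ofFn, ev_ofFn]
      have hc : ∀ (h : p ≤ p + q) (i : Fin p), finSumFinEquiv.symm (Fin.castLE h i) = Sum.inl i :=
        fun _ i => finSumFinEquiv_symm_apply_castAdd i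
      rcases Int.units_eq_one_or σ.sign with hs | hs <;>
        simp [hs, hc, MultilinearMap.domDomCongr_apply, MultilinearMap.domCoprod_apply,
          Equiv.Perm.sign_permCongr, Function.comp_def]
    rw [ev_ofFn]
    rw [h1] at h2
    exact (mul_left_cancel₀ (by positivity) h2).symm
  · rw [ev_of_length_ne _ h, shuffle_of_length_ne p q _ _ _ (fun m => ev_of_length_ne a)
      (fun m => ev_of_length_ne b) l h]

end Eval

/-! ### Calculus of the exterior product -/

section WedgeCalculus

variable {V V' : Type*} [NormedAddCommGroup V] [NormedSpace ℝ V]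
  [NormedAddCommGroup V'] [NormedSpace ℝ V']

theorem ev_add_fun {k : ℕ} (a b : V [⋀^Fin k]→L[ℝ] ℝ) : ev (a + b) = fun l => ev a l + ev b l :=
  funext (ev_add a b)

theorem ev_smul_fun {k : ℕ} (c : ℝ) (a : V [⋀^Fin k]→L[ℝ] ℝ) : ev (c • a) = fun l => c * ev a l :=
  funext (ev_smul c a)

theorem wedge_add_left {p q : ℕ} (a a' : V [⋀^Fin p]→L[ℝ] ℝ) (b : V [⋀^Fin q]→L[ℝ] ℝ) :
    wedge (a + a') b = wedge a b + wedge a' b :=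
  ev_ext fun l => by simp only [ev_add, ev_wedge, ev_add_fun, shuffle_add_left]

theorem wedge_add_right {p q : ℕ} (a : V [⋀^Fin p]→L[ℝ] ℝ) (b b' : V [⋀^Fin q]→L[ℝ] ℝ) :
    wedge a (b + b') = wedge a b + wedge a b' :=
  ev_ext fun l => by simp only [ev_add, ev_wedge, ev_add_fun, shuffle_add_right]

theorem wedge_smul_left {p q : ℕ} (c : ℝ) (a : V [⋀^Fin p]→L[ℝ] ℝ) (b : V [⋀^Fin q]→L[ℝ] ℝ) :
    wedge (c • a) b = c • wedge a b :=
  ev_ext fun l => by simp only [ev_smul, ev_wedge, ev_smul_fun, shuffle_smul_left]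

theorem wedge_smul_right {p q : ℕ} (c : ℝ) (a : V [⋀^Fin p]→L[ℝ] ℝ) (b : V [⋀^Fin q]→L[ℝ] ℝ) :
    wedge a (c • b) = c • wedge a b :=
  ev_ext fun l => by simp only [ev_smul, ev_wedge, ev_smul_fun, shuffle_smul_right]

theorem wedge_zero_left {p q : ℕ} (b : V [⋀^Fin q]→L[ℝ] ℝ) :
    wedge (0 : V [⋀^Fin p]→L[ℝ] ℝ) b = 0 := by
  simpa using wedge_smul_left 0 (0 : V [⋀^Fin p]→L[ℝ] ℝ) b

theorem wedge_zero_right {p q : ℕ} (a : V [⋀^Fin p]→L[ℝ] ℝ) :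
    wedge a (0 : V [⋀^Fin q]→L[ℝ] ℝ) = 0 := by
  simpa using wedge_smul_right 0 a (0 : V [⋀^Fin q]→L[ℝ] ℝ)

theorem wedge_neg_left {p q : ℕ} (a : V [⋀^Fin p]→L[ℝ] ℝ) (b : V [⋀^Fin q]→L[ℝ] ℝ) :
    wedge (-a) b = -wedge a b := by
  rw [← neg_one_smul ℝ a, wedge_smul_left]
  exact ev_ext fun l => by rw [ev_smul, ev_neg, neg_one_mul]

theorem wedge_sub_left {p q : ℕ} (a a' : V [⋀^Fin p]→L[ℝ] ℝ) (b : V [⋀^Fin q]→L[ℝ] ℝ) :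
    wedge (a - a') b = wedge a b - wedge a' b := by
  rw [sub_eq_add_neg, wedge_add_left, wedge_neg_left, ← sub_eq_add_neg]

theorem wedge_comp {p q : ℕ} (a : V' [⋀^Fin p]→L[ℝ] ℝ) (b : V' [⋀^Fin q]→L[ℝ] ℝ)
    (L : V →L[ℝ] V') : (wedge a b).compContinuousLinearMap L =
      wedge (a.compContinuousLinearMap L) (b.compContinuousLinearMap L) :=
  ev_ext fun l => by
    rw [ev_comp, ev_wedge, ev_wedge, shuffle_map]
    congr 1 <;> funext m <;> rw [ev_comp]

theorem wedge_comm {p q : ℕ} (a : V [⋀^Fin p]→L[ℝ] ℝ) (b : V [⋀^Fin q]→L[ℝ] ℝ) (l : List V) :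
    ev (wedge a b) l = (-1) ^ (p * q) * ev (wedge b a) l := by
  rw [ev_wedge, ev_wedge, shuffle_comm p q _ _ _ (fun m => ev_of_length_ne a)
      (fun m => ev_of_length_ne b)]

theorem abs_ev_le {k : ℕ} (a : V [⋀^Fin k]→L[ℝ] ℝ) (l : List V) :
    |ev a l| ≤ ‖a‖ * (l.map norm).prod := by
  by_cases h : l.length = k
  · obtain ⟨v, rfl⟩ : ∃ v : Fin k → V, List.ofFn v = l :=
      ⟨fun i => l.get (i.cast h.symm), by rw [← List.ofFn_congr h, List.ofFn_get]⟩
    rw [ev_ofFn, List.map_ofFn, List.prod_ofFn]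
    exact a.le_opNorm v
  · rw [ev_of_length_ne _ h, abs_zero]
    refine mul_nonneg (norm_nonneg _) (List.prod_nonneg ?_)
    simp

/-- Each vector at most doubles the number of terms, whence 2 ^ length. The crude constant suffices,
as only the continuity of the exterior product in its two factors is wanted. -/
theorem abs_shuffle_le {W : Type*} [NormedAddCommGroup W] (A B : List W → ℝ) (c d s : ℝ) (hs : |s| = 1)
    (hA : ∀ l, |A l| ≤ c * (l.map norm).prod) (hB : ∀ l, |B l| ≤ d * (l.map norm).prod)
    (l : List W) : |shuffle s A B l| ≤ 2 ^ l.length * c * d * (l.map norm).prod := by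
  induction l generalizing A B c d s with
  | nil =>
    have h1 := hA []
    have h2 := hB []
    simp only [List.map_nil, List.prod_nil, mul_one] at h1 h2
    simpa [shuffle_nil, abs_mul] using
      mul_le_mul h1 h2 (abs_nonneg _) ((abs_nonneg _).trans h1)
  | cons x l ih =>
    have h1 := ih (fun m => A (x :: m)) B (c * ‖x‖) d (-s) (by simpa using hs)
      (fun m => by simpa [mul_assoc] using hA (x :: m)) hB
    have h2 := ih A (fun m => B (x :: m)) c (d * ‖x‖) s hs hA
      (fun m => by simpa [mul_assoc] using hB (x :: m))
    rw [shuffle_cons]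
    refine (abs_add_le _ _).trans ?_
    rw [abs_mul, hs, one_mul, List.map_cons, List.prod_cons, List.length_cons, pow_succ]
    linarith

theorem norm_wedge_le {p q : ℕ} (a : V [⋀^Fin p]→L[ℝ] ℝ) (b : V [⋀^Fin q]→L[ℝ] ℝ) :
    ‖wedge a b‖ ≤ 2 ^ (p + q) * ‖a‖ * ‖b‖ := by
  refine ContinuousAlternatingMap.opNorm_le_bound _ (by positivity) fun v => ?_
  have := abs_shuffle_le (ev a) (ev b) ‖a‖ ‖b‖ ((-1) ^ p) (by simp) (abs_ev_le a) (abs_ev_le b)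
    (List.ofFn v)
  rwa [← ev_wedge, ev_ofFn, List.length_ofFn, List.map_ofFn, List.prod_ofFn] at this

/-- The exterior product as a continuous bilinear map. -/
def wedgeCLM (V : Type*) [NormedAddCommGroup V] [NormedSpace ℝ V] (p q : ℕ) :
    V [⋀^Fin p]→L[ℝ] ℝ →L[ℝ] V [⋀^Fin q]→L[ℝ] ℝ →L[ℝ] V [⋀^Fin (p + q)]→L[ℝ] ℝ :=
  LinearMap.mkContinuous₂ (LinearMap.mk₂ ℝ wedge wedge_add_left wedge_smul_left wedge_add_right
    wedge_smul_right) (2 ^ (p + q)) norm_wedge_le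

theorem wedgeCLM_apply {p q : ℕ} (a : V [⋀^Fin p]→L[ℝ] ℝ) (b : V [⋀^Fin q]→L[ℝ] ℝ) :
    wedgeCLM V p q a b = wedge a b := rfl

/-- The product rule for the continuous bilinear map `wedgeCLM`, followed by alternation. The
equation is between values on lists because the two forms on the right have degrees p + 1 + q and p
+ (q + 1), which are different types. -/
theorem extDeriv_wedge {p q : ℕ} {a : V → V [⋀^Fin p]→L[ℝ] ℝ} {b : V → V [⋀^Fin q]→L[ℝ] ℝ} {x : V}
    (ha : DifferentiableAt ℝ a x) (hb : DifferentiableAt ℝ b x) (l : List V) :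
    ev (extDeriv (fun y => wedge (a y) (b y)) x) l =
      ev (wedge (extDeriv a x) (b x)) l + (-1) ^ p * ev (wedge (a x) (extDeriv b x)) l := by
  have h := (wedgeCLM V p q).hasFDerivAt_of_bilinear ha.hasFDerivAt hb.hasFDerivAt
  have h1 : ∀ y, ev (fderiv ℝ (fun y => wedge (a y) (b y)) x y) = fun l =>
      shuffle ((-1) ^ p) (ev (fderiv ℝ a x y)) (ev (b x)) l +
        shuffle ((-1) ^ p) (ev (a x)) (ev (fderiv ℝ b x y)) l := by
    intro y
    rw [show (fun y => wedge (a y) (b y)) = fun y => wedgeCLM V p q (a y) (b y) from rfl, h.fderiv]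
    funext l
    refine (ev_add (wedge (a x) (fderiv ℝ b x y)) (wedge (fderiv ℝ a x y) (b x)) l).trans ?_
    rw [ev_wedge, ev_wedge, add_comm]
  have hda : ev (extDeriv a x) = altSum (fun y => ev (fderiv ℝ a x y)) :=
    funext (ev_alternatizeUncurryFin _)
  have hdb : ev (extDeriv b x) = altSum (fun y => ev (fderiv ℝ b x y)) :=
    funext (ev_alternatizeUncurryFin _)
  rw [ev_wedge, ev_wedge, hda, hdb, extDeriv, ev_alternatizeUncurryFin]
  simp only [h1]
  rw [altSum_add, altSum_shuffle_left, altSum_shuffle_right _ (neg_one_pow_mul_self p), pow_succ,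
    mul_neg_one]

/-- The source of the term dc ∧ a in d(c a); `A` is the covector `L` seen as a function on lists. -/
theorem altSum_mul {ι : Type*} (L : ι → ℝ) (a : List ι → ℝ) (l : List ι) (A : List ι → ℝ)
    (hA : ∀ x l, A (x :: l) = if l = [] then L x else 0) (hA' : A [] = 0) :
    altSum (fun y m => L y * a m) l = shuffle (-1) A a l := by
  induction l generalizing a with
  | nil => simp [altSum, shuffle_nil, hA']
  | cons x l ih =>
    have h1 : ∀ (l : List ι) (b : List ι → ℝ), shuffle 1 (fun m => A (x :: m)) b l = L x * b l := by
      intro l b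
      induction l generalizing b with
      | nil => simp [shuffle_nil, hA]
      | cons z l ih' =>
        rw [shuffle_cons, ih', show (fun m => A (x :: z :: m)) = fun _ => 0 from
          funext fun m => by simp [hA], shuffle_zero_left]
        ring
    rw [altSum, shuffle_cons, neg_neg, h1, ih]
    ring

theorem extDeriv_smul_fun {k : ℕ} {c : V → ℝ} {a : V → V [⋀^Fin k]→L[ℝ] ℝ} {x : V}
    (hc : DifferentiableAt ℝ c x) (ha : DifferentiableAt ℝ a x) (l : List V) :
    ev (extDeriv (fun y => c y • a y) x) l =
      ev (wedge (ContinuousAlternatingMap.ofSubsingleton ℝ V ℝ (0 : Fin 1) (fderiv ℝ c x)) (a x)) l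
        + c x * ev (extDeriv a x) l := by
  have h := hc.hasFDerivAt.smul ha.hasFDerivAt
  have h1 : ∀ y, ev (fderiv ℝ (fun y => c y • a y) x y) = fun l =>
      fderiv ℝ c x y * ev (a x) l + c x * ev (fderiv ℝ a x y) l := by
    intro y
    rw [show (fun y => c y • a y) = c • a from rfl, h.fderiv]
    funext l
    simp [ev_add, ev_smul, add_comm]
  rw [extDeriv, extDeriv, ev_alternatizeUncurryFin, ev_alternatizeUncurryFin]
  simp only [h1]
  rw [altSum_add, altSum_smul, ev_wedge, altSum_mul (fun y => fderiv ℝ c x y) _ _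
    (ev (ContinuousAlternatingMap.ofSubsingleton ℝ V ℝ (0 : Fin 1) (fderiv ℝ c x)))]
  · simp
  · intro x l
    split_ifs with hl
    · subst hl; rw [ev_ofSubsingleton]
    · exact ev_of_length_ne _ (by simpa using hl)
  · exact ev_of_length_ne _ (by simp)

end WedgeCalculus

/-! ### Components in a basis -/

section Components

variable {V : Type*} [NormedAddCommGroup V] [NormedSpace ℝ V]

theorem ev_swap {k : ℕ} (a : V [⋀^Fin k]→L[ℝ] ℝ) (x y : V) (l : List V) :
    ev a (y :: x :: l) = -ev a (x :: y :: l) := by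
  have := ev_insertIdx a x (y :: l) 1 (by simp)
  simpa using this

theorem ev_eq_zero_of_perm {k : ℕ} (a : V [⋀^Fin k]→L[ℝ] ℝ) {l l' : List V} (h : l.Perm l')
    (hl : ev a l = 0) : ev a l' = 0 := by
  induction h generalizing k with
  | nil => exact hl
  | cons x _ ih =>
    rcases k with _ | k
    · exact ev_cons_zero a _ _
    · rw [ev_cons] at hl ⊢
      exact ih _ hl
  | swap x y l => rw [ev_swap, hl, neg_zero]
  | trans _ _ ih1 ih2 => exact ih2 _ (ih1 _ hl)

theorem sorted_sublist_finRange {n : ℕ} {I : List (Fin n)} (hI : I.Nodup) :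
    ∃ I', I.Perm I' ∧ I'.Sublist (List.finRange n) := by
  refine ⟨I.insertionSort (· ≤ ·), (List.perm_insertionSort _ _).symm, ?_⟩
  refine List.sublist_of_subperm_of_sortedLE ?_ (List.sortedLE_insertionSort)
    (List.sortedLT_finRange n).sortedLE
  exact List.subperm_of_subset ((List.perm_insertionSort _ _).nodup_iff.2 hI)
    (fun x _ => List.mem_finRange x)

/-- The sublists of `List.finRange n` are the increasing index lists, and up to sign an alternating
form only sees those. This reduces identities of forms to finitely many components. -/
theorem ev_ext_basis {n k : ℕ} (b : Module.Basis (Fin n) ℝ V) {a a' : V [⋀^Fin k]→L[ℝ] ℝ}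
    (h : ∀ I ∈ (List.finRange n).sublistsLen k, ev a (I.map b) = ev a' (I.map b)) : a = a' := by
  rw [← sub_eq_zero]
  have h0 : ∀ v : Fin k → Fin n, Function.Injective v → (a - a') (fun i => b (v i)) = 0 := by
    intro v hv
    obtain ⟨I', hI', hs⟩ := sorted_sublist_finRange (List.nodup_ofFn.2 hv)
    have h1 : ev (a - a') (I'.map b) = 0 := by
      rw [ev_sub, h I' (List.mem_sublistsLen.2 ⟨hs, by rw [← hI'.length_eq, List.length_ofFn]⟩),
        sub_self]
    have h2 := ev_eq_zero_of_perm _ (hI'.map b).symm h1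
    rw [List.map_ofFn, ev_ofFn] at h2
    exact h2
  apply ContinuousAlternatingMap.toAlternatingMap_injective
  refine b.ext_alternating fun v hv => ?_
  exact h0 v hv

variable {g : LinearMap.BilinForm ℝ V}

theorem IsOrthonormalBasis.repr_eq {n : ℕ} {e : Module.Basis (Fin n) ℝ V}
    (he : IsOrthonormalBasis g e) (x : V) (i : Fin n) : e.repr x i = g x (e i) := by
  have h := congrArg (fun y => g y (e i)) (e.sum_repr x)
  simp only [map_sum, LinearMap.sum_apply, map_smul, LinearMap.smul_apply, he _ _] at h
  simpa using h

/-- Parseval's identity. It also shows that a bilinear form admitting an orthonormal basis is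
symmetric and positive, which is assumed nowhere. -/
theorem IsOrthonormalBasis.symm {n : ℕ} {e : Module.Basis (Fin n) ℝ V}
    (he : IsOrthonormalBasis g e) (x y : V) : g x y = ∑ i, g x (e i) * g y (e i) := by
  conv_lhs => rw [← e.sum_repr y]
  simp [he.repr_eq, mul_comm]

/-- The trace of a bilinear form does not depend on the orthonormal basis. -/
theorem IsOrthonormalBasis.sum_eq {n : ℕ} {e e' : Module.Basis (Fin n) ℝ V}
    (he : IsOrthonormalBasis g e) (he' : IsOrthonormalBasis g e') (B : LinearMap.BilinForm ℝ V) :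
    ∑ i, B (e i) (e i) = ∑ i, B (e' i) (e' i) := by
  have h1 : ∀ i, B (e i) (e i) = ∑ j, ∑ k, (g (e i) (e' j) * g (e i) (e' k)) * B (e' j) (e' k) := by
    intro i
    conv_lhs => rw [← e'.sum_repr (e i)]
    simp only [he'.repr_eq, map_sum, map_smul, LinearMap.sum_apply, LinearMap.smul_apply,
      smul_eq_mul, Finset.mul_sum, mul_assoc]
    rw [Finset.sum_comm]
    exact Finset.sum_congr rfl fun j _ => Finset.sum_congr rfl fun k _ => by ring
  have hsymm : ∀ x y, g x y = g y x := fun x y => by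
    rw [he.symm x y, he.symm y x]
    exact Finset.sum_congr rfl fun i _ => mul_comm _ _
  have h2 : ∀ j k, ∑ i, g (e i) (e' j) * g (e i) (e' k) = if j = k then 1 else 0 := by
    intro j k
    rw [← he' j k, he.symm]
    exact Finset.sum_congr rfl fun i _ => by rw [hsymm, hsymm (e i)]
  simp only [h1]
  rw [Finset.sum_comm]
  refine Finset.sum_congr rfl fun j _ => ?_
  rw [Finset.sum_comm]
  simp only [← Finset.sum_mul, h2]
  simp

theorem ev_cons_add {k : ℕ} (a : V [⋀^Fin k]→L[ℝ] ℝ) (x y : V) (l : List V) :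
    ev a ((x + y) :: l) = ev a (x :: l) + ev a (y :: l) := by
  rcases k with _ | k
  · simp [ev_cons_zero]
  · rw [ev_cons, ev_cons, ev_cons, map_add, ev_add]

theorem ev_cons_smul {k : ℕ} (a : V [⋀^Fin k]→L[ℝ] ℝ) (c : ℝ) (x : V) (l : List V) :
    ev a ((c • x) :: l) = c * ev a (x :: l) := by
  rcases k with _ | k
  · simp [ev_cons_zero]
  · rw [ev_cons, ev_cons, map_smul, ev_smul]

/-- The reason why `hodgeStar` does not depend on the chosen basis: the summation slots are
exchanged one at a time. With the others fixed, the sum over one slot is the trace of a bilinear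
form, which is the same in both bases. -/
theorem IsOrthonormalBasis.sum_ev_eq {n p m : ℕ} {e e' : Module.Basis (Fin n) ℝ V}
    (he : IsOrthonormalBasis g e) (he' : IsOrthonormalBasis g e') (β : V [⋀^Fin p]→L[ℝ] ℝ)
    (w : V [⋀^Fin m]→L[ℝ] ℝ) (l : List V) :
    ∑ I : Fin p → Fin n, ev β (List.ofFn (e ∘ I)) * ev w (List.ofFn (e ∘ I) ++ l) =
      ∑ I : Fin p → Fin n, ev β (List.ofFn (e' ∘ I)) * ev w (List.ofFn (e' ∘ I) ++ l) := by
  induction p generalizing m with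
  | zero => simp
  | succ p ih =>
    rcases m with _ | m
    · simp [List.ofFn_succ, ev_cons_zero]
    have hs : ∀ e : Module.Basis (Fin n) ℝ V,
        ∑ I : Fin (p + 1) → Fin n, ev β (List.ofFn (e ∘ I)) * ev w (List.ofFn (e ∘ I) ++ l) =
        ∑ i, ∑ I : Fin p → Fin n, ev β (e i :: List.ofFn (e ∘ I)) *
          ev w (e i :: (List.ofFn (e ∘ I) ++ l)) := by
      intro e
      rw [← (Fin.consEquiv (fun _ => Fin n)).sum_comp, Fintype.sum_prod_type]
      refine Finset.sum_congr rfl fun i _ => Finset.sum_congr rfl fun I _ => ?_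
      simp [Fin.consEquiv, List.ofFn_succ, Function.comp_def]
    rw [hs, hs]
    have h1 : ∀ i, ∑ I : Fin p → Fin n, ev β (e i :: List.ofFn (e ∘ I)) *
          ev w (e i :: (List.ofFn (e ∘ I) ++ l)) =
        ∑ I : Fin p → Fin n, ev β (e i :: List.ofFn (e' ∘ I)) *
          ev w (e i :: (List.ofFn (e' ∘ I) ++ l)) := by
      intro i
      simp only [ev_cons]
      exact ih _ _
    simp only [h1]
    rw [Finset.sum_comm, Finset.sum_comm (s := Finset.univ (α := Fin n))]
    refine Finset.sum_congr rfl fun I _ => ?_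
    exact he.sum_eq he' (LinearMap.mk₂ ℝ (fun x y => ev β (x :: List.ofFn (e' ∘ I)) *
          ev w (y :: (List.ofFn (e' ∘ I) ++ l)))
      (fun x y z => by rw [ev_cons_add, add_mul]) (fun c x z => by rw [ev_cons_smul, mul_assoc]; rfl)
      (fun x y z => by rw [ev_cons_add, mul_add])
      (fun c x z => by rw [ev_cons_smul, mul_left_comm]; rfl))

theorem ev_ofFn_comp_perm {p m : ℕ} (w : V [⋀^Fin m]→L[ℝ] ℝ) (v : Fin p → V)
    (σ : Equiv.Perm (Fin p)) (l : List V) :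
    ev w (List.ofFn (v ∘ σ) ++ l) = ((σ.sign : ℤ) : ℝ) * ev w (List.ofFn v ++ l) := by
  by_cases h : p + l.length = m
  · obtain ⟨q, u, rfl⟩ : ∃ q, ∃ u : Fin q → V, List.ofFn u = l := ⟨_, l.get, List.ofFn_get l⟩
    rw [List.length_ofFn] at h
    subst h
    have h1 : ∀ v : Fin p → V, List.ofFn v ++ List.ofFn u = List.ofFn (Fin.append v u) := fun v => by
      rw [List.ofFn_fin_append]
    have h2 : Fin.append (v ∘ σ) u =
        Fin.append v u ∘ (finSumFinEquiv.permCongr (Equiv.Perm.sumCongr σ 1)) := by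
      funext i
      refine Fin.addCases (fun i => ?_) (fun i => ?_) i <;> simp
    have h3 := w.toAlternatingMap.map_perm (Fin.append v u)
      (finSumFinEquiv.permCongr (Equiv.Perm.sumCongr σ 1))
    rw [h1, h1, ev_ofFn, ev_ofFn, h2]
    refine h3.trans ?_
    rcases Int.units_eq_one_or σ.sign with hs | hs <;>
      simp [hs, Equiv.Perm.sign_permCongr, Equiv.Perm.sign_sumCongr]
  · rw [ev_of_length_ne, ev_of_length_ne, mul_zero] <;> simpa using h

theorem hodgeStar_eq {p q : ℕ} {e : Module.Basis (Fin (q + p)) ℝ V} (he : IsOrthonormalBasis g e)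
    (vol : V [⋀^Fin (q + p)]→L[ℝ] ℝ) (β : V [⋀^Fin p]→L[ℝ] ℝ) (l : List V) :
    ev (hodgeStar g vol β) l = (p.factorial : ℝ)⁻¹ * ∑ I : Fin p → Fin (q + p),
      ev β (List.ofFn (e ∘ I)) * ev vol (List.ofFn (e ∘ I) ++ l) := by
  have h : ∃ e : Module.Basis (Fin (q + p)) ℝ V, IsOrthonormalBasis g e := ⟨e, he⟩
  rw [hodgeStar, dif_pos h, ev_smul, ev_sum]
  simp only [ev_smul, ev_contract]
  rw [← h.choose_spec.sum_ev_eq he]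
  simp only [ev_ofFn, Function.comp_def]

theorem ev_eq_zero_of_not_nodup {k : ℕ} (a : V [⋀^Fin k]→L[ℝ] ℝ) {l : List V} (h : ¬ l.Nodup) :
    ev a l = 0 := by
  obtain ⟨n, u, rfl⟩ : ∃ q, ∃ u : Fin q → V, List.ofFn u = l := ⟨_, l.get, List.ofFn_get l⟩
  by_cases hn : n = k
  · subst hn
    rw [ev_ofFn]
    exact a.map_eq_zero_of_not_injective u (fun hu => h (List.nodup_ofFn.2 hu))
  · exact ev_of_length_ne _ (by simpa using hn)

/-- The Hodge star in an orthonormal basis: `(⋆β)(e_J) = β(e_K) vol(e_K, e_J)` for `K`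
complementary to `J`. -/
theorem ev_hodgeStar {n p q : ℕ} (hn : q + p = n) {e : Module.Basis (Fin n) ℝ V}
    (he : IsOrthonormalBasis g e) (vol : V [⋀^Fin n]→L[ℝ] ℝ) (β : V [⋀^Fin p]→L[ℝ] ℝ)
    {K J : List (Fin n)} (hKJ : (K ++ J).Nodup) (hK : K.length = p) (hJ : J.length = q) :
    ev (hodgeStar g (castDeg hn.symm vol) β) (J.map e) = ev β (K.map e) * ev vol ((K ++ J).map e) := by
  subst hn
  obtain ⟨κ, rfl⟩ : ∃ κ : Fin p → Fin (q + p), List.ofFn κ = K :=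
    ⟨fun i => K.get (i.cast hK.symm), by rw [← List.ofFn_congr hK, List.ofFn_get]⟩
  rw [hodgeStar_eq he]
  have hκ : Function.Injective κ := List.nodup_ofFn.1 (List.nodup_append.1 hKJ).1
  have hinj : Function.Injective fun σ : Equiv.Perm (Fin p) => κ ∘ σ := fun σ τ h => by
    ext i
    exact congrArg Fin.val (hκ (congrFun h i))
  -- Only the tuples that permute K survive, since any other tuple repeats an index or meets J. The
  -- p! surviving terms agree, as the signs from `β` and `vol` square to one, and they cancel the
  -- factor 1/p!.
  rw [← Finset.sum_subset (Finset.subset_univ (Finset.univ.image fun σ : Equiv.Perm (Fin p) => κ ∘ σ))]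
  · rw [Finset.sum_image (fun σ _ τ _ h => hinj h)]
    have h1 : ∀ σ : Equiv.Perm (Fin p), ev β (List.ofFn (e ∘ κ ∘ σ)) *
        ev (castDeg rfl vol) (List.ofFn (e ∘ κ ∘ σ) ++ J.map e) =
        ev β ((List.ofFn κ).map e) * ev vol ((List.ofFn κ ++ J).map e) := by
      intro σ
      have h2 := ev_ofFn_comp_perm β (e ∘ κ) σ []
      rw [List.append_nil, List.append_nil] at h2
      rw [← Function.comp_assoc, h2, ev_castDeg, ev_ofFn_comp_perm, List.map_append, List.map_ofFn]
      have h3 : ((σ.sign : ℤ) : ℝ) * ((σ.sign : ℤ) : ℝ) = 1 := by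
        rcases Int.units_eq_one_or σ.sign with hs | hs <;> simp [hs]
      linear_combination (ev β (List.ofFn (e ∘ κ)) * ev vol (List.ofFn (e ∘ κ) ++ J.map e)) * h3
    rw [Finset.sum_congr rfl fun σ _ => h1 σ, Finset.sum_const, Finset.card_univ, Fintype.card_perm,
      Fintype.card_fin, nsmul_eq_mul, inv_mul_cancel_left₀ (by positivity)]
  · intro I _ hI
    rw [ev_castDeg]
    refine mul_eq_zero_of_right _ (ev_eq_zero_of_not_nodup _ fun hnd => hI ?_)
    rw [← List.map_ofFn, ← List.map_append] at hnd
    have hnd := hnd.of_map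
    have hsub : ∀ i, ∃ j, κ j = I i := by
      intro i
      have hperm : ∀ x, x ∈ List.ofFn κ ++ J := by
        intro x
        have : (List.ofFn κ ++ J).toFinset = Finset.univ := by
          rw [← Finset.card_eq_iff_eq_univ, List.toFinset_card_of_nodup hKJ]
          simp [hJ, add_comm]
        rw [← List.mem_toFinset, this]; exact Finset.mem_univ _
      rcases List.mem_append.1 (hperm (I i)) with h | h
      · exact List.mem_ofFn.1 h
      · exact absurd h fun h => (List.nodup_append.1 hnd).2.2 (I i) (List.mem_ofFn.2 ⟨i, rfl⟩) (I i) h rfl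
    choose τ hτ using hsub
    have hI' : Function.Injective I := List.nodup_ofFn.1 (List.nodup_append.1 hnd).1
    have hτ' : Function.Injective τ := fun i j h => hI' (by rw [← hτ, ← hτ, h])
    refine Finset.mem_image.2 ⟨Equiv.ofBijective τ (Finite.injective_iff_bijective.1 hτ'),
      Finset.mem_univ _, funext fun i => hτ i⟩

end Components

/-! ### Uniqueness of the metric and of the volume form induced by a 3-form -/

section Uniqueness

variable {V : Type*} [NormedAddCommGroup V] [NormedSpace ℝ V]

/-- Since g ⊗ vol is determined by φ, the pairs differ by a scaling: vol = c vol' and g' = c g with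
c > 0. If D is the determinant of a g-orthonormal basis in a g'-orthonormal one, the volume forms
give c D = 1 and the Gram matrices give D² = c⁷. Hence c⁹ = 1 and c = 1. -/
theorem Induces.unique {φ : V [⋀^Fin 3]→L[ℝ] ℝ} {g g' : LinearMap.BilinForm ℝ V}
    {vol vol' : V [⋀^Fin 7]→L[ℝ] ℝ} (h : Induces φ g vol) (h' : Induces φ g' vol') :
    g = g' ∧ vol = vol' := by
  obtain ⟨h1, e, he, hvol⟩ := h
  obtain ⟨h1', e', he', hvol'⟩ := h'
  have hgg : ∀ X Y, g X Y • vol = g' X Y • vol' := fun X Y => (h1 X Y).trans (h1' X Y).symm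
  set c := g' (e 0) (e 0) with hc
  have hv : vol = c • vol' := by
    have := hgg (e 0) (e 0)
    rwa [he 0 0, if_pos rfl, one_smul] at this
  have hce : c * vol' (fun i => e i) = 1 := by
    rw [← hvol, hv]; rfl
  have hc0 : c ≠ 0 := left_ne_zero_of_mul_eq_one hce
  have hcpos : 0 < c := by
    refine lt_of_le_of_ne ?_ hc0.symm
    rw [hc, he'.symm]
    exact Finset.sum_nonneg fun i _ => mul_self_nonneg _
  have hg : ∀ X Y, g' X Y = g X Y * c := by
    intro X Y
    have h2 := congrArg (fun w : V [⋀^Fin 7]→L[ℝ] ℝ => w (fun i => e' i)) (hgg X Y)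
    rw [hv] at h2
    simpa [hvol'] using h2.symm
  have hdet : vol' (fun i => e i) = (e'.toMatrix e).det := by
    have := vol'.toAlternatingMap.eq_smul_basis_det e'
    have h3 := congrArg (fun w : V [⋀^Fin 7]→ₗ[ℝ] ℝ => w (fun i => e i)) this
    have h4 : vol'.toAlternatingMap (fun i => e' i) = 1 := hvol'
    simpa [h4, Module.Basis.det_apply] using h3
  have hgram : (e'.toMatrix e).transpose * e'.toMatrix e = c • (1 : Matrix (Fin 7) (Fin 7) ℝ) := by
    ext i j
    rw [Matrix.mul_apply]
    simp only [Matrix.transpose_apply, Module.Basis.toMatrix_apply, he'.repr_eq, ← he'.symm]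
    rw [hg, he i j]
    simp [Matrix.one_apply]
  have h5 := congrArg Matrix.det hgram
  rw [Matrix.det_mul, Matrix.det_transpose, ← hdet, Matrix.det_smul, Matrix.det_one] at h5
  have hc9 : c ^ 9 = 1 := by
    simp only [Fintype.card_fin, mul_one] at h5
    calc c ^ 9 = c ^ 7 * (c * c) := by ring
      _ = (c * vol' (fun i => e i)) * (c * vol' (fun i => e i)) := by rw [← h5]; ring
      _ = 1 := by rw [hce, one_mul]
  have hc1 : c = 1 := (pow_eq_one_iff_of_nonneg hcpos.le (by norm_num)).1 hc9
  refine ⟨?_, by rw [hv, hc1, one_smul]⟩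
  ext X Y
  rw [hg, hc1, mul_one]

theorem Induces.isG2 {φ : V [⋀^Fin 3]→L[ℝ] ℝ} {g : LinearMap.BilinForm ℝ V}
    {vol : V [⋀^Fin 7]→L[ℝ] ℝ} (h : Induces φ g vol) : IsG2 φ := ⟨(g, vol), h⟩

theorem Induces.g2Metric_eq {φ : V [⋀^Fin 3]→L[ℝ] ℝ} {g : LinearMap.BilinForm ℝ V}
    {vol : V [⋀^Fin 7]→L[ℝ] ℝ} (h : Induces φ g vol) : g2Metric φ = g := by
  rw [g2Metric, dif_pos h.isG2]
  exact (h.isG2.choose_spec.unique h).1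

theorem Induces.g2Vol_eq {φ : V [⋀^Fin 3]→L[ℝ] ℝ} {g : LinearMap.BilinForm ℝ V}
    {vol : V [⋀^Fin 7]→L[ℝ] ℝ} (h : Induces φ g vol) : g2Vol φ = vol := by
  rw [g2Vol, dif_pos h.isG2]
  exact (h.isG2.choose_spec.unique h).2

end Uniqueness

/-! ### Computable components -/

section Computable

/-- The shuffle product of a function of degree `p` with another function. -/
def shuffleDeg {ι R : Type*} [CommRing R] : ℕ → (List ι → R) → (List ι → R) → List ι → R
  | 0, a, b, l => a [] * b l
  | _ + 1, _, _, [] => 0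
  | p + 1, a, b, x :: l => shuffleDeg p (fun m => a (x :: m)) b l +
      (-1) ^ (p + 1) * shuffleDeg (p + 1) a (fun m => b (x :: m)) l

/-- The branches in which `a` would receive too many or too few vectors vanish. Pruning them leaves
a recursion short enough for kernel evaluation. -/
theorem shuffle_eq_shuffleDeg {ι R : Type*} [CommRing R] (p : ℕ) (a b : List ι → R) (l : List ι)
    (ha : ∀ m : List ι, m.length ≠ p → a m = 0) :
    shuffle ((-1) ^ p) a b l = shuffleDeg p a b l := by
  induction l generalizing p a b with
  | nil =>
    rcases p with _ | p
    · rfl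
    · rw [shuffle_nil, ha [] (by simp), zero_mul]; rfl
  | cons x l ih =>
    rcases p with _ | p
    · rw [shuffle_cons, show (fun m => a (x :: m)) = fun _ => 0 from funext fun m => ha _ (by simp),
        shuffle_zero_left, ih 0 a _ ha]
      simp [shuffleDeg]
    · rw [shuffle_cons, shuffleDeg, show -(-1 : R) ^ (p + 1) = (-1) ^ p by ring,
        ih p _ _ (fun m hm => ha _ (by simpa using hm)), ih (p + 1) _ _ ha]

theorem shuffleDeg_intCast {ι : Type*} (p : ℕ) (a b : List ι → ℤ) (l : List ι) :
    shuffleDeg p (fun m => (a m : ℝ)) (fun m => (b m : ℝ)) l = ((shuffleDeg p a b l : ℤ) : ℝ) := by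
  induction l generalizing p a b with
  | nil => rcases p with _ | p <;> simp [shuffleDeg]
  | cons x l ih => rcases p with _ | p <;> simp [shuffleDeg, ih]

variable {n : ℕ}

/-- The components of the monomial `e^i ∧ e^j`. -/
def monoTable2 (i j : Fin n) : List (Fin n) → ℤ
  | [x, y] => (if x = i then if y = j then 1 else 0 else 0) -
      (if x = j then if y = i then 1 else 0 else 0)
  | _ => 0

/-- The components of the monomial `e^i ∧ e^j ∧ e^k`. -/
def monoTable3 (i j k : Fin n) : List (Fin n) → ℤ
  | [x, y, z] => (if z = k then monoTable2 i j [x, y] else 0) -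
      (if y = k then monoTable2 i j [x, z] else 0) + (if x = k then monoTable2 i j [y, z] else 0)
  | _ => 0

/-- The components of the standard form `ω`. -/
def omegaTable (l : List (Fin 6)) : ℤ := monoTable2 0 1 l + monoTable2 2 3 l + monoTable2 4 5 l

/-- The components of the standard form `ψ₊`. -/
def psiPlusTable (l : List (Fin 6)) : ℤ :=
  monoTable3 0 2 4 l - monoTable3 0 3 5 l - monoTable3 1 2 5 l - monoTable3 1 3 4 l

/-- The components of the standard form `ψ₋`. -/
def psiMinusTable (l : List (Fin 6)) : ℤ :=
  -monoTable3 1 3 5 l + monoTable3 1 2 4 l + monoTable3 0 3 4 l + monoTable3 0 2 5 l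

/-- The components of the standard `G₂`-form. -/
def phiTable (l : List (Fin 7)) : ℤ :=
  monoTable3 0 1 6 l + monoTable3 2 3 6 l + monoTable3 4 5 6 l +
    (monoTable3 0 2 4 l - monoTable3 0 3 5 l - monoTable3 1 2 5 l - monoTable3 1 3 4 l)

/-- The identity that makes the standard basis orthonormal for the metric of the standard G₂-form:
(ι_i φ) ∧ (ι_j φ) ∧ φ = 6 δ_ij e^{1…7}. -/
theorem bryant_phiTable : ∀ i j : Fin 7,
    shuffleDeg 4 (shuffleDeg 2 (fun m => phiTable (i :: m)) (fun m => phiTable (j :: m))) phiTable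
      (List.finRange 7) = if i = j then 6 else 0 := by
  decide +kernel

/-- The sign of moving `x` to its place in the sorted list `l`. -/
def insertSign (x : Fin n) : List (Fin n) → ℤ
  | [] => 1
  | y :: l => if x ≤ y then 1 else -insertSign x l

/-- The sign of a permutation given as a list. -/
def listSign : List (Fin n) → ℤ
  | [] => 1
  | x :: l => insertSign x (l.insertionSort (· ≤ ·)) * listSign l

/-- The complement of a list of indices. -/
def compl (l : List (Fin n)) : List (Fin n) := (List.finRange n).filter (· ∉ l)

end Computable

/-! ### Finite checks on the components of the standard forms. -/

section Tables

variable {n : ℕ}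

theorem compl_properties6 : ∀ q ∈ [2, 3, 4], ∀ J ∈ (List.finRange 6).sublistsLen q,
    (compl J ++ J).Nodup ∧ (compl J).length = 6 - q ∧ compl (compl J) = J ∧
    compl J ∈ (List.finRange 6).sublistsLen (6 - q) ∧
    listSign (compl J ++ J) * listSign (J ++ compl J) = (-1) ^ (q * (6 - q)) ∧
    (compl J ++ J).insertionSort (· ≤ ·) = List.finRange 6 := by
  decide +kernel

/-- An increasing list either avoids the last index or ends with it; these cases see respectively
the parts A and B of a form A + B ∧ θ. -/
theorem mem_sublistsLen7 : ∀ q ∈ [2, 3], ∀ J ∈ (List.finRange 7).sublistsLen (q + 1),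
    (∃ J' ∈ (List.finRange 6).sublistsLen (q + 1), J = J'.map Fin.castSucc) ∨
    (∃ J' ∈ (List.finRange 6).sublistsLen q, J = J'.map Fin.castSucc ++ [6]) := by
  decide +kernel

/-- The components of ⋆ω = ω²/2, doubled to stay in the integers. -/
theorem star_omegaTable : ∀ J ∈ (List.finRange 6).sublistsLen 4,
    2 * (listSign (compl J ++ J) * omegaTable (compl J)) = shuffleDeg 2 omegaTable omegaTable J := by
  decide +kernel

theorem star_psiPlusTable : ∀ J ∈ (List.finRange 6).sublistsLen 3,
    listSign (compl J ++ J) * psiPlusTable (compl J) = psiMinusTable J := by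
  decide +kernel

theorem psiPlus_omegaTable : ∀ J ∈ (List.finRange 6).sublistsLen 5,
    shuffleDeg 3 psiPlusTable omegaTable J = 0 := by
  decide +kernel

theorem psiMinus_omegaTable : ∀ J ∈ (List.finRange 6).sublistsLen 5,
    shuffleDeg 3 psiMinusTable omegaTable J = 0 := by
  decide +kernel

theorem vol6Table :
    shuffleDeg 4 (shuffleDeg 2 omegaTable omegaTable) omegaTable (List.finRange 6) = 6 := by
  decide +kernel

end Tables

/-! ### Sorting signs, dual bases and components of monomials. -/

section Coframes

variable {V : Type*} [NormedAddCommGroup V] [NormedSpace ℝ V] {n : ℕ}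

theorem ev_cons_insertSign {k : ℕ} (a : V [⋀^Fin k]→L[ℝ] ℝ) (b : Fin n → V) (x : Fin n)
    (l : List (Fin n)) : ev a ((x :: l).map b) =
      insertSign x l * ev a ((l.orderedInsert (· ≤ ·) x).map b) := by
  induction l generalizing k a with
  | nil => simp [insertSign]
  | cons y l ih =>
    rw [insertSign, List.orderedInsert]
    split_ifs with h
    · simp
    · rw [List.map_cons, List.map_cons, List.map_cons, ev_swap]
      rcases k with _ | k
      · simp [ev_cons_zero]
      · rw [ev_cons, ev_cons, ← List.map_cons, ih]
        push_cast; ring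

theorem ev_listSign {k : ℕ} (a : V [⋀^Fin k]→L[ℝ] ℝ) (b : Fin n → V) (l : List (Fin n)) :
    ev a (l.map b) = listSign l * ev a ((l.insertionSort (· ≤ ·)).map b) := by
  induction l generalizing k a with
  | nil => simp [listSign]
  | cons x l ih =>
    have h : ev a ((x :: l).map b) = listSign l * ev a ((x :: l.insertionSort (· ≤ ·)).map b) := by
      rcases k with _ | k
      · simp [ev_cons_zero]
      · rw [List.map_cons, List.map_cons, ev_cons, ev_cons, ih]
    rw [h, ev_cons_insertSign, listSign, List.insertionSort_cons]
    push_cast; ring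

/-- The coframe `E` is dual to the basis `b`. -/
def IsDual (E : Fin n → V [⋀^Fin 1]→L[ℝ] ℝ) (b : Fin n → V) : Prop :=
  ∀ i j, E i (fun _ => b j) = if i = j then 1 else 0

theorem IsDual.ev_eq {E : Fin n → V [⋀^Fin 1]→L[ℝ] ℝ} {b : Fin n → V} (h : IsDual E b)
    (i j : Fin n) : ev (E i) [b j] = if i = j then 1 else 0 := by
  rw [ev_singleton, h]

theorem IsDual.ev_mono2 {E : Fin n → V [⋀^Fin 1]→L[ℝ] ℝ} {b : Fin n → V} (h : IsDual E b)
    (i j : Fin n) (l : List (Fin n)) : ev (mono2 E i j) (l.map b) = monoTable2 i j l := by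
  match l with
  | [] => simp [monoTable2, ev_of_length_ne]
  | [x] => simp [monoTable2, ev_of_length_ne]
  | [x, y] =>
    simp [monoTable2, mono2, ev_wedge, shuffle, h.ev_eq, ev_of_length_ne, eq_comm]
    split_ifs <;> simp
  | x :: y :: z :: l => simp [monoTable2, ev_of_length_ne]

theorem IsDual.ev_mono3 {E : Fin n → V [⋀^Fin 1]→L[ℝ] ℝ} {b : Fin n → V} (h : IsDual E b)
    (i j k : Fin n) (l : List (Fin n)) : ev (mono3 E i j k) (l.map b) = monoTable3 i j k l := by
  match l with
  | [] => simp [monoTable3, ev_of_length_ne]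
  | [x] => simp [monoTable3, ev_of_length_ne]
  | [x, y] => simp [monoTable3, ev_of_length_ne]
  | [x, y, z] =>
    have h2 : ∀ x y, ev (mono2 E i j) [b x, b y] = monoTable2 i j [x, y] :=
      fun x y => h.ev_mono2 i j [x, y]
    simp [monoTable3, mono3, ev_wedge, shuffle, h.ev_eq, h2, ev_of_length_ne, eq_comm]
    split_ifs <;> ring_nf
  | x :: y :: z :: t :: l => simp [monoTable3, ev_of_length_ne]

theorem IsDual.linearIndependent {E : Fin n → V [⋀^Fin 1]→L[ℝ] ℝ} {b : Fin n → V}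
    (h : IsDual E b) : LinearIndependent ℝ E := by
  rw [Fintype.linearIndependent_iff]
  intro c hc i
  have := congrArg (fun w : V [⋀^Fin 1]→L[ℝ] ℝ => w (fun _ => b i)) hc
  simpa [h _ _] using this

/-- Forms of degree 1 embed into the dual space, where n independent ones form a basis; its dual
basis lives in the bidual and is brought back to V by the evaluation isomorphism. -/
theorem exists_isDual [NeZero n] [FiniteDimensional ℝ V] (hn : Module.finrank ℝ V = n)
    {E : Fin n → V [⋀^Fin 1]→L[ℝ] ℝ} (hE : LinearIndependent ℝ E) :
    ∃ b : Module.Basis (Fin n) ℝ V, IsDual E b := by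
  let F : V [⋀^Fin 1]→L[ℝ] ℝ →ₗ[ℝ] Module.Dual ℝ V :=
    { toFun := fun w =>
        { toFun := fun x => w (fun _ => x)
          map_add' := fun x y => by
            have := ev_cons_add w x y []
            rwa [ev_singleton, ev_singleton, ev_singleton] at this
          map_smul' := fun c x => by
            have := ev_cons_smul w c x []
            rwa [ev_singleton, ev_singleton] at this }
      map_add' := fun w w' => rfl
      map_smul' := fun c w => rfl }
  have hF : LinearMap.ker F = ⊥ := by
    rw [LinearMap.ker_eq_bot']
    intro w hw
    ext v
    have := LinearMap.congr_fun hw (v 0)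
    rw [show v = fun _ => v 0 from funext fun i => by rw [Subsingleton.elim i 0]]
    exact this
  have hli := hE.map' F hF
  have hcard : Fintype.card (Fin n) = Module.finrank ℝ (Module.Dual ℝ V) := by
    rw [Subspace.dual_finrank_eq, hn, Fintype.card_fin]
  have : Nonempty (Fin n) := ⟨0⟩
  let c : Module.Basis (Fin n) ℝ (Module.Dual ℝ V) :=
    basisOfLinearIndependentOfCardEqFinrank hli hcard
  have hc : ∀ i, c i = F (E i) := fun i => by simp [c]
  refine ⟨c.dualBasis.map (Module.evalEquiv ℝ V).symm, fun i j => ?_⟩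
  have h1 : E i (fun _ => (c.dualBasis.map (Module.evalEquiv ℝ V).symm) j) = c.dualBasis j (c i) := by
    rw [hc, Module.Basis.map_apply]
    exact Module.apply_evalEquiv_symm_apply ℝ V (F (E i)) (c.dualBasis j)
  rw [h1, Module.Basis.dualBasis_apply_self]

end Coframes

/-! ### Linear algebra of SU(3)- and G₂-structures at a point. -/

section Pointwise

variable {V : Type*} [NormedAddCommGroup V] [NormedSpace ℝ V]

theorem ev_wedge_map {n p q : ℕ} (A : V [⋀^Fin p]→L[ℝ] ℝ) (B : V [⋀^Fin q]→L[ℝ] ℝ) (b : Fin n → V)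
    (l : List (Fin n)) : ev (wedge A B) (l.map b) =
      shuffleDeg p (fun m => ev A (m.map b)) (fun m => ev B (m.map b)) l := by
  rw [ev_wedge, shuffle_map, shuffle_eq_shuffleDeg]
  exact fun m hm => ev_of_length_ne A (by simpa using hm)

theorem ev_wedge_table {n p q : ℕ} {A : V [⋀^Fin p]→L[ℝ] ℝ} {B : V [⋀^Fin q]→L[ℝ] ℝ} {b : Fin n → V}
    {TA TB : List (Fin n) → ℤ} (hA : ∀ l, ev A (l.map b) = TA l) (hB : ∀ l, ev B (l.map b) = TB l)
    (l : List (Fin n)) : ev (wedge A B) (l.map b) = shuffleDeg p TA TB l := by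
  rw [ev_wedge_map, ← shuffleDeg_intCast]
  simp only [hA, hB]

theorem ev_hodgeStar_compl {n p q : ℕ} (hn : q + p = n) {g : LinearMap.BilinForm ℝ V}
    {e : Module.Basis (Fin n) ℝ V} (he : IsOrthonormalBasis g e) {vol : V [⋀^Fin n]→L[ℝ] ℝ}
    (hvol : ev vol ((List.finRange n).map e) = 1) (β : V [⋀^Fin p]→L[ℝ] ℝ) {J : List (Fin n)}
    (hJ : J.length = q) (hnd : (compl J ++ J).Nodup) (hK : (compl J).length = p)
    (hs : (compl J ++ J).insertionSort (· ≤ ·) = List.finRange n) :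
    ev (hodgeStar g (castDeg hn.symm vol) β) (J.map e) =
      listSign (compl J ++ J) * ev β ((compl J).map e) := by
  rw [ev_hodgeStar hn he vol β hnd hK hJ, ev_listSign vol, hs, hvol]
  ring

theorem hodgeStar_smul {p q : ℕ} (g : LinearMap.BilinForm ℝ V) (vol : V [⋀^Fin (q + p)]→L[ℝ] ℝ)
    (c : ℝ) (β : V [⋀^Fin p]→L[ℝ] ℝ) : hodgeStar g vol (c • β) = c • hodgeStar g vol β := by
  unfold hodgeStar
  split_ifs
  · refine ev_ext fun l => ?_
    simp only [ev_smul, ev_sum, ContinuousAlternatingMap.smul_apply, smul_eq_mul, mul_assoc,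
      ← Finset.mul_sum]
    ring
  · exact (smul_zero c).symm

theorem hodgeStar_add {p q : ℕ} (g : LinearMap.BilinForm ℝ V) (vol : V [⋀^Fin (q + p)]→L[ℝ] ℝ)
    (β β' : V [⋀^Fin p]→L[ℝ] ℝ) :
    hodgeStar g vol (β + β') = hodgeStar g vol β + hodgeStar g vol β' := by
  unfold hodgeStar
  split_ifs
  · refine ev_ext fun l => ?_
    simp only [ev_smul, ev_add, ev_sum, ContinuousAlternatingMap.add_apply, add_mul,
      Finset.sum_add_distrib, mul_add]
  · exact (add_zero _).symm

/-- Componentwise, (⋆γ)(e_J) vol = −e^J ∧ γ for 3-forms. The minus sign is (-1)^9, from exchanging J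
with its complement. `G` holds arbitrary real components, so the twenty cases are expanded
symbolically. -/
theorem shuffleDeg_monoTable3 (G : List (Fin 6) → ℝ) : ∀ J ∈ (List.finRange 6).sublistsLen 3,
    -shuffleDeg 3 (fun m => (monoTable3 (J.getD 0 0) (J.getD 1 0) (J.getD 2 0) m : ℝ)) G
      (List.finRange 6) = listSign (compl J ++ J) * G (compl J) := by
  rw [show (List.finRange 6).sublistsLen 3 = [[3, 4, 5], [2, 4, 5], [2, 3, 5], [2, 3, 4], [1, 4, 5],
    [1, 3, 5], [1, 3, 4], [1, 2, 5], [1, 2, 4], [1, 2, 3], [0, 4, 5], [0, 3, 5], [0, 3, 4],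
    [0, 2, 5], [0, 2, 4], [0, 2, 3], [0, 1, 5], [0, 1, 4], [0, 1, 3], [0, 1, 2]] by decide]
  simp only [List.forall_mem_cons]
  refine ⟨?_, ?_, ?_, ?_, ?_, ?_, ?_, ?_, ?_, ?_, ?_, ?_, ?_, ?_, ?_, ?_, ?_, ?_, ?_, ?_, by simp⟩ <;>
  simp [shuffleDeg, monoTable2, monoTable3, listSign, insertSign, compl, List.finRange_succ, pow_succ]

namespace IsAdaptedCoframe

variable {e : Fin 6 → V [⋀^Fin 1]→L[ℝ] ℝ} {g : LinearMap.BilinForm ℝ V}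
  {w : V [⋀^Fin 2]→L[ℝ] ℝ} {ψp ψm : V [⋀^Fin 3]→L[ℝ] ℝ} {b : Module.Basis (Fin 6) ℝ V}

theorem ev_omega (he : IsAdaptedCoframe e g w ψp ψm) (hb : IsDual e b) (l : List (Fin 6)) :
    ev w (l.map b) = omegaTable l := by
  rw [he.omega_eq, omegaTable]
  simp [ev_add, hb.ev_mono2]

theorem ev_psiPlus (he : IsAdaptedCoframe e g w ψp ψm) (hb : IsDual e b) (l : List (Fin 6)) :
    ev ψp (l.map b) = psiPlusTable l := by
  rw [he.psiPlus_eq, psiPlusTable]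
  simp [ev_sub, hb.ev_mono3]

theorem ev_psiMinus (he : IsAdaptedCoframe e g w ψp ψm) (hb : IsDual e b) (l : List (Fin 6)) :
    ev ψm (l.map b) = psiMinusTable l := by
  rw [he.psiMinus_eq, psiMinusTable]
  simp [ev_add, ev_neg, hb.ev_mono3]

theorem isOrthonormalBasis (he : IsAdaptedCoframe e g w ψp ψm) (hb : IsDual e b) :
    IsOrthonormalBasis g b := by
  intro i j
  rw [he.metric_eq]
  simp [hb _ _, eq_comm]

theorem ev_vol6 (he : IsAdaptedCoframe e g w ψp ψm) (hb : IsDual e b) :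
    ev (vol6 w) ((List.finRange 6).map b) = 1 := by
  rw [vol6, ev_smul, sq, ev_wedge_table (ev_wedge_table (he.ev_omega hb) (he.ev_omega hb))
    (he.ev_omega hb), vol6Table]
  norm_num

theorem ev_star (he : IsAdaptedCoframe e g w ψp ψm) (hb : IsDual e b) {p q : ℕ} (h : q + p = 6)
    (hq : q ∈ [2, 3, 4]) (β : V [⋀^Fin p]→L[ℝ] ℝ) {J : List (Fin 6)}
    (hJ : J ∈ (List.finRange 6).sublistsLen q) :
    ev (hodgeStar g (castDeg h.symm (vol6 w)) β) (J.map b) =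
      listSign (compl J ++ J) * ev β ((compl J).map b) := by
  obtain ⟨h1, h2, -, -, -, h3⟩ := compl_properties6 q hq J hJ
  exact ev_hodgeStar_compl h (he.isOrthonormalBasis hb) (he.ev_vol6 hb) β
    (List.mem_sublistsLen.1 hJ).2 h1 (by omega) h3

theorem star_star (he : IsAdaptedCoframe e g w ψp ψm) (hb : IsDual e b) {p q : ℕ} (h : q + p = 6)
    (h' : p + q = 6) (hq : q ∈ [2, 3, 4]) (hp : p ∈ [2, 3, 4]) (β : V [⋀^Fin p]→L[ℝ] ℝ) :
    hodgeStar g (castDeg h'.symm (vol6 w)) (hodgeStar g (castDeg h.symm (vol6 w)) β) =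
      ((-1 : ℝ) ^ (p * q)) • β := by
  refine ev_ext_basis b fun J hJ => ?_
  obtain ⟨-, -, h3, h4, h5, -⟩ := compl_properties6 p hp J hJ
  rw [show 6 - p = q by omega] at h4 h5
  rw [he.ev_star hb h' hp _ hJ, he.ev_star hb h hq _ h4, h3, ev_smul]
  have h6 : (listSign (compl J ++ J) : ℝ) * listSign (J ++ compl J) = (-1) ^ (p * q) := by
    exact_mod_cast h5
  rw [← h6]
  ring

theorem star_omegaSq (he : IsAdaptedCoframe e g w ψp ψm) (hb : IsDual e b) :
    hodgeStar (p := 2) (q := 4) g (castDeg rfl (vol6 w)) w = (1 / 2 : ℝ) • sq w := by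
  refine ev_ext_basis b fun J hJ => ?_
  rw [he.ev_star hb (p := 2) (q := 4) rfl (by simp) _ hJ, ev_smul, sq,
    ev_wedge_table (he.ev_omega hb) (he.ev_omega hb), he.ev_omega hb, ← star_omegaTable J hJ]
  push_cast; ring

theorem star_sq (he : IsAdaptedCoframe e g w ψp ψm) (hb : IsDual e b) :
    hodgeStar (p := 4) (q := 2) g (castDeg rfl (vol6 w)) (sq w) = (2 : ℝ) • w := by
  have h2 := he.star_star hb (p := 2) (q := 4) rfl rfl (by simp) (by simp) w
  rw [he.star_omegaSq hb, hodgeStar_smul] at h2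
  refine ev_ext fun l => ?_
  have h3 := congrArg (fun u => ev u l) h2
  simp only [ev_smul] at h3 ⊢
  linarith

theorem star_psiPlus (he : IsAdaptedCoframe e g w ψp ψm) (hb : IsDual e b) :
    hodgeStar (p := 3) (q := 3) g (castDeg rfl (vol6 w)) ψp = ψm := by
  refine ev_ext_basis b fun J hJ => ?_
  rw [he.ev_star hb (p := 3) (q := 3) rfl (by simp) _ hJ, he.ev_psiPlus hb, he.ev_psiMinus hb,
    ← star_psiPlusTable J hJ]
  push_cast; ring

theorem star_psiMinus (he : IsAdaptedCoframe e g w ψp ψm) (hb : IsDual e b) :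
    hodgeStar (p := 3) (q := 3) g (castDeg rfl (vol6 w)) ψm = -ψp := by
  have h2 := he.star_star hb (p := 3) (q := 3) rfl rfl (by simp) (by simp) ψp
  rw [he.star_psiPlus hb] at h2
  rw [h2]
  exact ev_ext fun l => by simp only [ev_smul, ev_neg]; ring

theorem psiPlus_wedge_omega (he : IsAdaptedCoframe e g w ψp ψm) (hb : IsDual e b) :
    wedge ψp w = 0 := by
  refine ev_ext_basis b fun J hJ => ?_
  rw [ev_wedge_table (he.ev_psiPlus hb) (he.ev_omega hb), psiPlus_omegaTable J hJ, ev_zero]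
  simp

theorem psiMinus_wedge_omega (he : IsAdaptedCoframe e g w ψp ψm) (hb : IsDual e b) :
    wedge ψm w = 0 := by
  refine ev_ext_basis b fun J hJ => ?_
  rw [ev_wedge_table (he.ev_psiMinus hb) (he.ev_omega hb), psiMinus_omegaTable J hJ, ev_zero]
  simp

/-- The Lefschetz map ν ↦ ν ∧ ω² is injective on 1-forms: each component of ν ∧ ω² is a nonzero
multiple of a single component of ν. -/
theorem eq_zero_of_wedge_omega_omega (he : IsAdaptedCoframe e g w ψp ψm) (hb : IsDual e b)
    {ν : V [⋀^Fin 1]→L[ℝ] ℝ} (h : wedge (wedge ν w) w = 0) : ν = 0 := by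
  have h1 : ∀ J ∈ (List.finRange 6).sublistsLen 5,
      shuffleDeg 3 (shuffleDeg 1 (fun m => ev ν (m.map b)) (fun m => (omegaTable m : ℝ)))
        (fun m => (omegaTable m : ℝ)) J = 0 := by
    intro J _
    have h2 := ev_wedge_map (wedge ν w) w b J
    rw [h, ev_zero] at h2
    simp only [ev_wedge_map, he.ev_omega hb] at h2
    exact h2.symm
  refine ev_ext_basis b ?_
  rw [show (List.finRange 6).sublistsLen 5 = [[1, 2, 3, 4, 5], [0, 2, 3, 4, 5], [0, 1, 3, 4, 5],
    [0, 1, 2, 4, 5], [0, 1, 2, 3, 5], [0, 1, 2, 3, 4]] by decide] at h1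
  rw [show (List.finRange 6).sublistsLen 1 = [[5], [4], [3], [2], [1], [0]] by decide]
  simp [shuffleDeg, omegaTable, monoTable2, ev_zero] at h1 ⊢
  obtain ⟨h0, h1, h2, h3, h4, h5⟩ := h1
  refine ⟨?_, ?_, ?_, ?_, ?_, ?_⟩ <;> linarith

/-- Λ⁴ is the direct sum of ℝω², Λ¹ ∧ ψ₋ and Λ²₈ ∧ ω. Here σ ↦ ⋆(σ ∧ ω) has eigenvalues 2, 1 and −1
on 2-forms, and Λ²₈ is the eigenspace of −1, so the equation for ⋆σ characterizes it. In components,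
`h1` and `h3` are linear systems of fifteen equations each, which together leave only the zero
solution. -/
theorem decomposition (he : IsAdaptedCoframe e g w ψp ψm) (hb : IsDual e b)
    {c : ℝ} {π : V [⋀^Fin 1]→L[ℝ] ℝ} {σ : V [⋀^Fin 2]→L[ℝ] ℝ}
    (hσ : hodgeStar (p := 2) (q := 4) g (castDeg rfl (vol6 w)) σ = -wedge σ w)
    (h : c • sq w + wedge π ψm - wedge σ w = 0) : c = 0 ∧ π = 0 ∧ σ = 0 := by
  have h1 : ∀ J ∈ (List.finRange 6).sublistsLen 4,
      listSign (compl J ++ J) * ev σ ((compl J).map b) =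
        -shuffleDeg 2 (fun m => ev σ (m.map b)) (fun m => (omegaTable m : ℝ)) J := by
    intro J hJ
    have h2 := ev_wedge_map σ w b J
    simp only [he.ev_omega hb] at h2
    rw [← he.ev_star hb (p := 2) (q := 4) rfl (by simp) _ hJ, hσ, ev_neg, h2]
  have h3 : ∀ J ∈ (List.finRange 6).sublistsLen 4,
      c * shuffleDeg 2 omegaTable omegaTable J +
        shuffleDeg 1 (fun m => ev π (m.map b)) (fun m => (psiMinusTable m : ℝ)) J -
        shuffleDeg 2 (fun m => ev σ (m.map b)) (fun m => (omegaTable m : ℝ)) J = 0 := by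
    intro J hJ
    have h2 := congrArg (fun u => ev u (J.map b)) h
    simp only [ev_zero, ev_add, ev_sub, ev_smul, sq] at h2
    rw [ev_wedge_table (he.ev_omega hb) (he.ev_omega hb), ev_wedge_map π, ev_wedge_map σ] at h2
    simpa only [he.ev_omega hb, he.ev_psiMinus hb] using h2
  rw [show (List.finRange 6).sublistsLen 4 = [[2, 3, 4, 5], [1, 3, 4, 5], [1, 2, 4, 5],
    [1, 2, 3, 5], [1, 2, 3, 4], [0, 3, 4, 5], [0, 2, 4, 5], [0, 2, 3, 5], [0, 2, 3, 4], [0, 1, 4, 5],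
    [0, 1, 3, 5], [0, 1, 3, 4], [0, 1, 2, 5], [0, 1, 2, 4], [0, 1, 2, 3]] by decide] at h1 h3
  simp [shuffleDeg, omegaTable, psiMinusTable, monoTable2, monoTable3, listSign, insertSign, compl,
    List.finRange_succ] at h1 h3
  obtain ⟨a1, a2, a3, a4, a5, a6, a7, a8, a9, a10, a11, a12, a13, a14, a15⟩ := h1
  obtain ⟨c1, c2, c3, c4, c5, c6, c7, c8, c9, c10, c11, c12, c13, c14, c15⟩ := h3
  refine ⟨by linarith, ev_ext_basis b ?_, ev_ext_basis b ?_⟩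
  · rw [show (List.finRange 6).sublistsLen 1 = [[5], [4], [3], [2], [1], [0]] by decide]
    simp only [List.forall_mem_cons, List.map_cons, List.map_nil, ev_zero]
    refine ⟨?_, ?_, ?_, ?_, ?_, ?_, by simp⟩ <;> linarith
  · rw [show (List.finRange 6).sublistsLen 2 = [[4, 5], [3, 5], [3, 4], [2, 5], [2, 4], [2, 3],
      [1, 5], [1, 4], [1, 3], [1, 2], [0, 5], [0, 4], [0, 3], [0, 2], [0, 1]] by decide]
    simp only [List.forall_mem_cons, List.map_cons, List.map_nil, ev_zero]
    refine ⟨?_, ?_, ?_, ?_, ?_, ?_, ?_, ?_, ?_, ?_, ?_, ?_, ?_, ?_, ?_, by simp⟩ <;> linarith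

theorem exists_isDual [FiniteDimensional ℝ V] (hn : Module.finrank ℝ V = 6)
    (he : IsAdaptedCoframe e g w ψp ψm) : ∃ b : Module.Basis (Fin 6) ℝ V, IsDual e b :=
  WarpedCoflow.exists_isDual hn he.linearIndependent

theorem wedge_self_one (a : V [⋀^Fin 1]→L[ℝ] ℝ) : wedge a a = 0 := by
  refine ev_ext fun l => ?_
  have := wedge_comm a a l
  rw [one_mul, pow_one] at this
  rw [ev_zero]
  linarith

theorem wedge_comm_one (a a' : V [⋀^Fin 1]→L[ℝ] ℝ) : wedge a a' = -wedge a' a := by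
  refine ev_ext fun l => ?_
  rw [wedge_comm a a' l, ev_neg]
  ring

/-- Multiplying the complex volume form `ψ₊ + i ψ₋` by the phase `α + i β`. -/
theorem rotate [FiniteDimensional ℝ V] (hn : Module.finrank ℝ V = 6)
    (he : IsAdaptedCoframe e g w ψp ψm) {α β : ℝ}
    (hαβ : α ^ 2 + β ^ 2 = 1) :
    IsAdaptedCoframe ![α • e 0 - β • e 1, β • e 0 + α • e 1, e 2, e 3, e 4, e 5] g w
      (α • ψp - β • ψm) (β • ψp + α • ψm) := by
  obtain ⟨b, hb⟩ := he.exists_isDual hn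
  refine ⟨?_, ?_, ?_, ?_, ?_⟩
  -- The phase is absorbed into e¹ + i e² alone, by a rotation of the first two covectors. The dual
  -- vectors rotate by the same orthogonal matrix.
  · have : IsDual ![α • e 0 - β • e 1, β • e 0 + α • e 1, e 2, e 3, e 4, e 5]
        ![α • b 0 - β • b 1, β • b 0 + α • b 1, b 2, b 3, b 4, b 5] := by
      have h1 : ∀ (k : Fin 6) (c d : ℝ) (i j : Fin 6), e k (fun _ => c • b i + d • b j) =
          c * (if k = i then 1 else 0) + d * (if k = j then 1 else 0) := by
        intro k c d i j
        rw [← ev_singleton, ev_cons_add, ev_cons_smul, ev_cons_smul, hb.ev_eq, hb.ev_eq]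
      intro i j
      fin_cases i <;> fin_cases j <;> simp [h1, hb _ _, sub_eq_add_neg, ← neg_smul] <;> nlinarith
    exact this.linearIndependent
  · intro X Y
    rw [he.metric_eq]
    simp only [Fin.sum_univ_six]
    simp
    linear_combination (-(e 0 (fun _ => X) * e 0 (fun _ => Y)) - e 1 (fun _ => X) * e 1 (fun _ => Y)) * hαβ
  · rw [he.omega_eq]
    simp [mono2, wedge_add_right, wedge_sub_left, wedge_smul_left, wedge_smul_right,
      wedge_self_one]
    rw [wedge_comm_one (e 1) (e 0)]
    refine ev_ext fun l => ?_
    simp only [ev_add, ev_smul, ev_neg]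
    linear_combination (-ev (wedge (e 0) (e 1)) l) * hαβ
  · rw [he.psiPlus_eq, he.psiMinus_eq]
    simp only [mono3, mono2, wedge_add_left, wedge_sub_left, wedge_smul_left, Matrix.cons_val]
    refine ev_ext fun l => ?_
    simp only [ev_add, ev_sub, ev_smul, ev_neg]
    ring
  · rw [he.psiPlus_eq, he.psiMinus_eq]
    simp only [mono3, mono2, wedge_add_left, wedge_sub_left, wedge_smul_left, Matrix.cons_val]
    refine ev_ext fun l => ?_
    simp only [ev_add, ev_sub, ev_smul, ev_neg]
    ring

theorem eq_smul_vol6 (he : IsAdaptedCoframe e g w ψp ψm) (hb : IsDual e b)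
    (τ : V [⋀^Fin 6]→L[ℝ] ℝ) : τ = ev τ ((List.finRange 6).map b) • vol6 w := by
  refine ev_ext_basis b fun J hJ => ?_
  rw [show (List.finRange 6).sublistsLen 6 = [List.finRange 6] by decide, List.mem_singleton] at hJ
  rw [hJ, ev_smul, he.ev_vol6 hb, mul_one]

/-- The increasing triples of indices. -/
def triples : Finset (Fin 6 × Fin 6 × Fin 6) :=
  Finset.univ.filter fun t => t.1 < t.2.1 ∧ t.2.1 < t.2.2

/-- A formula for the Hodge star on 3-forms that does not involve the dual basis. -/
theorem star_eq_sum (he : IsAdaptedCoframe e g w ψp ψm) (hb : IsDual e b)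
    (γ : V [⋀^Fin 3]→L[ℝ] ℝ) (v : Fin 6 → V) (hv : vol6 w v ≠ 0) :
    hodgeStar (p := 3) (q := 3) g (castDeg rfl (vol6 w)) γ =
      ∑ t ∈ triples, (-(wedge (mono3 e t.1 t.2.1 t.2.2) γ v / vol6 w v)) •
        mono3 e t.1 t.2.1 t.2.2 := by
  refine ev_ext_basis b fun J hJ => ?_
  obtain ⟨t, ht, rfl⟩ : ∃ t ∈ triples, [t.1, t.2.1, t.2.2] = J := by
    revert J
    decide +kernel
  -- Forms of degree 6 are multiples of the volume form, so this ratio is the same for every tuple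
  -- `v` on which the volume does not vanish.
  have h1 : ∀ t : Fin 6 × Fin 6 × Fin 6, wedge (mono3 e t.1 t.2.1 t.2.2) γ v / vol6 w v =
      ev (wedge (mono3 e t.1 t.2.1 t.2.2) γ) ((List.finRange 6).map b) := by
    intro t
    have := congrArg (fun τ : V [⋀^Fin 6]→L[ℝ] ℝ => τ v)
      (he.eq_smul_vol6 hb (wedge (mono3 e t.1 t.2.1 t.2.2) γ))
    simp only [ContinuousAlternatingMap.smul_apply, smul_eq_mul] at this
    rw [this, mul_div_cancel_right₀ _ hv]
  rw [ev_sum, Finset.sum_eq_single t]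
  · rw [ev_smul, h1, hb.ev_mono3, ev_wedge_map, he.ev_star hb (p := 3) (q := 3) rfl (by simp) _ hJ]
    simp only [hb.ev_mono3]
    rw [show monoTable3 t.1 t.2.1 t.2.2 [t.1, t.2.1, t.2.2] = 1 by revert t; decide +kernel]
    have h2 := shuffleDeg_monoTable3 (fun m => ev γ (m.map b)) _ hJ
    simp only [List.getD_cons_zero, List.getD_cons_succ] at h2
    rw [← h2]
    push_cast
    ring
  · intro t' ht' hne
    rw [ev_smul, hb.ev_mono3]
    have : ∀ t ∈ triples, ∀ t' ∈ triples, t' ≠ t →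
        monoTable3 t'.1 t'.2.1 t'.2.2 [t.1, t.2.1, t.2.2] = 0 := by decide +kernel
    rw [this t ht t' ht' hne]
    simp
  · exact fun h => absurd ht h

end IsAdaptedCoframe

/-- The standard `G₂`-form induces the metric and the volume form of the standard basis. -/
theorem exists_induces {b : Module.Basis (Fin 7) ℝ V} {φ : V [⋀^Fin 3]→L[ℝ] ℝ}
    (hφ : ∀ l, ev φ (l.map b) = phiTable l) :
    ∃ g vol, Induces φ g vol ∧ IsOrthonormalBasis g b ∧ ev vol ((List.finRange 7).map b) = 1 := by
  have hbr : ∀ i j, ev (bryantForm φ (b i) (b j)) ((List.finRange 7).map b) =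
      if i = j then 6 else 0 := by
    intro i j
    have h1 : ∀ (i : Fin 7) (l : List (Fin 7)), ev (φ.curryLeft (b i)) (l.map b) =
        phiTable (i :: l) := fun i l => by rw [← hφ, List.map_cons, ev_cons (k := 2)]
    rw [bryantForm, ev_wedge_table (ev_wedge_table (h1 i) (h1 j)) hφ, bryant_phiTable]
    split_ifs <;> simp
  let g : LinearMap.BilinForm ℝ V := ∑ i, (b.coord i).smulRight (b.coord i)
  have hg : ∀ X Y, g X Y = ∑ i, b.repr X i * b.repr Y i := by
    intro X Y
    simp [g]
  have hgb : IsOrthonormalBasis g b := by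
    intro i j
    rw [hg]
    simp [Finsupp.single_apply]
  have hB : ∀ X Y, ev (bryantForm φ X Y) ((List.finRange 7).map b) = 6 * g X Y := by
    intro X Y
    -- Bilinearity in X and Y extends the finite check from the basis to all vectors.
    let B : LinearMap.BilinForm ℝ V := LinearMap.mk₂ ℝ
      (fun X Y => ev (bryantForm φ X Y) ((List.finRange 7).map b))
      (fun x y z => by
        simp only [bryantForm]
        rw [map_add, wedge_add_left, wedge_add_left, ev_add])
      (fun c x z => by
        simp only [bryantForm]
        rw [map_smul, wedge_smul_left, wedge_smul_left, ev_smul]; rfl)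
      (fun x y z => by
        simp only [bryantForm]
        rw [map_add, wedge_add_right, wedge_add_left, ev_add])
      (fun c x z => by
        simp only [bryantForm]
        rw [map_smul, wedge_smul_right, wedge_smul_left, ev_smul]; rfl)
    have hBe : ∀ X Y, ev (bryantForm φ X Y) ((List.finRange 7).map b) = B X Y :=
      fun X Y => by simp only [B, LinearMap.mk₂_apply]
    have : B = (6 : ℝ) • g := by
      refine LinearMap.ext_basis b b fun i j => ?_
      rw [← hBe, hbr, LinearMap.smul_apply, LinearMap.smul_apply, hgb i j]
      split_ifs <;> simp
    rw [hBe, this]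
    rfl
  have hvol : ev ((1 / 6 : ℝ) • bryantForm φ (b 0) (b 0)) ((List.finRange 7).map b) = 1 := by
    rw [ev_smul, hbr]; norm_num
  refine ⟨g, (1 / 6 : ℝ) • bryantForm φ (b 0) (b 0), ⟨fun X Y => ?_, b, hgb, ?_⟩, hgb, hvol⟩
  · refine ev_ext_basis b fun J hJ => ?_
    rw [show (List.finRange 7).sublistsLen 7 = [List.finRange 7] by decide, List.mem_singleton] at hJ
    rw [hJ, ev_smul, hvol, ev_smul, hB]
    ring
  · rw [← List.ofFn_eq_map] at hvol
    exact (ev_ofFn _ _).symm.trans hvol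

end Pointwise

/-! ### Forms on a product with a line -/

section Lift

/-- When J avoids the last index, that index ends up between the complement of J and J, and moving
it to the end past the q entries of J costs (-1)^q. In the next lemma it already stands at the end
and costs nothing. -/
theorem compl_castSucc : ∀ q ∈ [2, 3, 4], ∀ J ∈ (List.finRange 6).sublistsLen q,
    compl (J.map Fin.castSucc) = (compl J).map Fin.castSucc ++ [6] ∧
    listSign (compl (J.map Fin.castSucc) ++ J.map Fin.castSucc) =
      (-1) ^ q * listSign (compl J ++ J) := by
  decide +kernel

theorem compl_castSucc_append : ∀ q ∈ [2, 3, 4], ∀ J ∈ (List.finRange 6).sublistsLen q,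
    compl (J.map Fin.castSucc ++ [6]) = (compl J).map Fin.castSucc ∧
    listSign (compl (J.map Fin.castSucc ++ [6]) ++ (J.map Fin.castSucc ++ [6])) =
      listSign (compl J ++ J) := by
  decide +kernel

theorem compl_finRange7 : ∀ q ∈ [3, 4], ∀ J ∈ (List.finRange 7).sublistsLen q,
    (compl J ++ J).Nodup ∧ (compl J).length = 7 - q ∧
    (compl J ++ J).insertionSort (· ≤ ·) = List.finRange 7 := by
  decide +kernel

/-- Since the covector `B` kills every entry of `l`, only the shuffle that hands the last vector to
`B` survives. -/
theorem shuffle_append_singleton {ι R : Type*} [CommRing R] (s : R) (A B : List ι → R)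
    (l : List ι) (x : ι) (hB : ∀ m, m.length ≠ 1 → B m = 0) (hl : ∀ y ∈ l, B [y] = 0) :
    shuffle s A B (l ++ [x]) = s * (-1) ^ l.length * A l * B [x] := by
  induction l generalizing s A with
  | nil => simp [shuffle, hB [] (by simp), mul_assoc]
  | cons y l ih =>
    have h1 : (fun m => B (y :: m)) = fun _ => 0 := by
      funext m
      by_cases hm : m = []
      · subst hm; exact hl y (by simp)
      · exact hB _ (by simpa using hm)
    rw [List.cons_append, shuffle_cons, h1, shuffle_zero_right, mul_zero, add_zero,
      ih _ _ fun z hz => hl z (by simp [hz]), List.length_cons, pow_succ]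
    ring

theorem shuffle_eq_zero_of_right {ι R : Type*} [CommRing R] (s : R) (A B : List ι → R)
    (l : List ι) (hB : ∀ m, m.length ≠ 1 → B m = 0) (hl : ∀ y ∈ l, B [y] = 0) :
    shuffle s A B l = 0 := by
  induction l generalizing s A with
  | nil => simp [shuffle, hB [] (by simp)]
  | cons y l ih =>
    have h1 : (fun m => B (y :: m)) = fun _ => 0 := by
      funext m
      by_cases hm : m = []
      · subst hm; exact hl y (by simp)
      · exact hB _ (by simpa using hm)
    rw [shuffle_cons, h1, shuffle_zero_right, mul_zero, add_zero,
      ih _ _ fun z hz => hl z (by simp [hz])]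

variable {V U : Type*} [NormedAddCommGroup V] [NormedSpace ℝ V]
  [NormedAddCommGroup U] [NormedSpace ℝ U]

theorem ev_eq_zero_of_zero_mem {k : ℕ} (a : V [⋀^Fin k]→L[ℝ] ℝ) {l : List V} (h : 0 ∈ l) :
    ev a l = 0 := by
  obtain ⟨n, u, rfl⟩ : ∃ q, ∃ u : Fin q → V, List.ofFn u = l := ⟨_, l.get, List.ofFn_get l⟩
  by_cases hn : n = k
  · subst hn
    rw [ev_ofFn]
    obtain ⟨i, hi⟩ := List.mem_ofFn.1 h
    exact a.map_coord_zero i hi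
  · exact ev_of_length_ne _ (by simpa using hn)

/-- The form `A + B ∧ θ` on `V × U`. -/
def lift (θ : U [⋀^Fin 1]→L[ℝ] ℝ) {k : ℕ} (A : V [⋀^Fin (k + 1)]→L[ℝ] ℝ) (B : V [⋀^Fin k]→L[ℝ] ℝ) :
    (V × U) [⋀^Fin (k + 1)]→L[ℝ] ℝ :=
  A.compContinuousLinearMap (ContinuousLinearMap.fst ℝ V U) +
    wedge (B.compContinuousLinearMap (ContinuousLinearMap.fst ℝ V U))
      (θ.compContinuousLinearMap (ContinuousLinearMap.snd ℝ V U))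

theorem ev_lift (θ : U [⋀^Fin 1]→L[ℝ] ℝ) {k : ℕ} (A : V [⋀^Fin (k + 1)]→L[ℝ] ℝ)
    (B : V [⋀^Fin k]→L[ℝ] ℝ) (l : List (V × U)) :
    ev (lift θ A B) l = ev A (l.map Prod.fst) +
      shuffle ((-1) ^ k) (fun m => ev B (m.map Prod.fst)) (fun m => ev θ (m.map Prod.snd)) l := by
  rw [lift, ev_add, ev_comp, ev_wedge]
  congr 2
  · funext m; rw [ev_comp]; rfl
  · funext m; rw [ev_comp]; rfl

theorem lift_smul (θ : U [⋀^Fin 1]→L[ℝ] ℝ) (c : ℝ) {k : ℕ} (A : V [⋀^Fin (k + 1)]→L[ℝ] ℝ)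
    (B : V [⋀^Fin k]→L[ℝ] ℝ) : lift θ (c • A) (c • B) = c • lift θ A B := by
  refine ev_ext fun l => ?_
  simp only [ev_lift, ev_smul, shuffle_smul_left]
  ring

theorem lift_smul_coframe (θ : U [⋀^Fin 1]→L[ℝ] ℝ) (c : ℝ) {k : ℕ} (A : V [⋀^Fin (k + 1)]→L[ℝ] ℝ)
    (B : V [⋀^Fin k]→L[ℝ] ℝ) : lift (c • θ) A B = lift θ A (c • B) := by
  refine ev_ext fun l => ?_
  simp only [ev_lift, ev_smul, shuffle_smul_left, shuffle_smul_right]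

/-- The product basis. -/
def prodBasis (b : Module.Basis (Fin 6) ℝ V) (c : Module.Basis (Fin 1) ℝ U) :
    Module.Basis (Fin 7) ℝ (V × U) := (b.prod c).reindex (finSumFinEquiv (m := 6) (n := 1))

theorem prodBasis_castSucc (b : Module.Basis (Fin 6) ℝ V) (c : Module.Basis (Fin 1) ℝ U)
    (i : Fin 6) : prodBasis b c i.castSucc = (b i, 0) := by
  rw [prodBasis, Module.Basis.reindex_apply,
    show (finSumFinEquiv (m := 6) (n := 1)).symm i.castSucc = Sum.inl i from
      finSumFinEquiv_symm_apply_castAdd i]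
  ext <;> simp

theorem prodBasis_last (b : Module.Basis (Fin 6) ℝ V) (c : Module.Basis (Fin 1) ℝ U) :
    prodBasis b c 6 = (0, c 0) := by
  rw [prodBasis, Module.Basis.reindex_apply,
    show (finSumFinEquiv (m := 6) (n := 1)).symm 6 = Sum.inr 0 from
      finSumFinEquiv_symm_apply_natAdd 0]
  ext <;> simp

theorem ev_lift_castSucc (θ : U [⋀^Fin 1]→L[ℝ] ℝ) {k : ℕ} (A : V [⋀^Fin (k + 1)]→L[ℝ] ℝ)
    (B : V [⋀^Fin k]→L[ℝ] ℝ) (b : Module.Basis (Fin 6) ℝ V) (c : Module.Basis (Fin 1) ℝ U)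
    (J : List (Fin 6)) :
    ev (lift θ A B) ((J.map Fin.castSucc).map (prodBasis b c)) = ev A (J.map b) := by
  rw [ev_lift, shuffle_eq_zero_of_right, add_zero]
  · simp [prodBasis_castSucc, Function.comp_def]
  · exact fun m hm => ev_of_length_ne _ (by simpa using hm)
  · simp only [List.map_map, List.mem_map]
    rintro y ⟨i, _, rfl⟩
    exact ev_eq_zero_of_zero_mem _ (by simp [prodBasis_castSucc])

theorem ev_lift_append (θ : U [⋀^Fin 1]→L[ℝ] ℝ) {k : ℕ} (A : V [⋀^Fin (k + 1)]→L[ℝ] ℝ)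
    (B : V [⋀^Fin k]→L[ℝ] ℝ) (b : Module.Basis (Fin 6) ℝ V) {c : Module.Basis (Fin 1) ℝ U}
    (hc : θ (fun _ => c 0) = 1) (J : List (Fin 6)) :
    ev (lift θ A B) ((J.map Fin.castSucc ++ [6]).map (prodBasis b c)) = ev B (J.map b) := by
  rw [ev_lift, List.map_append, List.map_singleton, shuffle_append_singleton,
    ev_eq_zero_of_zero_mem A, zero_add]
  · have h1 : ev θ ([prodBasis b c 6].map Prod.snd) = 1 := by
      rw [prodBasis_last, List.map_singleton, ev_singleton, hc]
    rw [h1]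
    by_cases hJ : J.length = k
    · simp only [List.length_map, hJ, List.map_map, Function.comp_def, prodBasis_castSucc]
      rw [neg_one_pow_mul_self]
      ring
    · rw [ev_of_length_ne B (by simpa using hJ), ev_of_length_ne B (by simpa using hJ)]
      ring
  · simp [prodBasis_last]
  · exact fun m hm => ev_of_length_ne _ (by simpa using hm)
  · simp only [List.map_map, List.mem_map]
    rintro y ⟨i, _, rfl⟩
    exact ev_eq_zero_of_zero_mem _ (by simp [prodBasis_castSucc])

theorem lift_injective {θ : U [⋀^Fin 1]→L[ℝ] ℝ} {k : ℕ} {A A' : V [⋀^Fin (k + 1)]→L[ℝ] ℝ}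
    {B B' : V [⋀^Fin k]→L[ℝ] ℝ} (b : Module.Basis (Fin 6) ℝ V) {c : Module.Basis (Fin 1) ℝ U}
    (hc : θ (fun _ => c 0) = 1) (h : lift θ A B = lift θ A' B') : A = A' ∧ B = B' := by
  refine ⟨ev_ext_basis b fun J _ => ?_, ev_ext_basis b fun J _ => ?_⟩
  · rw [← ev_lift_castSucc θ A B b c, h, ev_lift_castSucc]
  · rw [← ev_lift_append θ A B b hc, h, ev_lift_append _ _ _ _ hc]

variable {e : Fin 6 → V [⋀^Fin 1]→L[ℝ] ℝ} {g : LinearMap.BilinForm ℝ V}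
  {w : V [⋀^Fin 2]→L[ℝ] ℝ} {ψp ψm : V [⋀^Fin 3]→L[ℝ] ℝ} {b : Module.Basis (Fin 6) ℝ V}
  {c : Module.Basis (Fin 1) ℝ U} {θ : U [⋀^Fin 1]→L[ℝ] ℝ}

theorem ev_lift_table (he : IsAdaptedCoframe e g w ψp ψm) (hb : IsDual e b)
    (hc : θ (fun _ => c 0) = 1) (l : List (Fin 7)) :
    ev (lift θ ψp w) (l.map (prodBasis b c)) = phiTable l := by
  let E : Fin 7 → (V × U) [⋀^Fin 1]→L[ℝ] ℝ :=
    Fin.snoc (α := fun _ => (V × U) [⋀^Fin 1]→L[ℝ] ℝ)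
      (fun i : Fin 6 => (e i).compContinuousLinearMap (ContinuousLinearMap.fst ℝ V U))
      (θ.compContinuousLinearMap (ContinuousLinearMap.snd ℝ V U))
  have h1 : ∀ i : Fin 6, E i.castSucc =
      (e i).compContinuousLinearMap (ContinuousLinearMap.fst ℝ V U) := fun i => by simp [E]
  have h2 : E 6 = θ.compContinuousLinearMap (ContinuousLinearMap.snd ℝ V U) :=
    Fin.snoc_last (α := fun _ => (V × U) [⋀^Fin 1]→L[ℝ] ℝ) _ _
  have hE : IsDual E (prodBasis b c) := by
    intro i j
    rw [← ev_singleton]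
    refine Fin.lastCases ?_ (fun i => ?_) i <;> refine Fin.lastCases ?_ (fun j => ?_) j
    · rw [show Fin.last 6 = 6 from rfl, h2, ev_comp, prodBasis_last]
      simp [ev_singleton, hc]
    · rw [show Fin.last 6 = 6 from rfl, h2, ev_comp, prodBasis_castSucc, if_neg]
      · exact ev_eq_zero_of_zero_mem _ (by simp)
      · exact (Fin.castSucc_lt_last j).ne'
    · rw [show Fin.last 6 = 6 from rfl, h1, ev_comp, prodBasis_last, if_neg]
      · exact ev_eq_zero_of_zero_mem _ (by simp)
      · exact (Fin.castSucc_lt_last i).ne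
    · rw [h1, ev_comp, prodBasis_castSucc]
      simp [hb.ev_eq]
  have h3 : lift θ ψp w = mono3 E 0 1 6 + mono3 E 2 3 6 + mono3 E 4 5 6 +
      (mono3 E 0 2 4 - mono3 E 0 3 5 - mono3 E 1 2 5 - mono3 E 1 3 4) := by
    rw [lift, he.omega_eq, he.psiPlus_eq]
    simp only [mono3, mono2]
    rw [show E 0 = _ from h1 0, show E 1 = _ from h1 1, show E 2 = _ from h1 2,
      show E 3 = _ from h1 3, show E 4 = _ from h1 4, show E 5 = _ from h1 5, h2]
    simp only [← wedge_comp]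
    refine ev_ext fun l => ?_
    have h4 : ∀ {k : ℕ} (a a' : V [⋀^Fin k]→L[ℝ] ℝ) (L : V × U →L[ℝ] V),
      (a + a').compContinuousLinearMap L =
        a.compContinuousLinearMap L + a'.compContinuousLinearMap L := fun _ _ _ => rfl
    simp only [h4, wedge_add_left, ev_add, ev_sub, ev_comp]
    ring
  rw [h3, phiTable]
  simp [ev_add, ev_sub, hE.ev_mono3]

theorem exists_induces_lift (he : IsAdaptedCoframe e g w ψp ψm) (hb : IsDual e b)
    (hc : θ (fun _ => c 0) = 1) : ∃ g' vol, Induces (lift θ ψp w) g' vol ∧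
      IsOrthonormalBasis g' (prodBasis b c) ∧
      ev vol ((List.finRange 7).map (prodBasis b c)) = 1 :=
  exists_induces (ev_lift_table he hb hc)

/-- The product basis is orthonormal for the metric of ω ∧ θ + ψ, and the complement of an index
list contains the last index exactly when the list does not. Hence the star exchanges the two parts;
the only sign is (-1)^4 here and (-1)^3 in `star_lift_four`. -/
theorem star_lift_three (he : IsAdaptedCoframe e g w ψp ψm) (hb : IsDual e b)
    (hc : θ (fun _ => c 0) = 1) (A : V [⋀^Fin 3]→L[ℝ] ℝ) (B : V [⋀^Fin 2]→L[ℝ] ℝ) :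
    hodgeStar (p := 3) (q := 4) (g2Metric (lift θ ψp w)) (castDeg rfl (g2Vol (lift θ ψp w)))
      (lift θ A B) =
    lift θ (hodgeStar (p := 2) (q := 4) g (castDeg rfl (vol6 w)) B)
      (hodgeStar (p := 3) (q := 3) g (castDeg rfl (vol6 w)) A) := by
  obtain ⟨g', vol, h, hg', hvol⟩ := exists_induces_lift he hb hc
  rw [h.g2Metric_eq, h.g2Vol_eq]
  refine ev_ext_basis (prodBasis b c) fun J hJ => ?_
  obtain ⟨k1, k2, k3⟩ := compl_finRange7 4 (by simp) J hJ
  rw [ev_hodgeStar_compl (p := 3) (q := 4) rfl hg' hvol _ (List.mem_sublistsLen.1 hJ).2 k1 k2 k3]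
  rcases mem_sublistsLen7 3 (by simp) J hJ with ⟨J', hJ', rfl⟩ | ⟨J', hJ', rfl⟩
  · obtain ⟨k4, k5⟩ := compl_castSucc 4 (by simp) J' hJ'
    rw [k5, k4, ev_lift_append _ _ _ _ hc, ev_lift_castSucc,
      he.ev_star hb (p := 2) (q := 4) rfl (by simp) _ hJ']
    push_cast; ring
  · obtain ⟨k4, k5⟩ := compl_castSucc_append 3 (by simp) J' hJ'
    rw [k5, k4, ev_lift_append _ _ _ _ hc, ev_lift_castSucc,
      he.ev_star hb (p := 3) (q := 3) rfl (by simp) _ hJ']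

theorem star_lift_four (he : IsAdaptedCoframe e g w ψp ψm) (hb : IsDual e b)
    (hc : θ (fun _ => c 0) = 1) (A : V [⋀^Fin 4]→L[ℝ] ℝ) (B : V [⋀^Fin 3]→L[ℝ] ℝ) :
    hodgeStar (p := 4) (q := 3) (g2Metric (lift θ ψp w)) (castDeg rfl (g2Vol (lift θ ψp w)))
      (lift θ A B) =
    lift θ (-hodgeStar (p := 3) (q := 3) g (castDeg rfl (vol6 w)) B)
      (hodgeStar (p := 4) (q := 2) g (castDeg rfl (vol6 w)) A) := by
  obtain ⟨g', vol, h, hg', hvol⟩ := exists_induces_lift he hb hc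
  rw [h.g2Metric_eq, h.g2Vol_eq]
  refine ev_ext_basis (prodBasis b c) fun J hJ => ?_
  obtain ⟨k1, k2, k3⟩ := compl_finRange7 3 (by simp) J hJ
  rw [ev_hodgeStar_compl (p := 4) (q := 3) rfl hg' hvol _ (List.mem_sublistsLen.1 hJ).2 k1 k2 k3]
  rcases mem_sublistsLen7 2 (by simp) J hJ with ⟨J', hJ', rfl⟩ | ⟨J', hJ', rfl⟩
  · obtain ⟨k4, k5⟩ := compl_castSucc 3 (by simp) J' hJ'
    rw [k5, k4, ev_lift_append _ _ _ _ hc, ev_lift_castSucc, ev_neg,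
      he.ev_star hb (p := 3) (q := 3) rfl (by simp) _ hJ']
    push_cast; ring
  · obtain ⟨k4, k5⟩ := compl_castSucc_append 2 (by simp) J' hJ'
    rw [k5, k4, ev_lift_append _ _ _ _ hc, ev_lift_castSucc,
      he.ev_star hb (p := 4) (q := 2) rfl (by simp) _ hJ']

end Lift

/-! ### The exterior derivative on a manifold without boundary -/

section ManifoldForms

variable {E : Type*} [NormedAddCommGroup E] [NormedSpace ℝ E] {H : Type*} [TopologicalSpace H]
  (I : ModelWithCorners ℝ E H) {M : Type*} [TopologicalSpace M] [ChartedSpace H M]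

theorem compContinuousLinearMap_id {V : Type*} [NormedAddCommGroup V] [NormedSpace ℝ V] {k : ℕ}
    (a : V [⋀^Fin k]→L[ℝ] ℝ) :
    a.compContinuousLinearMap (ContinuousLinearMap.id ℝ V) = a := rfl

theorem coordForm_self [IsManifold I 1 M] {k : ℕ} (η : Form I M k) (x : M) :
    coordForm I η x (extChartAt I x x) = η x := by
  rw [coordForm, mfderivWithin_range_extChartAt_symm]
  exact (compContinuousLinearMap_id _).trans (by rw [extChartAt_to_inv])

/-- At its own base point the preferred chart has the identity as derivative, so both pullbacks in
the definition disappear. -/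
theorem extD_eq [IsManifold I 1 M] [I.Boundaryless] {k : ℕ} (η : Form I M k) (x : M) :
    extD I η x = extDeriv (coordForm I η x) (extChartAt I x x) := by
  rw [extD, mfderiv_extChartAt_self, I.range_eq_univ, extDerivWithin_univ]
  exact compContinuousLinearMap_id _

theorem coordForm_wedge {p q : ℕ} (η : Form I M p) (ξ : Form I M q) (x : M) :
    coordForm I (fun y => wedge (η y) (ξ y)) x =
      fun y => wedge (coordForm I η x y) (coordForm I ξ x y) :=
  funext fun _ => wedge_comp _ _ _

theorem coordForm_smul_fun {k : ℕ} (c : M → ℝ) (η : Form I M k) (x : M) :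
    coordForm I (fun y => c y • η y) x =
      fun y => c ((extChartAt I x).symm y) • coordForm I η x y := rfl

/-- Differentiability of a differential form at a point, in the chart at this point. -/
def FormDifferentiableAt {k : ℕ} (η : Form I M k) (x : M) : Prop :=
  DifferentiableAt ℝ (coordForm I η x) (extChartAt I x x)

variable {I}

theorem IsSmooth.contDiffOn {k : ℕ} {η : Form I M k} (h : IsSmooth I η) (x : M) :
    ContDiffOn ℝ ∞ (coordForm I η x) (extChartAt I x).target := by
  simpa using h x

theorem isSmooth_iff {k : ℕ} {η : Form I M k} :
    IsSmooth I η ↔ ∀ x, ContDiffOn ℝ ∞ (coordForm I η x) (extChartAt I x).target := by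
  simp [IsSmooth, IsSmoothOn]

theorem IsSmoothOn.formDifferentiableAt [I.Boundaryless] {k : ℕ} {η : Form I M k} {U : Set M}
    (h : IsSmoothOn I U η) (hU : IsOpen U) {x : M} (hx : x ∈ U) : FormDifferentiableAt I η x := by
  refine ((h x).contDiffAt (Filter.inter_mem (extChartAt_target_mem_nhds x) ?_)).differentiableAt
    (by simp)
  exact (continuousAt_extChartAt_symm x).preimage_mem_nhds
    (hU.mem_nhds (by rwa [extChartAt_to_inv]))

theorem IsSmooth.formDifferentiableAt [I.Boundaryless] {k : ℕ} {η : Form I M k}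
    (h : IsSmooth I η) (x : M) : FormDifferentiableAt I η x :=
  IsSmoothOn.formDifferentiableAt h isOpen_univ (Set.mem_univ x)

theorem IsSmooth.add {k : ℕ} {η ξ : Form I M k} (hη : IsSmooth I η) (hξ : IsSmooth I ξ) :
    IsSmooth I (fun y => η y + ξ y) :=
  isSmooth_iff.2 fun x => (hη.contDiffOn x).add (hξ.contDiffOn x)

theorem IsSmooth.const_smul {k : ℕ} (c : ℝ) {η : Form I M k} (hη : IsSmooth I η) :
    IsSmooth I (fun y => c • η y) :=
  isSmooth_iff.2 fun x => (hη.contDiffOn x).const_smul c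

theorem IsSmooth.sub {k : ℕ} {η ξ : Form I M k} (hη : IsSmooth I η) (hξ : IsSmooth I ξ) :
    IsSmooth I (fun y => η y - ξ y) :=
  isSmooth_iff.2 fun x => (hη.contDiffOn x).sub (hξ.contDiffOn x)

namespace FormDifferentiableAt

variable {k p q : ℕ} {x : M}

theorem add {η ξ : Form I M k} (hη : FormDifferentiableAt I η x)
    (hξ : FormDifferentiableAt I ξ x) : FormDifferentiableAt I (fun y => η y + ξ y) x :=
  DifferentiableAt.add hη hξ

theorem const_smul (c : ℝ) {η : Form I M k} (hη : FormDifferentiableAt I η x) :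
    FormDifferentiableAt I (fun y => c • η y) x :=
  DifferentiableAt.const_smul hη c

theorem wedge {η : Form I M p} {ξ : Form I M q} (hη : FormDifferentiableAt I η x)
    (hξ : FormDifferentiableAt I ξ x) :
    FormDifferentiableAt I (fun y => wedge (η y) (ξ y)) x := by
  rw [FormDifferentiableAt, coordForm_wedge]
  exact ((wedgeCLM E p q).hasFDerivAt_of_bilinear hη.hasFDerivAt hξ.hasFDerivAt).differentiableAt

theorem comp_extChartAt_symm [IsManifold I 1 M] [I.Boundaryless] {c : M → ℝ}
    (hc : MDifferentiableAt I 𝓘(ℝ, ℝ) c x) :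
    DifferentiableAt ℝ (fun y => c ((extChartAt I x).symm y)) (extChartAt I x x) := by
  have h := hc.differentiableWithinAt_writtenInExtChartAt
  rw [I.range_eq_univ, differentiableWithinAt_univ] at h
  exact h

theorem smul_fun [IsManifold I 1 M] [I.Boundaryless] {c : M → ℝ} {η : Form I M k}
    (hc : MDifferentiableAt I 𝓘(ℝ, ℝ) c x) (hη : FormDifferentiableAt I η x) :
    FormDifferentiableAt I (fun y => c y • η y) x :=
  DifferentiableAt.smul (comp_extChartAt_symm hc) hη

end FormDifferentiableAt

section ExtD

variable [IsManifold I 1 M] [I.Boundaryless] {k p q : ℕ} {x : M}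

theorem extD_add {η ξ : Form I M k} (hη : FormDifferentiableAt I η x)
    (hξ : FormDifferentiableAt I ξ x) :
    extD I (fun y => η y + ξ y) x = extD I η x + extD I ξ x := by
  simp only [extD_eq]
  exact extDeriv_add hη hξ

theorem extD_smul (c : ℝ) (η : Form I M k) (x : M) :
    extD I (fun y => c • η y) x = c • extD I η x := by
  simp only [extD_eq]
  exact extDeriv_smul c (coordForm I η x)

theorem extD_sub {η ξ : Form I M k} (hη : FormDifferentiableAt I η x)
    (hξ : FormDifferentiableAt I ξ x) :
    extD I (fun y => η y - ξ y) x = extD I η x - extD I ξ x := by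
  have h1 : ∀ {m : ℕ} (a b : E [⋀^Fin m]→L[ℝ] ℝ), a - b = a + (-1 : ℝ) • b := fun a b =>
    ev_ext fun l => by rw [ev_sub, ev_add, ev_smul]; ring
  simp only [h1]
  rw [extD_add hη (hξ.const_smul (-1)), extD_smul]

theorem extD_zero : extD I (0 : Form I M k) x = 0 := by
  have h := extD_smul (0 : ℝ) (0 : Form I M k) x
  simpa using! h

theorem ev_extD_wedge {η : Form I M p} {ξ : Form I M q} (hη : FormDifferentiableAt I η x)
    (hξ : FormDifferentiableAt I ξ x) (l : List E) :
    ev (extD I (fun y => wedge (η y) (ξ y)) x) l =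
      ev (wedge (extD I η x) (ξ x)) l + (-1) ^ p * ev (wedge (η x) (extD I ξ x)) l := by
  simp only [extD_eq, coordForm_wedge]
  rw [extDeriv_wedge hη hξ, coordForm_self, coordForm_self]

theorem ev_extD_smul_fun {c : M → ℝ} {η : Form I M k} (hc : MDifferentiableAt I 𝓘(ℝ, ℝ) c x)
    (hη : FormDifferentiableAt I η x) (l : List E) :
    ev (extD I (fun y => c y • η y) x) l =
      ev (wedge (funD I c x) (η x)) l + c x * ev (extD I η x) l := by
  have h : mfderiv I 𝓘(ℝ, ℝ) c x =
      fderiv ℝ (fun y => c ((extChartAt I x).symm y)) (extChartAt I x x) := by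
    rw [hc.mfderiv, I.range_eq_univ, fderivWithin_univ]
    rfl
  simp only [extD_eq, coordForm_smul_fun]
  rw [extDeriv_smul_fun (FormDifferentiableAt.comp_extChartAt_symm hc) hη, coordForm_self,
    extChartAt_to_inv, funD, h]

end ExtD

end ManifoldForms

/-! ### The angular form on the circle -/

section Circle

/-- The model space of the circle. -/
abbrev E1 : Type := EuclideanSpace ℝ (Fin 1)

attribute [local instance] finrank_real_complex_fact'

theorem contMDiff_coe_circle : ContMDiff (𝓡 1) 𝓘(ℝ, ℂ) ∞ (fun w : Circle => (w : ℂ)) :=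
  contMDiff_coe_sphere (E := ℂ) (n := 1)

/-- A tangent vector v of the circle at z satisfies Re(z̄v) = 0 by orthogonality to z. If ds also
vanished, then Im(z̄v) = 0 and v = 0, contradicting that the inclusion into ℂ is an immersion. -/
theorem ds_ne_zero (z : Circle) : ds z ≠ 0 := by
  intro h
  have hinj : Function.Injective (mfderiv (𝓡 1) 𝓘(ℝ, ℂ) (fun w : Circle => (w : ℂ)) z) :=
    injective_mvfderiv_subtypeVal_sphere (E := ℂ) (n := 1) z
  have hrange : ∀ u : E1, inner ℝ (z : ℂ)
      ((mfderiv (𝓡 1) 𝓘(ℝ, ℂ) (fun w : Circle => (w : ℂ)) z : E1 →L[ℝ] ℂ) u) = 0 := by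
    intro u
    have h1 := range_mvfderiv_subtypeVal (E := ℂ) (n := 1) z
    refine Submodule.mem_orthogonal_singleton_iff_inner_right.1 ?_
    exact h1 ▸ ⟨u, rfl⟩
  have h0 : ∀ u : E1, (mfderiv (𝓡 1) 𝓘(ℝ, ℂ) (fun w : Circle => (w : ℂ)) z : E1 →L[ℝ] ℂ) u = 0 := by
    intro u
    have h1 : ds z (fun _ => u) = 0 := by rw [h]; rfl
    have h2 := hrange u
    set v : ℂ := (mfderiv (𝓡 1) 𝓘(ℝ, ℂ) (fun w : Circle => (w : ℂ)) z : E1 →L[ℝ] ℂ) u with hv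
    have h3 : ((starRingEnd ℂ) (z : ℂ) * v).im = 0 := h1
    have h4 : ((starRingEnd ℂ) (z : ℂ) * v).re = 0 := by
      rw [Complex.inner, mul_comm] at h2
      exact h2
    have h5 : (starRingEnd ℂ) (z : ℂ) * v = 0 := Complex.ext h4 h3
    refine (mul_eq_zero.1 h5).resolve_left ?_
    simp
  have h1 : (EuclideanSpace.single 0 1 : E1) = 0 := hinj ((h0 _).trans (h0 0).symm)
  have h2 := congrArg (fun u : E1 => u 0) h1
  simp at h2

theorem exists_basis_ds {f : ℝ} (hf : f ≠ 0) (z : Circle) :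
    ∃ c : Module.Basis (Fin 1) ℝ E1, (f • ds z) (fun _ => c 0) = 1 := by
  obtain ⟨c, hc⟩ := exists_isDual (n := 1) (V := E1) (E := fun _ => f • ds z) (by simp)
    (linearIndependent_unique_iff.2 (smul_ne_zero hf (ds_ne_zero z)))
  exact ⟨c, by simpa using! hc 0 0⟩

/-- This is what makes ds closed. -/
theorem eq_zero_of_line (a : E1 [⋀^Fin 2]→L[ℝ] ℝ) : a = 0 :=
  ev_ext_basis (EuclideanSpace.basisFun (Fin 1) ℝ).toBasis fun I hI => by
    rw [show (List.finRange 1).sublistsLen 2 = [] by decide] at hI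
    simp at hI

/-- By the chain rule ds becomes Im(F̄ dF), with F the inverse chart as a map into ℂ; in this form
smoothness is evident. -/
theorem coordForm_ds (z : Circle) {u : E1} (hu : u ∈ (extChartAt (𝓡 1) z).target) :
    coordForm (𝓡 1) ds z u = ContinuousAlternatingMap.ofSubsingleton ℝ E1 ℝ (0 : Fin 1)
      (Complex.imCLM ∘L (ContinuousLinearMap.mul ℝ ℂ
        ((starRingEnd ℂ) (((extChartAt (𝓡 1) z).symm u : Circle) : ℂ))) ∘L
        (fderiv ℝ (fun v => (((extChartAt (𝓡 1) z).symm v : Circle) : ℂ)) u)) := by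
  have h1 : fderiv ℝ (fun v => (((extChartAt (𝓡 1) z).symm v : Circle) : ℂ)) u =
      (mfderiv (𝓡 1) 𝓘(ℝ, ℂ) (fun w : Circle => (w : ℂ)) ((extChartAt (𝓡 1) z).symm u) :
        E1 →L[ℝ] ℂ) ∘L
      (mfderivWithin 𝓘(ℝ, E1) (𝓡 1) (extChartAt (𝓡 1) z).symm (Set.range (𝓡 1)) u :
        E1 →L[ℝ] E1) := by
    rw [← fderivWithin_univ, ← mfderivWithin_eq_fderivWithin, ← (𝓡 1).range_eq_univ]
    exact mfderiv_comp_mfderivWithin (I := 𝓘(ℝ, E1)) (I' := 𝓡 1) (I'' := 𝓘(ℝ, ℂ))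
      (g := fun w : Circle => (w : ℂ)) u
      (contMDiff_coe_circle.mdifferentiableAt (by simp))
      (mdifferentiableWithinAt_extChartAt_symm hu)
      ((𝓡 1).uniqueMDiffOn _ (extChartAt_target_subset_range z hu))
  rw [h1]
  rfl

theorem isSmooth_ds : IsSmooth (𝓡 1) ds := by
  refine isSmooth_iff.2 fun z => ContDiffOn.congr ?_ fun u hu => coordForm_ds z hu
  have h : ContDiffOn ℝ ∞ (fun v => (((extChartAt (𝓡 1) z).symm v : Circle) : ℂ))
      (extChartAt (𝓡 1) z).target :=
    (contMDiff_coe_circle.comp_contMDiffOn (contMDiffOn_extChartAt_symm z)).contDiffOn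
  have h2 := h.fderiv_of_isOpen (m := ∞) (isOpen_extChartAt_target z) (by simp)
  refine (ContinuousAlternatingMap.ofSubsingletonLIE (𝕜 := ℝ) (E := E1) (F := ℝ) (0 : Fin 1)).contDiff.comp_contDiffOn ?_
  refine contDiffOn_const.clm_comp (ContDiffOn.clm_comp ?_ h2)
  exact (ContinuousLinearMap.contDiff _).comp_contDiffOn
    (Complex.conjCLE.contDiff.comp_contDiffOn h)

end Circle

/-! ### Forms on the product of a 6-manifold with the circle -/

section ProductForms

variable {M : Type*} [TopologicalSpace M] [ChartedSpace E6 M]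

/-- The form `A + B ∧ ds` on `M × S¹`. -/
def liftM {k : ℕ} (A : Form (𝓡 6) M (k + 1)) (B : Form (𝓡 6) M k) :
    Form I7 (M × Circle) (k + 1) :=
  fun p => lift (ds p.2) (A p.1) (B p.1)

theorem compContinuousLinearMap_comp {W W' W'' : Type*} [NormedAddCommGroup W] [NormedSpace ℝ W]
    [NormedAddCommGroup W'] [NormedSpace ℝ W'] [NormedAddCommGroup W''] [NormedSpace ℝ W''] {m : ℕ}
    (a : W'' [⋀^Fin m]→L[ℝ] ℝ) (L : W' →L[ℝ] W'') (L' : W →L[ℝ] W') :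
    (a.compContinuousLinearMap L).compContinuousLinearMap L' =
      a.compContinuousLinearMap (L ∘L L') := rfl

theorem lift_comp {V U : Type*} [NormedAddCommGroup V] [NormedSpace ℝ V] [NormedAddCommGroup U]
    [NormedSpace ℝ U] (θ : U [⋀^Fin 1]→L[ℝ] ℝ) {k : ℕ} (A : V [⋀^Fin (k + 1)]→L[ℝ] ℝ)
    (B : V [⋀^Fin k]→L[ℝ] ℝ) {D : V × U →L[ℝ] V × U} {D₁ : V →L[ℝ] V} {D₂ : U →L[ℝ] U}
    (h₁ : ContinuousLinearMap.fst ℝ V U ∘L D = D₁ ∘L ContinuousLinearMap.fst ℝ V U)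
    (h₂ : ContinuousLinearMap.snd ℝ V U ∘L D = D₂ ∘L ContinuousLinearMap.snd ℝ V U) :
    (lift θ A B).compContinuousLinearMap D = lift (θ.compContinuousLinearMap D₂)
      (A.compContinuousLinearMap D₁) (B.compContinuousLinearMap D₁) := by
  calc (lift θ A B).compContinuousLinearMap D
      = (A.compContinuousLinearMap (ContinuousLinearMap.fst ℝ V U)).compContinuousLinearMap D +
        (wedge (B.compContinuousLinearMap (ContinuousLinearMap.fst ℝ V U))
          (θ.compContinuousLinearMap (ContinuousLinearMap.snd ℝ V U))).compContinuousLinearMap D :=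
        rfl
    _ = _ := by
        simp only [wedge_comp, compContinuousLinearMap_comp, h₁, h₂]
        rfl

theorem warpedG2_eq (α β f : ℝ) (s : SU3Structure M) :
    warpedG2 α β f s =
      liftM (fun x => α • s.psiPlus x - β • s.psiMinus x) (fun x => f • s.omega x) := by
  funext p
  rw [warpedG2, liftM, lift, add_comm]
  simp only [pullback, mfderiv_fst, mfderiv_snd]
  congr 1
  exact (wedge_smul_left _ _ _).symm

theorem differentiableAt_pullback {V W : Type*} [NormedAddCommGroup V] [NormedSpace ℝ V]
    [NormedAddCommGroup W] [NormedSpace ℝ W] {k : ℕ} {a : W → W [⋀^Fin k]→L[ℝ] ℝ} {L : V →L[ℝ] W}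
    {v : V} (ha : DifferentiableAt ℝ a (L v)) :
    DifferentiableAt ℝ (fun w => (a (L w)).compContinuousLinearMap L) v :=
  (ContinuousAlternatingMap.compContinuousLinearMapCLM (ι := Fin k) (F := ℝ)
    L).differentiableAt.comp v (f := fun w => a (L w)) (ha.comp v L.differentiableAt)

theorem contDiffOn_pullback {V W : Type*} [NormedAddCommGroup V] [NormedSpace ℝ V]
    [NormedAddCommGroup W] [NormedSpace ℝ W] {k : ℕ} {a : W → W [⋀^Fin k]→L[ℝ] ℝ} {L : V →L[ℝ] W}
    {s : Set V} {t : Set W} (ha : ContDiffOn ℝ ∞ a t) (h : Set.MapsTo L s t) :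
    ContDiffOn ℝ ∞ (fun w => (a (L w)).compContinuousLinearMap L) s :=
  (ContinuousAlternatingMap.compContinuousLinearMapCLM (ι := Fin k) (F := ℝ)
    L).contDiff.comp_contDiffOn (ha.comp L.contDiff.contDiffOn h)

theorem contDiff_wedge (V : Type*) [NormedAddCommGroup V] [NormedSpace ℝ V] (p q : ℕ) :
    ContDiff ℝ ∞ (fun x : (V [⋀^Fin p]→L[ℝ] ℝ) × (V [⋀^Fin q]→L[ℝ] ℝ) => wedge x.1 x.2) := by
  have h := (wedgeCLM V p q).isBoundedBilinearMap
  have h2 := h.contDiff (n := ∞)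
  simpa only [wedgeCLM_apply] using h2

theorem contDiffOn_wedge {W V : Type*} [NormedAddCommGroup V] [NormedSpace ℝ V]
    [NormedAddCommGroup W] [NormedSpace ℝ W] {p q : ℕ} {a : W → V [⋀^Fin p]→L[ℝ] ℝ}
    {b : W → V [⋀^Fin q]→L[ℝ] ℝ} {s : Set W} (ha : ContDiffOn ℝ ∞ a s) (hb : ContDiffOn ℝ ∞ b s) :
    ContDiffOn ℝ ∞ (fun w => wedge (a w) (b w)) s := by
  have h := (contDiff_wedge V p q).comp_contDiffOn (ha.prodMk hb)
  exact h

theorem contDiffOn_lift {V U : Type*} [NormedAddCommGroup V] [NormedSpace ℝ V]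
    [NormedAddCommGroup U] [NormedSpace ℝ U] {k : ℕ} {τ : U → U [⋀^Fin 1]→L[ℝ] ℝ}
    {a : V → V [⋀^Fin (k + 1)]→L[ℝ] ℝ} {b : V → V [⋀^Fin k]→L[ℝ] ℝ}
    {s : Set (V × U)} {t₁ : Set V} {t₂ : Set U} (hτ : ContDiffOn ℝ ∞ τ t₂)
    (ha : ContDiffOn ℝ ∞ a t₁) (hb : ContDiffOn ℝ ∞ b t₁) (h₁ : Set.MapsTo Prod.fst s t₁)
    (h₂ : Set.MapsTo Prod.snd s t₂) :
    ContDiffOn ℝ ∞ (fun v : V × U => lift (τ v.2) (a v.1) (b v.1)) s :=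
  (contDiffOn_pullback (L := ContinuousLinearMap.fst ℝ V U) ha h₁).add (contDiffOn_wedge
    (contDiffOn_pullback (L := ContinuousLinearMap.fst ℝ V U) hb h₁)
    (contDiffOn_pullback (L := ContinuousLinearMap.snd ℝ V U) hτ h₂))

variable [IsManifold (𝓡 6) ∞ M]

/-- The charts of the product are products of charts, so the derivative of the inverse chart is
block diagonal and `lift_comp` applies. -/
theorem coordForm_liftM {k : ℕ} (A : Form (𝓡 6) M (k + 1)) (B : Form (𝓡 6) M k)
    (p : M × Circle) {v : E6 × E1} (hv : v ∈ (extChartAt I7 p).target) :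
    coordForm I7 (liftM A B) p v = lift (coordForm (𝓡 1) ds p.2 v.2)
      (coordForm (𝓡 6) A p.1 v.1) (coordForm (𝓡 6) B p.1 v.1) := by
  have : IsManifold (𝓡 6) 1 M := .of_le (n := ∞) (by simp)
  have : IsManifold (𝓡 1) 1 Circle := .of_le (n := ω) (by simp)
  have hσ := mdifferentiableWithinAt_extChartAt_symm hv
  have hu := I7.uniqueMDiffOn v (extChartAt_target_subset_range p hv)
  have e1 : (Prod.fst ∘ (extChartAt I7 p).symm) = (extChartAt (𝓡 6) p.1).symm ∘ Prod.fst := by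
    rw [extChartAt_prod]; rfl
  have e2 : (Prod.snd ∘ (extChartAt I7 p).symm) = (extChartAt (𝓡 1) p.2).symm ∘ Prod.snd := by
    rw [extChartAt_prod]; rfl
  have hv' := hv
  rw [extChartAt_prod] at hv'
  have h1 := mfderiv_comp_mfderivWithin (I'' := 𝓡 6) v
    (mdifferentiableAt_fst (I := 𝓡 6) (I' := 𝓡 1) (x := (extChartAt I7 p).symm v)) hσ hu
  have h2 := mfderiv_comp_mfderivWithin (I'' := 𝓡 1) v
    (mdifferentiableAt_snd (I := 𝓡 6) (I' := 𝓡 1) (x := (extChartAt I7 p).symm v)) hσ hu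
  have hmaps1 : Set.range I7 ⊆ Prod.fst ⁻¹' (Set.range (𝓡 6)) := by
    simp
  have hmaps2 : Set.range I7 ⊆ Prod.snd ⁻¹' (Set.range (𝓡 1)) := by
    simp
  have h3 := mfderivWithin_comp (I := 𝓘(ℝ, E6 × E1)) (I' := 𝓘(ℝ, E6)) (I'' := 𝓡 6) v
    (g := (extChartAt (𝓡 6) p.1).symm) (f := Prod.fst)
    (mdifferentiableWithinAt_extChartAt_symm hv'.1)
    differentiableAt_fst.mdifferentiableAt.mdifferentiableWithinAt hmaps1 hu
  have h4 := mfderivWithin_comp (I := 𝓘(ℝ, E6 × E1)) (I' := 𝓘(ℝ, E1)) (I'' := 𝓡 1) v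
    (g := (extChartAt (𝓡 1) p.2).symm) (f := Prod.snd)
    (mdifferentiableWithinAt_extChartAt_symm hv'.2)
    differentiableAt_snd.mdifferentiableAt.mdifferentiableWithinAt hmaps2 hu
  rw [e1, h3, mfderiv_fst, mfderivWithin_eq_fderivWithin, I7.range_eq_univ, fderivWithin_univ,
    fderiv_fst] at h1
  rw [e2, h4, mfderiv_snd, mfderivWithin_eq_fderivWithin, I7.range_eq_univ, fderivWithin_univ,
    fderiv_snd] at h2
  have e3 : (extChartAt I7 p).symm v =
      ((extChartAt (𝓡 6) p.1).symm v.1, (extChartAt (𝓡 1) p.2).symm v.2) := by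
    rw [extChartAt_prod]; rfl
  rw [coordForm, liftM, I7.range_eq_univ]
  have := lift_comp (ds ((extChartAt I7 p).symm v).2) (A ((extChartAt I7 p).symm v).1)
    (B ((extChartAt I7 p).symm v).1) h1.symm h2.symm
  refine this.trans ?_
  rw [e3]
  rfl

/-- d(A + B ∧ ds) = dA + dB ∧ ds: pullback along the projections commutes with d, and the Leibniz
term with d(ds) is a 2-form on a line. -/
theorem extD_liftM {k : ℕ} {A : Form (𝓡 6) M (k + 1)} {B : Form (𝓡 6) M k} {p : M × Circle}
    (hA : FormDifferentiableAt (𝓡 6) A p.1) (hB : FormDifferentiableAt (𝓡 6) B p.1) :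
    extD I7 (liftM A B) p = lift (ds p.2) (extD (𝓡 6) A p.1) (extD (𝓡 6) B p.1) := by
  have : IsManifold (𝓡 6) 1 M := .of_le (n := ∞) (by simp)
  have : IsManifold (𝓡 1) 1 Circle := .of_le (n := ω) (by simp)
  have he : extChartAt I7 p p = (extChartAt (𝓡 6) p.1 p.1, extChartAt (𝓡 1) p.2 p.2) := by
    rw [extChartAt_prod]; rfl
  rw [extD_eq, extD_eq, extD_eq]
  have h1 : coordForm I7 (liftM A B) p =ᶠ[nhds (extChartAt I7 p p)] fun v =>
      lift (coordForm (𝓡 1) ds p.2 v.2) (coordForm (𝓡 6) A p.1 v.1)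
        (coordForm (𝓡 6) B p.1 v.1) :=
    Filter.eventually_of_mem (extChartAt_target_mem_nhds p) fun v hv => coordForm_liftM A B p hv
  rw [h1.extDeriv_eq, he, ← coordForm_self (𝓡 1) ds p.2]
  have hτ := isSmooth_ds.formDifferentiableAt p.2
  unfold FormDifferentiableAt at hA hB hτ
  generalize coordForm (𝓡 6) A p.1 = a at *
  generalize coordForm (𝓡 6) B p.1 = b at *
  generalize coordForm (𝓡 1) ds p.2 = τ at *
  generalize extChartAt (𝓡 6) p.1 p.1 = y at *
  generalize extChartAt (𝓡 1) p.2 p.2 = u at *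
  have hτ' := differentiableAt_pullback (L := ContinuousLinearMap.snd ℝ E6 E1) (v := (y, u)) hτ
  have ha' := differentiableAt_pullback (L := ContinuousLinearMap.fst ℝ E6 E1) (v := (y, u)) hA
  have hb' := differentiableAt_pullback (L := ContinuousLinearMap.fst ℝ E6 E1) (v := (y, u)) hB
  have pa := extDeriv_pullback (f := (Prod.fst : E6 × E1 → E6)) (x := (y, u)) (r := 2) hA
    contDiffAt_fst (by simp)
  have pb := extDeriv_pullback (f := (Prod.fst : E6 × E1 → E6)) (x := (y, u)) (r := 2) hB
    contDiffAt_fst (by simp)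
  have pτ := extDeriv_pullback (f := (Prod.snd : E6 × E1 → E1)) (x := (y, u)) (r := 2) hτ
    contDiffAt_snd (by simp)
  simp only [fderiv_fst, fderiv_snd] at pa pb pτ
  have hw : DifferentiableAt ℝ (fun w : E6 × E1 =>
      wedge ((b w.1).compContinuousLinearMap (ContinuousLinearMap.fst ℝ E6 E1))
        ((τ w.2).compContinuousLinearMap (ContinuousLinearMap.snd ℝ E6 E1))) (y, u) :=
    ((wedgeCLM (E6 × E1) k 1).hasFDerivAt_of_bilinear hb'.hasFDerivAt
    hτ'.hasFDerivAt).differentiableAt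
  refine ev_ext fun l => ?_
  simp only [lift]
  refine (congrArg (ev · l) (extDeriv_fun_add ha' hw)).trans ?_
  refine (ev_add _ _ l).trans (Eq.trans ?_ (ev_add _ _ l).symm)
  refine congrArg₂ (· + ·) (congrArg (ev · l) pa) ((extDeriv_wedge hb' hτ' l).trans ?_)
  change ev (wedge (extDeriv (fun x : E6 × E1 => (b x.1).compContinuousLinearMap
      (ContinuousLinearMap.fst ℝ E6 E1)) (y, u)) _) l + (-1) ^ k * ev (wedge _
    (extDeriv (fun x : E6 × E1 => (τ x.2).compContinuousLinearMap
      (ContinuousLinearMap.snd ℝ E6 E1)) (y, u))) l = _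
  rw [pb, pτ, eq_zero_of_line (extDeriv τ u)]
  have h0 : (0 : E1 [⋀^Fin 2]→L[ℝ] ℝ).compContinuousLinearMap
    (ContinuousLinearMap.snd ℝ E6 E1) = 0 := rfl
  rw [h0, wedge_zero_right, ev_zero, mul_zero, add_zero]
  rfl

theorem isSmooth_liftM {k : ℕ} {A : Form (𝓡 6) M (k + 1)} {B : Form (𝓡 6) M k}
    (hA : IsSmooth (𝓡 6) A) (hB : IsSmooth (𝓡 6) B) : IsSmooth I7 (liftM A B) := by
  refine isSmooth_iff.2 fun p => ContDiffOn.congr ?_ fun v hv => coordForm_liftM A B p hv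
  refine contDiffOn_lift (isSmooth_ds.contDiffOn p.2) (hA.contDiffOn p.1) (hB.contDiffOn p.1) ?_ ?_
  · rw [extChartAt_prod]; exact fun v hv => hv.1
  · rw [extChartAt_prod]; exact fun v hv => hv.2

end ProductForms

/-! ### The Hodge star operator of an `SU(3)`-structure and differentiability -/

section StarSix

/-- The formula of `star_eq_sum` transported by a linear map `D`, later the derivative of an inverse
chart, so that only coordinate expressions of the forms and of the coframe occur. -/
theorem IsAdaptedCoframe.star_comp_eq_sum {V V' : Type*} [NormedAddCommGroup V] [NormedSpace ℝ V]
    [NormedAddCommGroup V'] [NormedSpace ℝ V'] {e : Fin 6 → V [⋀^Fin 1]→L[ℝ] ℝ}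
    {g : LinearMap.BilinForm ℝ V} {w : V [⋀^Fin 2]→L[ℝ] ℝ} {ψp ψm : V [⋀^Fin 3]→L[ℝ] ℝ}
    {b : Module.Basis (Fin 6) ℝ V} (he : IsAdaptedCoframe e g w ψp ψm) (hb : IsDual e b)
    (γ : V [⋀^Fin 3]→L[ℝ] ℝ) (D : V' →L[ℝ] V) (v : Fin 6 → V')
    (hv : (vol6 w).compContinuousLinearMap D v ≠ 0) :
    (hodgeStar (p := 3) (q := 3) g (castDeg rfl (vol6 w)) γ).compContinuousLinearMap D =
      ∑ t ∈ triples, (-((wedge (mono3 e t.1 t.2.1 t.2.2) γ).compContinuousLinearMap D v *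
        ((vol6 w).compContinuousLinearMap D v)⁻¹)) •
        (mono3 e t.1 t.2.1 t.2.2).compContinuousLinearMap D := by
  rw [ContinuousAlternatingMap.compContinuousLinearMap_apply] at hv
  rw [he.star_eq_sum hb γ (D ∘ v) hv]
  refine ev_ext fun l => ?_
  simp only [ev_comp, ev_sum, ev_smul, ContinuousAlternatingMap.compContinuousLinearMap_apply,
    div_eq_mul_inv]

variable {M : Type*} [TopologicalSpace M] [ChartedSpace E6 M]

theorem SU3Structure.exists_adapted (s : SU3Structure M) (x : M) :
    ∃ (e : Fin 6 → E6 [⋀^Fin 1]→L[ℝ] ℝ) (b : Module.Basis (Fin 6) ℝ E6),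
      IsAdaptedCoframe e (s.metric x) (s.omega x) (s.psiPlus x) (s.psiMinus x) ∧ IsDual e b := by
  obtain ⟨U, -, hx, e, -, he⟩ := s.exists_coframe x
  obtain ⟨b, hb⟩ := (he x hx).exists_isDual (by simp)
  exact ⟨_, b, he x hx, hb⟩

theorem SU3Structure.exists_rotated (s : SU3Structure M) {α β : ℝ} (hαβ : α ^ 2 + β ^ 2 = 1)
    (x : M) : ∃ (e : Fin 6 → E6 [⋀^Fin 1]→L[ℝ] ℝ) (b : Module.Basis (Fin 6) ℝ E6),
      IsAdaptedCoframe e (s.metric x) (s.omega x) (α • s.psiPlus x - β • s.psiMinus x)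
        (β • s.psiPlus x + α • s.psiMinus x) ∧ IsDual e b := by
  obtain ⟨e, b, he, -⟩ := s.exists_adapted x
  have he' := IsAdaptedCoframe.rotate (by simp) he hαβ
  obtain ⟨b', hb'⟩ := he'.exists_isDual (by simp)
  exact ⟨_, b', he', hb'⟩

theorem star6_add {p q : ℕ} (h : q + p = 6) (s : SU3Structure M) (η ξ : Form (𝓡 6) M p) (x : M) :
    star6 h s (fun y => η y + ξ y) x = star6 h s η x + star6 h s ξ x :=
  hodgeStar_add _ _ _ _

theorem star6_smul {p q : ℕ} (h : q + p = 6) (s : SU3Structure M) (c : ℝ) (η : Form (𝓡 6) M p)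
    (x : M) : star6 h s (fun y => c • η y) x = c • star6 h s η x :=
  hodgeStar_smul _ _ _ _

variable [IsManifold (𝓡 6) ∞ M]

-- The star is defined through a basis chosen separately at each point, so its regularity is not
-- visible from the definition. A smooth local coframe expresses it as a finite sum of products and
-- quotients of differentiable coefficients.
set_option maxRecDepth 4000 in
theorem formDifferentiableAt_star6 (s : SU3Structure M) {γ : Form (𝓡 6) M 3} {x : M}
    (hγ : FormDifferentiableAt (𝓡 6) γ x) :
    FormDifferentiableAt (𝓡 6) (star6 (p := 3) (q := 3) rfl s γ) x := by
  have : IsManifold (𝓡 6) 1 M := .of_le (n := ∞) (by simp)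
  obtain ⟨U, hU, hx, e, hsm, he⟩ := s.exists_coframe x
  obtain ⟨b, hb⟩ := (he x hx).exists_isDual (by simp)
  have hde : ∀ i, FormDifferentiableAt (𝓡 6) (e i) x := fun i =>
    (hsm i).formDifferentiableAt hU hx
  have hmono : ∀ i j k, FormDifferentiableAt (𝓡 6) (fun y => mono3 (fun i => e i y) i j k) x :=
    fun i j k => ((hde i).wedge (hde j)).wedge (hde k)
  have hω := s.smooth_omega.formDifferentiableAt x
  have hvol : FormDifferentiableAt (𝓡 6) (fun y => vol6 (s.omega y)) x := by
    have h1 : FormDifferentiableAt (𝓡 6) (fun y => sq (s.omega y)) x := hω.wedge hω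
    have h2 : FormDifferentiableAt (𝓡 6) (fun y => wedge (sq (s.omega y)) (s.omega y)) x :=
      h1.wedge hω
    exact h2.const_smul (k := 6) (1 / 6 : ℝ)
  have happ : ∀ {k : ℕ} {η : Form (𝓡 6) M k} (v : Fin k → E6), FormDifferentiableAt (𝓡 6) η x →
      DifferentiableAt ℝ (fun y => coordForm (𝓡 6) η x y v) (extChartAt (𝓡 6) x x) :=
    fun v hη => (ContinuousAlternatingMap.apply ℝ E6 ℝ v).differentiableAt.comp _ hη
  -- `F` is the volume form on the fixed vectors `b i`. These form the dual basis at x only, so `F`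
  -- is 1 at x and hence nonzero nearby, which permits the division.
  obtain ⟨F, hFe⟩ : ∃ F : E6 → ℝ, F = fun y =>
      coordForm (𝓡 6) (fun y => vol6 (s.omega y)) x y (fun i => b i) := ⟨_, rfl⟩
  have hF : DifferentiableAt ℝ F (extChartAt (𝓡 6) x x) := hFe ▸ happ (fun i => b i) hvol
  have hne : F (extChartAt (𝓡 6) x x) ≠ 0 := by
    have h := (he x hx).ev_vol6 hb
    rw [hFe]
    simp only []
    rw [coordForm_self, ← ev_ofFn (vol6 (s.omega x)), List.ofFn_eq_map, h]
    exact one_ne_zero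
  obtain ⟨A, hAe⟩ : ∃ A : Fin 6 × Fin 6 × Fin 6 → E6 → ℝ, A = fun t y =>
      coordForm (𝓡 6) (fun y => wedge (mono3 (fun i => e i y) t.1 t.2.1 t.2.2) (γ y)) x y
        (fun i => b i) := ⟨_, rfl⟩
  have hA : ∀ t, DifferentiableAt ℝ (A t) (extChartAt (𝓡 6) x x) := by
    intro t
    have h := (hmono t.1 t.2.1 t.2.2).wedge hγ
    rw [hAe]
    exact happ (k := 6) (fun i => b i) h
  have heq : coordForm (𝓡 6) (star6 (p := 3) (q := 3) rfl s γ) x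
      =ᶠ[nhds (extChartAt (𝓡 6) x x)] fun y => ∑ t ∈ IsAdaptedCoframe.triples,
        (-(A t y * (F y)⁻¹)) •
        coordForm (𝓡 6) (fun y => mono3 (fun i => e i y) t.1 t.2.1 t.2.2) x y := by
    have hUn : ∀ᶠ y in nhds (extChartAt (𝓡 6) x x), (extChartAt (𝓡 6) x).symm y ∈ U :=
      (continuousAt_extChartAt_symm x).preimage_mem_nhds
        (hU.mem_nhds (by rwa [extChartAt_to_inv]))
    filter_upwards [hUn, hF.continuousAt.eventually_ne hne] with y hy hy'
    obtain ⟨b', hb'⟩ := (he _ hy).exists_isDual (by simp)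
    rw [hFe] at hy' ⊢
    rw [hAe]
    simp only [coordForm, star6] at hy' ⊢
    have key := (he _ hy).star_comp_eq_sum hb' (γ ((extChartAt (𝓡 6) x).symm y))
      (mfderivWithin 𝓘(ℝ, E6) (𝓡 6) (extChartAt (𝓡 6) x).symm (Set.range (𝓡 6)) y : E6 →L[ℝ] E6)
      (fun i => b i)
    exact key hy'
  refine DifferentiableAt.congr_of_eventuallyEq ?_ heq
  exact DifferentiableAt.fun_sum fun t _ => DifferentiableAt.fun_smul
    (((hA t).mul (hF.inv hne)).neg) (hmono t.1 t.2.1 t.2.2)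

end StarSix

/-! ### Warped `G₂`-structures -/

section Warped

variable {M : Type*} [TopologicalSpace M] [ChartedSpace E6 M]
  {α β f : ℝ} (s : SU3Structure M)

/-- The 3-form `α ψ₊ - β ψ₋`. -/
def SU3Structure.psi (α β : ℝ) : Form (𝓡 6) M 3 := fun x => α • s.psiPlus x - β • s.psiMinus x

/-- The 3-form `β ψ₊ + α ψ₋`. -/
def SU3Structure.psiHat (α β : ℝ) : Form (𝓡 6) M 3 := fun x => β • s.psiPlus x + α • s.psiMinus x

/-- The warping function is moved into the covector, so that f ds is the unit seventh element of the
coframe and the star formulas for `lift` apply with no further factor. -/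
theorem warpedG2_apply (p : M × Circle) :
    warpedG2 α β f s p = lift (f • ds p.2) (s.psi α β p.1) (s.omega p.1) := by
  rw [warpedG2_eq, liftM, lift_smul_coframe]
  rfl

theorem isG2_warpedG2 (hαβ : α ^ 2 + β ^ 2 = 1) (hf : f ≠ 0)
    (p : M × Circle) : IsG2 (warpedG2 α β f s p) := by
  obtain ⟨e, b, he, hb⟩ := s.exists_rotated hαβ p.1
  obtain ⟨c, hc⟩ := exists_basis_ds hf p.2
  obtain ⟨g, vol, h, -⟩ := exists_induces_lift he hb hc
  rw [warpedG2_apply]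
  exact h.isG2

theorem star7_three (hαβ : α ^ 2 + β ^ 2 = 1) (hf : f ≠ 0)
    {η : Form I7 (M × Circle) 3} {A : Form (𝓡 6) M 3} {B : Form (𝓡 6) M 2}
    {p : M × Circle} (h : η p = lift (f • ds p.2) (A p.1) (B p.1)) :
    star7 I7 (p := 3) (q := 4) rfl (warpedG2 α β f s) η p =
      lift (f • ds p.2) (star6 (p := 2) (q := 4) rfl s B p.1)
        (star6 (p := 3) (q := 3) rfl s A p.1) := by
  obtain ⟨e, b, he, hb⟩ := s.exists_rotated hαβ p.1
  obtain ⟨c, hc⟩ := exists_basis_ds hf p.2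
  rw [star7, h, warpedG2_apply]
  exact star_lift_three he hb hc _ _

theorem star7_four (hαβ : α ^ 2 + β ^ 2 = 1) (hf : f ≠ 0)
    {η : Form I7 (M × Circle) 4} {A : Form (𝓡 6) M 4} {B : Form (𝓡 6) M 3}
    {p : M × Circle} (h : η p = lift (f • ds p.2) (A p.1) (B p.1)) :
    star7 I7 (p := 4) (q := 3) rfl (warpedG2 α β f s) η p =
      lift (f • ds p.2) (-star6 (p := 3) (q := 3) rfl s B p.1)
        (star6 (p := 4) (q := 2) rfl s A p.1) := by
  obtain ⟨e, b, he, hb⟩ := s.exists_rotated hαβ p.1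
  obtain ⟨c, hc⟩ := exists_basis_ds hf p.2
  rw [star7, h, warpedG2_apply]
  exact star_lift_four he hb hc _ _

theorem starPhi_warpedG2 (hαβ : α ^ 2 + β ^ 2 = 1) (hf : f ≠ 0)
    (p : M × Circle) : starPhi I7 (warpedG2 α β f s) p =
    lift (f • ds p.2) ((1 / 2 : ℝ) • s.omegaSq p.1) (s.psiHat α β p.1) := by
  obtain ⟨e, b, he, hb⟩ := s.exists_rotated hαβ p.1
  rw [starPhi, star7_three s hαβ hf (A := s.psi α β) (B := s.omega) (warpedG2_apply s p)]
  exact congrArg₂ (lift _) (he.star_omegaSq hb) (he.star_psiPlus hb)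

theorem starPhi_warpedG2_eq (hαβ : α ^ 2 + β ^ 2 = 1) (hf : f ≠ 0)
    : starPhi I7 (warpedG2 α β f s) =
    liftM (fun x => (1 / 2 : ℝ) • s.omegaSq x) (fun x => f • s.psiHat α β x) := by
  funext p
  rw [starPhi_warpedG2 s hαβ hf, lift_smul_coframe, liftM]

theorem star7_starPhi_warpedG2 (hαβ : α ^ 2 + β ^ 2 = 1) (hf : f ≠ 0)
    :
    star7 I7 (p := 4) (q := 3) rfl (warpedG2 α β f s) (starPhi I7 (warpedG2 α β f s)) =
      warpedG2 α β f s := by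
  funext p
  obtain ⟨e, b, he, hb⟩ := s.exists_rotated hαβ p.1
  rw [star7_four s hαβ hf (A := fun x => (1 / 2 : ℝ) • s.omegaSq x) (B := s.psiHat α β)
    (starPhi_warpedG2 s hαβ hf p), star6_smul, warpedG2_apply]
  refine congrArg₂ (lift _) ?_ ?_
  · exact (congrArg Neg.neg (he.star_psiMinus hb)).trans (neg_neg _)
  · refine (congrArg ((1 / 2 : ℝ) • ·) (he.star_sq hb)).trans ?_
    rw [smul_smul]
    norm_num

end Warped

/-! ### Differentials of the forms of an SU(3)-structure. -/

section Differentials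

variable {M : Type*} [TopologicalSpace M] [ChartedSpace E6 M]
  {α β : ℝ} (s : SU3Structure M)

theorem formDifferentiableAt_psi (x : M) : FormDifferentiableAt (𝓡 6) (s.psi α β) x :=
  ((s.smooth_psiPlus.const_smul α).sub (s.smooth_psiMinus.const_smul β)).formDifferentiableAt x

theorem formDifferentiableAt_psiHat (x : M) : FormDifferentiableAt (𝓡 6) (s.psiHat α β) x :=
  ((s.smooth_psiPlus.const_smul β).add (s.smooth_psiMinus.const_smul α)).formDifferentiableAt x

theorem formDifferentiableAt_omegaSq (x : M) : FormDifferentiableAt (𝓡 6) s.omegaSq x :=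
  (s.smooth_omega.formDifferentiableAt x).wedge (s.smooth_omega.formDifferentiableAt x)

variable [IsManifold (𝓡 6) ∞ M]

theorem isSmooth_warpedG2 (f : ℝ) : IsSmooth I7 (warpedG2 α β f s) := by
  rw [warpedG2_eq]
  exact isSmooth_liftM ((s.smooth_psiPlus.const_smul α).sub (s.smooth_psiMinus.const_smul β))
    (s.smooth_omega.const_smul f)

theorem extD_psi (x : M) : extD (𝓡 6) (s.psi α β) x =
    α • extD (𝓡 6) s.psiPlus x - β • extD (𝓡 6) s.psiMinus x := by
  have : IsManifold (𝓡 6) 1 M := .of_le (n := ∞) (by simp)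
  unfold SU3Structure.psi
  rw [extD_sub ((s.smooth_psiPlus.const_smul α).formDifferentiableAt x)
    ((s.smooth_psiMinus.const_smul β).formDifferentiableAt x), extD_smul, extD_smul]

theorem extD_psiHat (x : M) : extD (𝓡 6) (s.psiHat α β) x =
    β • extD (𝓡 6) s.psiPlus x + α • extD (𝓡 6) s.psiMinus x := by
  have : IsManifold (𝓡 6) 1 M := .of_le (n := ∞) (by simp)
  unfold SU3Structure.psiHat
  rw [extD_add ((s.smooth_psiPlus.const_smul β).formDifferentiableAt x)
    ((s.smooth_psiMinus.const_smul α).formDifferentiableAt x), extD_smul, extD_smul]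

theorem extD_omegaSq (x : M) : extD (𝓡 6) s.omegaSq x =
    (2 : ℝ) • wedge (extD (𝓡 6) s.omega x) (s.omega x) := by
  have : IsManifold (𝓡 6) 1 M := .of_le (n := ∞) (by simp)
  have hω := s.smooth_omega.formDifferentiableAt x
  refine ev_ext fun l => ?_
  refine (ev_extD_wedge hω hω l).trans ?_
  rw [wedge_comm (s.omega x), ev_smul]
  norm_num
  ring

end Differentials

/-! ### The torsion forms of coclosed warped `G₂`-structures -/

section Coclosed

variable {M : Type*} [TopologicalSpace M] [ChartedSpace E6 M] {α β f : ℝ} {s : SU3Structure M}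

/-- The function `α π₀ - β σ₀`. -/
def SU3Torsion.p0 (T : SU3Torsion s) (α β : ℝ) : M → ℝ := fun y => α * T.pi0 y - β * T.sigma0 y

/-- The 2-form `α π₂ - β σ₂`. -/
def SU3Torsion.p2 (T : SU3Torsion s) (α β : ℝ) : Form (𝓡 6) M 2 :=
  fun y => α • T.pi2 y - β • T.sigma2 y

theorem IsOmega28.smul_add {σ τ : Form (𝓡 6) M 2} (hσ : IsOmega28 s σ) (hτ : IsOmega28 s τ)
    (a b : ℝ) : IsOmega28 s (fun x => a • σ x + b • τ x) := by
  intro x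
  obtain ⟨h1, h2⟩ := hσ x
  obtain ⟨h3, h4⟩ := hτ x
  refine ⟨?_, ?_⟩
  · rw [wedge_add_left, wedge_smul_left, wedge_smul_left, h1, h3, smul_zero, smul_zero, add_zero]
  · rw [star6_add, star6_smul, star6_smul, h2, h4, wedge_add_left, wedge_smul_left,
      wedge_smul_left]
    refine ev_ext fun l => ?_
    simp only [ev_add, ev_neg, ev_smul]
    ring

theorem isOmega28_p2 (T : SU3Torsion s) : IsOmega28 s (T.p2 α β) := by
  have h : T.p2 α β = fun x => α • T.pi2 x + (-β) • T.sigma2 x := by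
    funext x
    refine ev_ext fun l => ?_
    simp only [SU3Torsion.p2, ev_add, ev_sub, ev_smul]
    ring
  rw [h]
  exact T.pi2_mem.smul_add T.sigma2_mem α (-β)

/-- The relations between the torsion forms that express coclosedness. -/
structure SU3Torsion.Coclosed (T : SU3Torsion s) (α β : ℝ) (x : M) : Prop where
  sigma0_eq : T.sigma0 x = -β * T.p0 α β x
  pi0_eq : T.pi0 x = α * T.p0 α β x
  zero_eq : α * T.sigma0 x + β * T.pi0 x = 0
  two_eq : α • T.sigma2 x + β • T.pi2 x = 0
  nu1_eq : T.nu1 x = 0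
  pi1_eq : T.pi1 x = 0

theorem SU3Torsion.Coclosed.extD_omega {x : M} {T : SU3Torsion s} (h : T.Coclosed α β x) :
    extD (𝓡 6) s.omega x = (3 / 2 * T.p0 α β x) • s.psiHat α β x + T.nu3 x := by
  rw [T.extD_omega, h.sigma0_eq, h.pi0_eq, h.nu1_eq, wedge_zero_left]
  refine ev_ext fun l => ?_
  simp only [SU3Structure.psiHat, ev_add, ev_smul, ev_zero]
  ring

variable [IsManifold (𝓡 6) ∞ M]

-- The two parts of d⋆φ = 0 are dω ∧ ω = 0 and dψ̂ = 0. Wedging dω with ω kills every torsion term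
-- but ν₁ ∧ ω, so ν₁ = 0; the terms of dψ̂ lie in independent summands of Λ⁴, so each of them
-- vanishes.
set_option maxRecDepth 4000 in
theorem SU3Torsion.coclosed (T : SU3Torsion s) (hαβ : α ^ 2 + β ^ 2 = 1) (hf : f ≠ 0)
    (hco : IsCoclosed I7 (warpedG2 α β f s)) (x : M) : T.Coclosed α β x := by
  obtain ⟨e, b, he, hb⟩ := s.exists_rotated hαβ x
  obtain ⟨e', b', he', hb'⟩ := s.exists_adapted x
  -- The forms in question come from M, so evaluation over a single point of the circle is enough.
  obtain ⟨c, hc⟩ := exists_basis_ds one_ne_zero (1 : Circle)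
  rw [one_smul] at hc
  have hd := congrFun hco (x, 1)
  rw [starPhi_warpedG2_eq s hαβ hf,
    extD_liftM ((formDifferentiableAt_omegaSq s x).const_smul _)
      ((formDifferentiableAt_psiHat s x).const_smul _), extD_smul, extD_smul] at hd
  have h0 : (0 : Form I7 (M × Circle) 5) (x, 1) = lift (ds 1) (0 : E6 [⋀^Fin 5]→L[ℝ] ℝ) 0 := by
    have := lift_smul (ds 1) 0 (0 : E6 [⋀^Fin 5]→L[ℝ] ℝ) 0
    rw [zero_smul, zero_smul, zero_smul] at this
    exact this.symm
  obtain ⟨h1, h2⟩ := lift_injective b hc (hd.trans h0)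
  have h3 := (smul_eq_zero.1 h1).resolve_left (by norm_num)
  have h4 := (smul_eq_zero.1 h2).resolve_left hf
  rw [extD_omegaSq] at h3
  have h5 : wedge (extD (𝓡 6) s.omega x) (s.omega x) = 0 := ev_ext fun l => by
    have := congrArg (fun a => ev a l) h3
    simp only [ev_smul, ev_zero] at this ⊢
    linarith
  have hν : T.nu1 x = 0 := by
    refine he.eq_zero_of_wedge_omega_omega hb ?_
    rw [T.extD_omega, wedge_add_left, wedge_add_left, wedge_add_left, wedge_smul_left,
      wedge_smul_left, he'.psiPlus_wedge_omega hb', he'.psiMinus_wedge_omega hb',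
      (T.nu3_mem x).1] at h5
    refine ev_ext fun l => ?_
    have h6 := congrArg (fun a => ev a l) h5
    simp only [ev_add, ev_smul] at h6
    have h7 : ev (0 : E6 [⋀^Fin 5]→L[ℝ] ℝ) l = 0 := ev_zero l
    linear_combination h6 + (3 / 2 * T.sigma0 x - 3 / 2 * T.pi0 x - 1) * h7
  have h6 : (β * T.pi0 x + α * T.sigma0 x) • sq (s.omega x) +
      wedge (T.pi1 x) (β • s.psiPlus x + α • s.psiMinus x) -
      wedge (α • T.sigma2 x + β • T.pi2 x) (s.omega x) = 0 := by
    rw [← h4, extD_psiHat, T.extD_psiPlus, T.extD_psiMinus, wedge_add_left, wedge_add_right]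
    simp only [wedge_smul_left, wedge_smul_right]
    refine ev_ext fun l => ?_
    simp only [ev_add, ev_sub, ev_smul, SU3Structure.omegaSq]
    ring
  obtain ⟨k1, k2, k3⟩ := he.decomposition hb ((T.sigma2_mem.smul_add T.pi2_mem α β x).2) h6
  -- The vector (σ₀, π₀) is orthogonal to the unit vector (α, β), hence a multiple of (−β, α), with
  -- factor p₀.
  refine ⟨?_, ?_, by linarith, k3, hν, k2⟩ <;> simp only [SU3Torsion.p0]
  · linear_combination (-T.sigma0 x) * hαβ + α * k1
  · linear_combination (-T.pi0 x) * hαβ + β * k1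

variable {x : M}

theorem SU3Torsion.Coclosed.extD_psi {T : SU3Torsion s} (h : T.Coclosed α β x) :
    extD (𝓡 6) (s.psi α β) x =
      T.p0 α β x • s.omegaSq x - wedge (T.p2 α β x) (s.omega x) := by
  rw [WarpedCoflow.extD_psi, T.extD_psiPlus, T.extD_psiMinus, h.pi1_eq, wedge_zero_left,
    wedge_zero_left, SU3Torsion.p2, wedge_sub_left, wedge_smul_left, wedge_smul_left]
  refine ev_ext fun l => ?_
  simp only [SU3Torsion.p0, ev_add, ev_sub, ev_smul, ev_zero]
  ring

/-- The codifferential has sign +1 on 4-forms, and ⋆⋆φ = φ, so this form is ⋆dφ; both parts of dφ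
are known from the reduced torsion equations. -/
theorem codiff_starPhi (T : SU3Torsion s) (hαβ : α ^ 2 + β ^ 2 = 1) (hf : f ≠ 0)
    (h : ∀ x, T.Coclosed α β x) :
    codiff I7 (k := 3) (q := 3) rfl (warpedG2 α β f s) (starPhi I7 (warpedG2 α β f s)) =
      liftM (fun x => (3 / 2 : ℝ) • (T.p0 α β x • s.psi α β x) -
          star6 (p := 3) (q := 3) rfl s T.nu3 x)
        (fun x => f • ((2 : ℝ) • (T.p0 α β x • s.omega x) + T.p2 α β x)) := by
  rw [codiff, star7_starPhi_warpedG2 s hαβ hf]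
  funext p
  obtain ⟨e, b, he, hb⟩ := s.exists_rotated hαβ p.1
  have h1 : extD I7 (warpedG2 α β f s) p = lift (f • ds p.2)
      (T.p0 α β p.1 • s.omegaSq p.1 - wedge (T.p2 α β p.1) (s.omega p.1))
      ((3 / 2 * T.p0 α β p.1) • s.psiHat α β p.1 + T.nu3 p.1) := by
    rw [warpedG2_eq, lift_smul_coframe, ← (h p.1).extD_omega, ← (h p.1).extD_psi, ← extD_smul]
    exact extD_liftM (formDifferentiableAt_psi s p.1)
      ((s.smooth_omega.formDifferentiableAt p.1).const_smul f)
  have h2 := star7_four s hαβ hf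
    (A := fun x => T.p0 α β x • s.omegaSq x - wedge (T.p2 α β x) (s.omega x))
    (B := fun x => (3 / 2 * T.p0 α β x) • s.psiHat α β x + T.nu3 x) h1
  have h3 : star6 (p := 3) (q := 3) rfl s
      (fun x => (3 / 2 * T.p0 α β x) • s.psiHat α β x + T.nu3 x) p.1 =
      -((3 / 2 : ℝ) • (T.p0 α β p.1 • s.psi α β p.1)) +
        star6 (p := 3) (q := 3) rfl s T.nu3 p.1 := by
    have := he.star_psiMinus hb
    refine (hodgeStar_add _ _ _ _).trans ?_
    rw [hodgeStar_smul]
    refine congrArg₂ (· + ·) ((congrArg (_ • ·) this).trans ?_) rfl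
    refine ev_ext fun l => ?_
    simp only [ev_smul, ev_neg, SU3Structure.psi]
    ring
  have h4 : star6 (p := 4) (q := 2) rfl s
      (fun x => T.p0 α β x • s.omegaSq x - wedge (T.p2 α β x) (s.omega x)) p.1 =
      (2 : ℝ) • (T.p0 α β p.1 • s.omega p.1) + T.p2 α β p.1 := by
    -- As p₂ lies in Ω²₈, −p₂ ∧ ω = ⋆₆p₂, and a second star returns p₂ itself.
    have k1 := he.star_sq hb
    have k2 := he.star_star hb (p := 2) (q := 4) rfl rfl (by simp) (by simp) (T.p2 α β p.1)
    have k3 := (isOmega28_p2 (α := α) (β := β) T p.1).2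
    have k4 : T.p0 α β p.1 • s.omegaSq p.1 - wedge (T.p2 α β p.1) (s.omega p.1) =
        T.p0 α β p.1 • sq (s.omega p.1) + star6 (p := 2) (q := 4) rfl s (T.p2 α β) p.1 := by
      rw [k3, ← sub_eq_add_neg]; rfl
    refine (congrArg (hodgeStar _ _) k4).trans ?_
    rw [hodgeStar_add, hodgeStar_smul]
    refine (congrArg₂ (· + ·) (congrArg (_ • ·) k1) k2).trans ?_
    refine ev_ext fun l => ?_
    simp only [ev_smul, ev_add]
    ring
  rw [Pi.smul_apply, h2, h3, h4, lift_smul_coframe, liftM, ← lift_smul]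
  refine congrArg₂ (lift _) ?_ ?_
  · refine ev_ext fun l => ?_
    simp only [ev_smul, ev_add, ev_sub, ev_neg]
    ring
  · refine ev_ext fun l => ?_
    simp only [ev_smul, ev_add]
    ring

theorem codiff_zero {k q : ℕ} (h : q + (k + 1) = 7) (φ : Form I7 (M × Circle) 3) :
    codiff I7 h φ (0 : Form I7 (M × Circle) (k + 1)) = 0 := by
  have h0 : ∀ {p q : ℕ} (h : q + p = 7), star7 I7 h φ (0 : Form I7 (M × Circle) p) = 0 := by
    intro p q h
    funext x
    have := hodgeStar_smul (g2Metric (φ x)) (castDeg h.symm (g2Vol (φ x))) 0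
      (0 : (E6 × E1) [⋀^Fin p]→L[ℝ] ℝ)
    rw [zero_smul, zero_smul] at this
    exact this
  have : IsManifold (𝓡 6) 1 M := .of_le (n := ∞) (by simp)
  have : IsManifold (𝓡 1) 1 Circle := .of_le (n := ω) (by simp)
  have h1 : extD I7 (0 : Form I7 (M × Circle) q) = 0 := funext fun x => extD_zero
  rw [codiff, h0, h1, h0, smul_zero]

/-- Since ⋆φ is closed only d d^* contributes. The terms with `funD` come from the Leibniz rule, as
p₀ varies over M. -/
theorem laplacian_starPhi (T : SU3Torsion s) (hαβ : α ^ 2 + β ^ 2 = 1) (hf : f ≠ 0)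
    (hco : IsCoclosed I7 (warpedG2 α β f s)) (p : M × Circle) :
    laplacian4 I7 (warpedG2 α β f s) (starPhi I7 (warpedG2 α β f s)) p =
      lift (ds p.2)
        ((3 / 2 : ℝ) • (wedge (funD (𝓡 6) (T.p0 α β) p.1) (s.psi α β p.1) + T.p0 α β p.1 •
            (T.p0 α β p.1 • s.omegaSq p.1 - wedge (T.p2 α β p.1) (s.omega p.1))) -
          extD (𝓡 6) (star6 (p := 3) (q := 3) rfl s T.nu3) p.1)
        (f • ((2 : ℝ) • (wedge (funD (𝓡 6) (T.p0 α β) p.1) (s.omega p.1) + T.p0 α β p.1 •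
            ((3 / 2 * T.p0 α β p.1) • s.psiHat α β p.1 + T.nu3 p.1)) +
          extD (𝓡 6) (T.p2 α β) p.1)) := by
  have : IsManifold (𝓡 6) 1 M := .of_le (n := ∞) (by simp)
  have hT := T.coclosed hαβ hf hco
  have hp0 : MDifferentiableAt (𝓡 6) 𝓘(ℝ, ℝ) (T.p0 α β) p.1 :=
    ((contMDiff_const.mul T.smooth_pi0).sub
      (contMDiff_const.mul T.smooth_sigma0)).mdifferentiableAt (by simp)
  have hp2 : FormDifferentiableAt (𝓡 6) (T.p2 α β) p.1 :=
    ((T.smooth_pi2.const_smul α).sub (T.smooth_sigma2.const_smul β)).formDifferentiableAt p.1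
  have hω := s.smooth_omega.formDifferentiableAt p.1
  have hψ := formDifferentiableAt_psi (α := α) (β := β) s p.1
  have hν := formDifferentiableAt_star6 s (T.smooth_nu3.formDifferentiableAt p.1)
  have h1 := (FormDifferentiableAt.smul_fun hp0 hψ).const_smul (3 / 2)
  have h2 := (FormDifferentiableAt.smul_fun hp0 hω).const_smul 2
  have hA : FormDifferentiableAt (𝓡 6) (fun x => (3 / 2 : ℝ) • (T.p0 α β x • s.psi α β x) -
          star6 (p := 3) (q := 3) rfl s T.nu3 x) p.1 := DifferentiableAt.sub h1 hν
  rw [laplacian4, hco, codiff_zero, add_zero, codiff_starPhi T hαβ hf hT,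
    extD_liftM hA ((h2.add hp2).const_smul f), extD_smul, extD_add h2 hp2, extD_smul,
    extD_sub h1 hν, extD_smul, ← (hT p.1).extD_omega, ← (hT p.1).extD_psi]
  have h3 : extD (𝓡 6) (fun y => T.p0 α β y • s.psi α β y) p.1 =
      wedge (funD (𝓡 6) (T.p0 α β) p.1) (s.psi α β p.1) +
        T.p0 α β p.1 • extD (𝓡 6) (s.psi α β) p.1 :=
    ev_ext fun l => by
      rw [ev_add, ev_smul]
      exact (ev_extD_smul_fun hp0 hψ l)
  have h4 : extD (𝓡 6) (fun y => T.p0 α β y • s.omega y) p.1 =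
      wedge (funD (𝓡 6) (T.p0 α β) p.1) (s.omega p.1) +
        T.p0 α β p.1 • extD (𝓡 6) s.omega p.1 :=
    ev_ext fun l => by
      rw [ev_add, ev_smul]
      exact (ev_extD_smul_fun hp0 hω l)
  rw [h3, h4]

end Coclosed

/-! ### Time derivatives and the flow equations -/

section Time

theorem uniqueDiffOn_of_ordConnected {J : Set ℝ} (hJ : J.OrdConnected) (hJ' : J.Nontrivial) :
    UniqueDiffOn ℝ J := by
  obtain ⟨a, ha, b, hb, hab⟩ := hJ'.exists_lt
  refine uniqueDiffOn_convex hJ.convex ⟨(a + b) / 2, mem_interior.2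
    ⟨Set.Ioo a b, Set.Ioo_subset_Icc_self.trans (hJ.out ha hb), isOpen_Ioo, ?_⟩⟩
  constructor <;> linarith

theorem hasDerivWithinAt_lift {V U : Type*} [NormedAddCommGroup V] [NormedSpace ℝ V]
    [NormedAddCommGroup U] [NormedSpace ℝ U] {k : ℕ} (θ : U [⋀^Fin 1]→L[ℝ] ℝ)
    {A : ℝ → V [⋀^Fin (k + 1)]→L[ℝ] ℝ} {B : ℝ → V [⋀^Fin k]→L[ℝ] ℝ}
    {A' : V [⋀^Fin (k + 1)]→L[ℝ] ℝ} {B' : V [⋀^Fin k]→L[ℝ] ℝ} {J : Set ℝ} {t : ℝ}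
    (hA : HasDerivWithinAt A A' J t) (hB : HasDerivWithinAt B B' J t) :
    HasDerivWithinAt (fun τ => lift θ (A τ) (B τ)) (lift θ A' B') J t := by
  have h1 := (ContinuousAlternatingMap.compContinuousLinearMapCLM (ι := Fin (k + 1)) (F := ℝ)
    (ContinuousLinearMap.fst ℝ V U)).hasFDerivAt.comp_hasDerivWithinAt t hA
  have h2 := (ContinuousAlternatingMap.compContinuousLinearMapCLM (ι := Fin k) (F := ℝ)
    (ContinuousLinearMap.fst ℝ V U)).hasFDerivAt.comp_hasDerivWithinAt t hB
  have h3 := ((wedgeCLM (V × U) k 1).flip (θ.compContinuousLinearMap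
    (ContinuousLinearMap.snd ℝ V U))).hasFDerivAt.comp_hasDerivWithinAt t h2
  exact h1.add h3

theorem differentiableWithinAt_wedge {W V : Type*} [NormedAddCommGroup V] [NormedSpace ℝ V]
    [NormedAddCommGroup W] [NormedSpace ℝ W] {p q : ℕ} {a : W → V [⋀^Fin p]→L[ℝ] ℝ}
    {b : W → V [⋀^Fin q]→L[ℝ] ℝ} {J : Set W} {t : W} (ha : DifferentiableWithinAt ℝ a J t)
    (hb : DifferentiableWithinAt ℝ b J t) :
    DifferentiableWithinAt ℝ (fun τ => wedge (a τ) (b τ)) J t := by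
  have h := (contDiff_wedge V p q).differentiable (by simp) (a t, b t)
  have h2 := h.comp_differentiableWithinAt t (ha.prodMk hb)
  exact h2

variable {M : Type*} [TopologicalSpace M] [ChartedSpace E6 M] {J : Set ℝ} {α β : ℝ} {f : ℝ → ℝ}
  {s : ℝ → SU3Structure M} {t : ℝ}

theorem hasDerivWithinAt_starPhi (hαβ : α ^ 2 + β ^ 2 = 1) (hf : ∀ t ∈ J, f t ≠ 0)
    (hf' : DifferentiableOn ℝ f J) (hω : TimeDifferentiable J (fun t => (s t).omega))
    (hψp : TimeDifferentiable J (fun t => (s t).psiPlus))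
    (hψm : TimeDifferentiable J (fun t => (s t).psiMinus)) (ht : t ∈ J) (p : M × Circle) :
    HasDerivWithinAt (fun τ => starPhi I7 (warpedG2 α β (f τ) (s τ)) p)
      (lift (ds p.2) ((1 / 2 : ℝ) • timeDeriv J (fun τ => (s τ).omegaSq) t p.1)
        (f t • (β • timeDeriv J (fun τ => (s τ).psiPlus) t p.1 +
            α • timeDeriv J (fun τ => (s τ).psiMinus) t p.1) +
          derivWithin f J t • (s t).psiHat α β p.1)) J t := by
  have h1 : HasDerivWithinAt (fun τ => (s τ).omegaSq p.1)
      (timeDeriv J (fun τ => (s τ).omegaSq) t p.1) J t :=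
    (differentiableWithinAt_wedge (hω p.1 t ht) (hω p.1 t ht)).hasDerivWithinAt
  have h2 := ((hψp p.1 t ht).hasDerivWithinAt.const_smul β).add
    ((hψm p.1 t ht).hasDerivWithinAt.const_smul α)
  have h3 := (hf' t ht).hasDerivWithinAt.smul h2
  refine (hasDerivWithinAt_lift (ds p.2) (h1.const_smul (1 / 2 : ℝ)) h3).congr_of_mem
    (fun τ hτ => ?_) ht
  rw [starPhi_warpedG2_eq (s τ) hαβ (hf τ hτ)]
  rfl

variable [IsManifold (𝓡 6) ∞ M]

/-- Derivatives within J are unique, so the flow equation equates the derivative of ⋆φ computed from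
the data with −Δ⋆φ. Both have the shape A + B ∧ ds, and `lift_injective` separates the two parts. -/
theorem isLaplacianCoflow_iff (hJ : UniqueDiffOn ℝ J) (hαβ : α ^ 2 + β ^ 2 = 1)
    (hf : ∀ t ∈ J, f t ≠ 0) (hf' : DifferentiableOn ℝ f J)
    (hω : TimeDifferentiable J (fun t => (s t).omega))
    (hψp : TimeDifferentiable J (fun t => (s t).psiPlus))
    (hψm : TimeDifferentiable J (fun t => (s t).psiMinus)) (T : ∀ t, SU3Torsion (s t))
    (hco : ∀ t ∈ J, IsCoclosed I7 (warpedG2 α β (f t) (s t))) :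
    IsLaplacianCoflow I7 J (fun t => warpedG2 α β (f t) (s t)) ↔ ∀ t ∈ J, ∀ x,
      (1 / 2 : ℝ) • timeDeriv J (fun τ => (s τ).omegaSq) t x =
        -((3 / 2 : ℝ) • (wedge (funD (𝓡 6) ((T t).p0 α β) x) ((s t).psi α β x) + (T t).p0 α β x •
            ((T t).p0 α β x • (s t).omegaSq x - wedge ((T t).p2 α β x) ((s t).omega x))) -
          extD (𝓡 6) (star6 (p := 3) (q := 3) rfl (s t) (T t).nu3) x) ∧
      f t • (β • timeDeriv J (fun τ => (s τ).psiPlus) t x +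
            α • timeDeriv J (fun τ => (s τ).psiMinus) t x) +
          derivWithin f J t • (s t).psiHat α β x =
        -(f t • ((2 : ℝ) • (wedge (funD (𝓡 6) ((T t).p0 α β) x) ((s t).omega x) +
            (T t).p0 α β x • ((3 / 2 * (T t).p0 α β x) • (s t).psiHat α β x + (T t).nu3 x)) +
          extD (𝓡 6) ((T t).p2 α β) x)) := by
  have hneg : ∀ (z : Circle) (A : E6 [⋀^Fin 4]→L[ℝ] ℝ) (B : E6 [⋀^Fin 3]→L[ℝ] ℝ),
      -lift (ds z) A B = lift (ds z) (-A) (-B) := by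
    intro z A B
    have := lift_smul (ds z) (-1) A B
    have hn : ∀ {V : Type} [NormedAddCommGroup V] [NormedSpace ℝ V] {m : ℕ}
        (a : V [⋀^Fin m]→L[ℝ] ℝ), (-1 : ℝ) • a = -a := fun a =>
      ev_ext fun l => by rw [ev_smul, ev_neg, neg_one_mul]
    rw [hn, hn, hn] at this
    exact this.symm
  refine forall₂_congr fun t ht => ?_
  have hder := hasDerivWithinAt_starPhi hαβ hf hf' hω hψp hψm ht
  constructor
  · intro h x
    obtain ⟨e, b, -, -⟩ := (s t).exists_adapted x
    obtain ⟨c, hc⟩ := exists_basis_ds one_ne_zero (1 : Circle)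
    rw [one_smul] at hc
    have h1 := (hJ t ht).eq_deriv _ (hder (x, 1)) (h.2.2 (x, 1))
    rw [laplacian_starPhi (T t) hαβ (hf t ht) (hco t ht), hneg] at h1
    exact lift_injective b hc h1
  · intro h
    refine ⟨⟨isSmooth_warpedG2 (s t) (f t), isG2_warpedG2 (s t) hαβ (hf t ht)⟩, hco t ht,
      fun p => ?_⟩
    rw [laplacian_starPhi (T t) hαβ (hf t ht) (hco t ht), hneg, ← (h p.1).1, ← (h p.1).2]
    exact hder p

end Time

end WarpedCoflow

end

open WarpedCoflow in
theorem mainTheorem5 {M : Type*} [TopologicalSpace M] [ChartedSpace E6 M]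
    [IsManifold (𝓡 6) ∞ M]
    (J : Set ℝ) (hJ : J.OrdConnected) (hJ' : J.Nontrivial)
    (α β : ℝ) (hαβ : α ^ 2 + β ^ 2 = 1)
    (f : ℝ → ℝ) (hf : ∀ t ∈ J, f t ≠ 0) (hf' : DifferentiableOn ℝ f J)
    (s : ℝ → SU3Structure M)
    (hω : TimeDifferentiable J (fun t => (s t).omega))
    (hψp : TimeDifferentiable J (fun t => (s t).psiPlus))
    (hψm : TimeDifferentiable J (fun t => (s t).psiMinus))
    (T : ∀ t, SU3Torsion (s t))
    (hco : ∀ t ∈ J, IsCoclosed I7 (warpedG2 α β (f t) (s t))) :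
    (∀ t ∈ J, ∀ x,
      α * (T t).sigma0 x + β * (T t).pi0 x = 0 ∧
      α • (T t).sigma2 x + β • (T t).pi2 x = 0) ∧
    (IsLaplacianCoflow I7 J (fun t => warpedG2 α β (f t) (s t)) ↔
      ∀ t ∈ J, ∀ x,
        timeDeriv J (fun τ => (s τ).omegaSq) t x =
          (-3 * (α * (T t).pi0 x - β * (T t).sigma0 x) ^ 2) • (s t).omegaSq x
          + (3 * (α * (T t).pi0 x - β * (T t).sigma0 x)) •
              wedge (α • (T t).pi2 x - β • (T t).sigma2 x) ((s t).omega x)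
          + (2 : ℝ) • extD (𝓡 6) (star6 (p := 3) (q := 3) rfl (s t) (T t).nu3) x
          - (3 : ℝ) • wedge (funD (𝓡 6) (fun y => α * (T t).pi0 y - β * (T t).sigma0 y) x)
              (α • (s t).psiPlus x - β • (s t).psiMinus x) ∧
        (derivWithin f J t / f t) • (β • (s t).psiPlus x + α • (s t).psiMinus x)
          + (β • timeDeriv J (fun τ => (s τ).psiPlus) t x
            + α • timeDeriv J (fun τ => (s τ).psiMinus) t x) =
          -((α * (T t).pi0 x - β * (T t).sigma0 x) •
              ((-3 * (T t).sigma0 x) • (s t).psiPlus x + (3 * (T t).pi0 x) • (s t).psiMinus x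
                + (2 : ℝ) • (T t).nu3 x))
          - extD (𝓡 6) (α • (T t).pi2 - β • (T t).sigma2) x
          - (2 : ℝ) • wedge (funD (𝓡 6) (fun y => α * (T t).pi0 y - β * (T t).sigma0 y) x)
              ((s t).omega x)) := by
  have hT := fun t ht => (T t).coclosed hαβ (hf t ht) (hco t ht)
  refine ⟨fun t ht x => ⟨(hT t ht x).zero_eq, (hT t ht x).two_eq⟩, ?_⟩
  rw [isLaplacianCoflow_iff (uniqueDiffOn_of_ordConnected hJ hJ') hαβ hf hf' hω hψp hψm T hco]
  refine forall₂_congr fun t ht => forall_congr' fun x => and_congr ?_ ?_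
  -- The first component is the evolution of ω²/2, so the two equations differ by the factor 2.
  · change _ ↔ _ = (-3 * ((T t).p0 α β x) ^ 2) • (s t).omegaSq x
      + (3 * (T t).p0 α β x) • wedge ((T t).p2 α β x) ((s t).omega x)
      + (2 : ℝ) • extD (𝓡 6) (star6 (p := 3) (q := 3) rfl (s t) (T t).nu3) x
      - (3 : ℝ) • wedge (funD (𝓡 6) ((T t).p0 α β) x) ((s t).psi α β x)
    constructor <;> intro h <;> refine ev_ext fun l => ?_ <;>
      have h' := congrArg (fun a => ev a l) h <;>
      simp only [ev_add, ev_sub, ev_smul, ev_neg] at h' ⊢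
    · linear_combination 2 * h'
    · linear_combination h' / 2
  -- With σ₀ = −βp₀ and π₀ = αp₀, the terms −3σ₀ψ₊ + 3π₀ψ₋ become 3p₀ψ̂. The remaining difference
  -- between the equations is the factor f ≠ 0.
  · rw [(hT t ht x).sigma0_eq, (hT t ht x).pi0_eq]
    change _ ↔ (derivWithin f J t / f t) • (s t).psiHat α β x + _ = -((α * (α * (T t).p0 α β x) -
        β * (-β * (T t).p0 α β x)) • _) - extD (𝓡 6) ((T t).p2 α β) x
          - (2 : ℝ) • wedge (funD (𝓡 6) ((T t).p0 α β) x) ((s t).omega x)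
    have hp : α * (α * (T t).p0 α β x) - β * (-β * (T t).p0 α β x) = (T t).p0 α β x := by
      linear_combination (T t).p0 α β x * hαβ
    rw [hp]
    have hft := hf t ht
    constructor <;> intro h <;> refine ev_ext fun l => ?_ <;>
      have h' := congrArg (fun a => ev a l) h <;>
      simp only [SU3Structure.psiHat, ev_add, ev_sub, ev_smul, ev_neg] at h' ⊢
    · field_simp
      linear_combination h'
    · field_simp at h'
      linear_combination h'
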